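/- **Notation.** A strict partition is a sequence $\lambda=(\lambda_1>\dots>\lambda_l)$ of positive integers; $l(\lambda)=l$, and $\lambda_i=0$ for $i>l$. Write $\mu\subset\lambda$ if $\mu_i\le\lambda_i$ for all $i$. For $l(\lambda)\le n$ let $$ P^C_\lambda(x_1,\dots,x_n;t)=\frac1{v_\lambda^{(n)}(t)}\sum_{w\in W_n}w\left(\prod_{i=1}^n x_i^{\lambda_i}\prod_{i=1}^n\frac{1-tx_i^{-2}}{1-x_i^{-2}}\prod_{1\le i<j\le n}\frac{1-tx_i^{-1}x_j}{1-x_i^{-1}x_j}\cdot\frac{1-tx_i^{-1}x_j^{-1}}{1-x_i^{-1}x_j^{-1}}\right), $$ where $W_n$ is the hyperoctahedral group acting by permuting and inverting the variables, and $v^{(n)}_\lambda(t)=\prod_{i=1}^{m_0}\frac{1-t^{2i}}{1-t}\prod_{r\ge1}\prod_{i=1}^{m_r}\frac{1-t^i}{1-t}$, with $m_r$ the number of $i\in\{1,\dots,n\}$ with $\lambda_i=r$. Put $Q^C_\lambda(x_1,\dots,x_n)=2^{l(\lambda)}P^C_\lambda(x_1,\dots,x_n;-1)$. For an infinite set of variables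 $X$, the universal symplectic $Q$-function $Q^C_\lambda(X)$ is the unique symmetric function in $X$ with rational coefficients such that, for all $n\ge l(\lambda)$, specializing $2n$ of the variables to $x_1,\dots,x_n,x_1^{-1},\dots,x_n^{-1}$ and the others to $0$ yields $Q^C_\lambda(x_1,\dots,x_n)$. Let $R$ be a commutative $\mathbb Q$-algebra and $a=(a_0,a_1,\dots)$ a sequence in $R$ (for instance $R=\mathbb Q[a_0,a_1,\dots]$ with the $a_i$ indeterminates). With $e_k$ the elementary symmetric polynomials ($e_k=0$ for $k<0$), put $$ Q^C_\lambda(X|a)=\sum_{\mu\subset\lambda,\ l(\mu)=l(\lambda)}\det\big(e_{\lambda_i-\mu_j}(a_0,\dots,a_{\lambda_i-1})\big)_{1\le i,j\le l(\lambda)}\,Q^C_\mu(X), $$ where $\mu$ runs over strict partitions. Let $R^C_{r/k}(X|a)$ be $Q^C_{(r)}(X|a)$ if $k=0$ (with $(0)=\emptyset$), $Q^C_{(r-k)}(X|0,a_{k+1},\dots,a_{r-1})$ if $1\le k\le r-1$, $1$ if $k=r$, and $0$ if $k>r$; here one uses that $Q^C_{(s)}(X|a)$ depends only on $a_0,\dots,a_{s-1}$.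 For strict partitions $\lambda,\mu$ let $r=l(\lambda)$, and let $\beta=(\beta_1,\dots,\beta_s)$ be $\mu$ if $l(\lambda)+l(\mu)$ is even and $(\mu_1,\dots,\mu_{l(\mu)},0)$ if it is odd. Define the skew function $$ Q^C_{\lambda/\mu}(X|a)=\operatorname{Pf}\begin{pmatrix}K&M\\-{}^tM&O\end{pmatrix},\qquad M=\big(R^C_{\lambda_i/\beta_{s+1-j}}(X|a)\big)_{1\le i\le r,\,1\le j\le s}, $$ where $K$ is the $r\times r$ skew-symmetric matrix with entries $Q^C_{(\lambda_i,\lambda_j)}(X|a)$ for $i<j$. **Proposition.** Let $X$ and $Y$ be two disjoint infinite sets of variables, and let $\lambda$ and $\nu$ be strict partitions. Then $$ Q^C_\lambda(X\cup Y|a)=\sum_\mu Q^C_{\lambda/\mu}(X|a)\,Q^C_\mu(Y|a), \qquad Q^C_{\lambda/\nu}(X\cup Y|a)=\sum_\mu Q^C_{\lambda/\mu}(X|a)\,Q^C_{\mu/\nu}(Y|a), $$ where $\mu$ runs over all strict partitions; only finitely many $\mu$ satisfy $Q^C_{\lambda/\mu}(X|a)\ne0$, so both sums are finite. -/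

import Mathlib

noncomputable section

namespace SymplecticQ

/-! ### Strict partitions -/

/-- A strict partition: a strictly decreasing finite sequence of positive integers. -/
structure StrictPartition where
  /-- The parts, in decreasing order. -/
  parts : List ℕ
  decreasing : parts.Pairwise (· > ·)
  pos : ∀ p ∈ parts, 0 < p

namespace StrictPartition

/-- The length `l(lam)`, i.e. the number of (positive) parts. -/
def length (lam : StrictPartition) : ℕ := lam.parts.length

/-- The parts `lam_0 > lam_1 > ...` (numbered from `0`), with `lam_i = 0` for `i ≥ l(lam)`. -/
def part (lam : StrictPartition) (i : ℕ) : ℕ := lam.parts.getD i 0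

/-- Containment of diagrams, `lam ⊇ mu`. -/
def Contains (lam mu : StrictPartition) : Prop := ∀ i, mu.part i ≤ lam.part i

/-- The one-row partition `(r)`, which is the empty partition for `r = 0`. -/
def row (r : ℕ) : StrictPartition where
  parts := if r = 0 then [] else [r]
  decreasing := by split_ifs <;> simp
  pos := by
    intro p hp
    split_ifs at hp with h
    · simp at hp
    · simp only [List.mem_singleton] at hp
      omega

/-- The partition `(lam_i, lam_j)` formed by two parts of `lam`, `i < j`. -/
def pair (lam : StrictPartition) (i j : Fin lam.parts.length) (h : i < j) : StrictPartition where
  parts := [lam.parts.get i, lam.parts.get j]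
  decreasing := by
    have := List.pairwise_iff_get.1 lam.decreasing i j h
    simpa using this
  pos := by
    intro p hp
    simp only [List.mem_cons, List.not_mem_nil, or_false] at hp
    rcases hp with rfl | rfl
    · exact lam.pos _ (List.get_mem _ _)
    · exact lam.pos _ (List.get_mem _ _)

end StrictPartition

/-! ### Pfaffians -/

/-- The Pfaffian of a skew-symmetric matrix `A` of even size `N`,
`Pf A = 1 / (2 ^ (N/2) (N/2)!) * ∑_s sgn(s) ∏_{i < N/2} A_{s(2i), s(2i+1)}`. -/
def pfaffian {S : Type*} [CommRing S] [Algebra ℚ S] {N : ℕ} (A : Matrix (Fin N) (Fin N) S) : S :=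
  ((2 : ℚ) ^ (N / 2) * (N / 2).factorial)⁻¹ •
    ∑ s : Equiv.Perm (Fin N), ((Equiv.Perm.sign s : ℤˣ) : ℤ) •
      ∏ i : Fin (N / 2), A (s ⟨2 * i, by omega⟩) (s ⟨2 * i + 1, by omega⟩)

/-! ### Hall-Littlewood functions of type `C` in finitely many variables -/

section HallLittlewood

variable {F : Type*} [Field F] {n : ℕ}

/-- The function symmetrized in the definition of the Hall-Littlewood function of type `C`,
in the variables `y_0, ..., y_{n-1}`. -/
def hlSummand (lam : Fin n → ℕ) (t : F) (y : Fin n → F) : F :=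
  (∏ i, y i ^ lam i) *
  (∏ i, (1 - t * (y i ^ 2)⁻¹) / (1 - (y i ^ 2)⁻¹)) *
  ∏ i, ∏ j ∈ Finset.Ioi i,
    ((1 - t * (y i)⁻¹ * y j) / (1 - (y i)⁻¹ * y j)) *
    ((1 - t * (y i)⁻¹ * (y j)⁻¹) / (1 - (y i)⁻¹ * (y j)⁻¹))

/-- The multiplicity of `r` in `lam = (lam_0, ..., lam_{n-1})`. -/
def multiplicity (lam : Fin n → ℕ) (r : ℕ) : ℕ := (Finset.univ.filter fun i => lam i = r).card

/-- The normalizing factor `v_lam^{(n)}(t)`, the Poincare polynomial of the stabilizer of `lam`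
in the hyperoctahedral group. -/
def hlNorm (lam : Fin n → ℕ) (t : F) : F :=
  (∏ i ∈ Finset.Icc 1 (multiplicity lam 0), (1 - t ^ (2 * i)) / (1 - t)) *
  ∏ r ∈ (Finset.univ.image lam).erase 0,
    ∏ i ∈ Finset.Icc 1 (multiplicity lam r), (1 - t ^ i) / (1 - t)

end HallLittlewood

/-- The field of rational functions `ℚ(x_0, ..., x_{n-1})`. -/
abbrev RatFunField (n : ℕ) : Type := FractionRing (MvPolynomial (Fin n) ℚ)

/-- The variable `x_i`. -/
def xvar {n : ℕ} (i : Fin n) : RatFunField n :=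
  algebraMap (MvPolynomial (Fin n) ℚ) (RatFunField n) (MvPolynomial.X i)

/-- The symplectic Hall-Littlewood function `P^C_lam(x_0, ..., x_{n-1}; t)`, as a rational function
of the parameter `t`. The pair `(w, e)` is the element of the hyperoctahedral group
acting by `x_i ↦ x_{w(i)}^{e_i}`. -/
def hallLittlewoodC {n : ℕ} (lam : Fin n → ℕ) : RatFunc (RatFunField n) :=
  (hlNorm lam RatFunc.X)⁻¹ *
    ∑ w : Equiv.Perm (Fin n), ∑ e : Fin n → ℤˣ,
      hlSummand lam RatFunc.X fun i => RatFunc.C (xvar (w i)) ^ ((e i : ℤˣ) : ℤ)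

/-- The symplectic `Q`-function `Q^C_lam(x_0, ..., x_{n-1}) = 2^{l(lam)} P^C_lam(x; -1)`,
for a strict partition `lam` of length at most `n`. -/
def finiteQ (n : ℕ) (lam : StrictPartition) : RatFunField n :=
  2 ^ lam.length *
    RatFunc.eval (RingHom.id (RatFunField n)) (-1) (hallLittlewoodC fun i : Fin n => lam.part i)

/-! ### Symmetric functions and universal symplectic `Q`-functions -/

/-- Symmetric functions in the variables indexed by `σ`: formal power series of bounded degree
which are invariant under permutations of the variables. -/
def IsSymmetricFunction {σ R : Type*} [CommRing R] (f : MvPowerSeries σ R) : Prop :=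
  (∃ N : ℕ, ∀ d : σ →₀ ℕ, N < d.degree → MvPowerSeries.coeff d f = 0) ∧
  ∀ (p : Equiv.Perm σ) (d : σ →₀ ℕ),
    MvPowerSeries.coeff (d.equivMapDomain p) f = MvPowerSeries.coeff d f

/-- The specialization `f(x_0, ..., x_{n-1}, x_0⁻¹, ..., x_{n-1}⁻¹, 0, 0, ...)`: among the
variables indexed by `σ`, those indexed by `e (inl i)` are replaced by `x_i`, those indexed by
`e (inr i)` by `x_i⁻¹`, and all others by `0`. The sum is finite if `f` has bounded degree. -/
def specialize {σ : Type*} {n : ℕ} (e : Fin n ⊕ Fin n ↪ σ) (f : MvPowerSeries σ ℚ) :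
    RatFunField n :=
  ∑ᶠ d : Fin n ⊕ Fin n →₀ ℕ,
    algebraMap ℚ (RatFunField n) (MvPowerSeries.coeff (d.embDomain e) f) *
      ((∏ i, xvar i ^ d (Sum.inl i)) * ∏ i, (xvar i)⁻¹ ^ d (Sum.inr i))

/-- `f` is the symmetric function which specializes to the symplectic `Q`-function
`Q^C_lam(x_0, ..., x_{n-1})` for all `n ≥ l(lam)`. -/
def IsUniversalQ {σ : Type*} (lam : StrictPartition) (f : MvPowerSeries σ ℚ) : Prop :=
  IsSymmetricFunction f ∧
  ∀ n : ℕ, lam.length ≤ n → ∀ e : Fin n ⊕ Fin n ↪ σ, specialize e f = finiteQ n lam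

/-- The universal symplectic `Q`-function `Q^C_lam(X)` in the infinitely many variables
indexed by `σ`: the unique symmetric function with property `IsUniversalQ lam`. -/
def universalQ (σ : Type*) (lam : StrictPartition) : MvPowerSeries σ ℚ :=
  Classical.epsilon fun f => IsUniversalQ lam f

/-! ### Factorial symplectic `Q`-functions -/

section Factorial

variable {R : Type*} [CommRing R] [Algebra ℚ R]

/-- The elementary symmetric polynomial `e_k(a_0, ..., a_{m-1})`. -/
def elemSymm (a : ℕ → R) (m k : ℕ) : R :=
  ∑ s ∈ (Finset.range m).powersetCard k, ∏ i ∈ s, a i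

/-- `d_{lam,mu} = det (e_{lam_i - mu_j}(a_0, ..., a_{lam_i - 1}))_{i,j < l(lam)}`,
where `e_k = 0` for `k < 0`. -/
def dCoeff (a : ℕ → R) (lam mu : StrictPartition) : R :=
  (Matrix.of fun i j : Fin lam.length =>
    if mu.part j ≤ lam.part i then elemSymm a (lam.part i) (lam.part i - mu.part j) else 0).det

/-- The universal factorial symplectic `Q`-function `Q^C_lam(X|a)`, the sum of
`d_{lam,mu} Q^C_mu(X)` over the finitely many strict `mu ⊆ lam` with `l(mu) = l(lam)`. -/
def factorialQ (σ : Type*) (a : ℕ → R) (lam : StrictPartition) : MvPowerSeries σ R :=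
  ∑ᶠ mu ∈ {mu : StrictPartition | lam.Contains mu ∧ mu.length = lam.length},
    dCoeff a lam mu • MvPowerSeries.map (algebraMap ℚ R) (universalQ σ mu)

/-- `R^C_{r/k}(X|a)`. For `1 ≤ k ≤ r - 1` it is `Q^C_{(r-k)}(X|0, a_{k+1}, ..., a_{r-1})`. -/
def rowSkewR (σ : Type*) (a : ℕ → R) (r k : ℕ) : MvPowerSeries σ R :=
  if k = 0 then factorialQ σ a (StrictPartition.row r)
  else if k < r then
    factorialQ σ (fun i => if i = 0 then 0 else a (k + i)) (StrictPartition.row (r - k))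
  else if k = r then 1
  else 0

/-- The skew-symmetric matrix `(Q^C_{(lam_i, lam_j)}(X|a))_{i,j}`. -/
def matK (σ : Type*) (a : ℕ → R) (lam : StrictPartition) :
    Matrix (Fin lam.parts.length) (Fin lam.parts.length) (MvPowerSeries σ R) :=
  Matrix.of fun i j =>
    if h : i < j then factorialQ σ a (lam.pair i j h)
    else if h : j < i then - factorialQ σ a (lam.pair j i h)
    else 0

/-- The matrix `(R^C_{α_i / β_{s+1-j}}(X|a))_{1 ≤ i ≤ r, 1 ≤ j ≤ s}`. -/
def matM (σ : Type*) (a : ℕ → R) (α β : List ℕ) :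
    Matrix (Fin α.length) (Fin β.length) (MvPowerSeries σ R) :=
  Matrix.of fun i j => rowSkewR σ a (α.get i) (β.get j.rev)

/-- The sequence `mu` if `l(lam) + l(mu)` is even, and `mu^0 = (mu_1, ..., mu_{l(mu)}, 0)`
if `l(lam) + l(mu)` is odd. -/
def padded (lam mu : StrictPartition) : List ℕ :=
  if Even (lam.length + mu.length) then mu.parts else mu.parts ++ [0]

/-- The universal skew factorial symplectic `Q`-function `Q^C_{lam/mu}(X|a)`, the Pfaffian of the
block matrix with rows `(K, M)` and `(-Mᵀ, 0)`. -/
def skewQ (σ : Type*) (a : ℕ → R) (lam mu : StrictPartition) : MvPowerSeries σ R :=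
  pfaffian <| Matrix.reindex finSumFinEquiv finSumFinEquiv <|
    Matrix.fromBlocks (matK σ a lam) (matM σ a lam.parts (padded lam mu))
      (-(matM σ a lam.parts (padded lam mu)).transpose) 0

end Factorial

/-- A function of the variables `X`, viewed as a function of the variables `X ∪ Y`. -/
def inX {σ R : Type*} [CommRing R] (τ : Type*) (f : MvPowerSeries σ R) :
    MvPowerSeries (σ ⊕ τ) R :=
  MvPowerSeries.rename (Function.Embedding.inl : σ ↪ σ ⊕ τ) f

/-- A function of the variables `Y`, viewed as a function of the variables `X ∪ Y`. -/
def inY {τ R : Type*} [CommRing R] (σ : Type*) (f : MvPowerSeries τ R) :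
    MvPowerSeries (σ ⊕ τ) R :=
  MvPowerSeries.rename (Function.Embedding.inr : τ ↪ σ ⊕ τ) f

end SymplecticQ

end

noncomputable section

namespace SymplecticQ

/-! ### Pfaffians and the exterior algebra -/

section Pfaffian

open ExteriorAlgebra

/-! Every function in the statement is a matrix coefficient of an operator on the exterior algebra
of the free module with basis e_0, e_1, .... For an alternating form K and an endomorphism φ let
`fockMap` be the exponential of contraction with K followed by Λφ. These operators compose: (K₁, φ₁)
followed by (K₂, φ₂) gives φ₂φ₁ and K₁ plus the pullback of K₂ along φ₁ (`fockMap_fockMap`). The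
Pfaffian of a Gram matrix is the scalar part of such an exponential applied to a wedge product
(`pfaffian_gram`), and the zero block of a skew function amounts to contractions afterwards
(`pfaffian_eq_skewCoef`).

Strict partitions index the wedges of the e_i with i ≥ 1. Imposing that the Clifford action of e_0
is the identity makes them a basis of the quotient, with dual functionals `skewCoef`; the padding of
β by 0 is the parity bookkeeping of this quotient. `fockMap` descends to it when φ fixes e_0 and
K(e_0, ·) = e_0* - e_0*∘φ. Inserting the basis between two operators then gives the sum over μ
(`skewCoef_fockMap_comp`).

The required data come from the one-row series q of ∏ (1 + xu)/(1 - xu). It is multiplicative under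
union of variables (`rowSeries_sum`), and the two-row series is (V - U)/(V + U) · (q(u)q(v) - 1)
with U = u + 1/u, V = v + 1/v (`matrixSeries_pairQ`), so the two-row form satisfies the cocycle rule
needed for composition (`pairQ_comp`). The parameters a only conjugate by a unitriangular matrix
(`rowMap_comp_factMap`), whose minors are the determinants in the definition of the factorial
functions (`skewCoef_map_factMap`).

It remains to recognize the universal Q-functions. Summing the Hall-Littlewood expression one
variable at a time and putting t = -1 gives a sum over sequences of indices (`finiteQ_eq`). Schur's
Pfaffian in the variables z = x + 1/x (`schur_pfaffian`) rewrites it as a Pfaffian of two-row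
functions, which are polynomials in q. Specializations separate functions of bounded degree
(`eq_zero_of_specialize`), hence `universalQ_eq`. The first identity of the theorem is the second
one with ν empty. -/

/-- The permutation of `{0, ..., n}` that fixes `0` and acts as `e` on the other elements. -/
def liftPerm {n : ℕ} (e : Equiv.Perm (Fin n)) : Equiv.Perm (Fin (n + 1)) :=
  Equiv.Perm.decomposeFin.symm (0, e)

lemma liftPerm_zero {n : ℕ} (e : Equiv.Perm (Fin n)) : liftPerm e 0 = 0 := by
  simp [liftPerm]

lemma liftPerm_succ {n : ℕ} (e : Equiv.Perm (Fin n)) (i : Fin n) :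
    liftPerm e i.succ = (e i).succ := by
  simp [liftPerm]

lemma sign_liftPerm {n : ℕ} (e : Equiv.Perm (Fin n)) :
    Equiv.Perm.sign (liftPerm e) = Equiv.Perm.sign e := by
  simp [liftPerm]

lemma exists_liftPerm {n : ℕ} (s : Equiv.Perm (Fin (n + 1))) (h : s 0 = 0) :
    ∃ e, s = liftPerm e := by
  refine ⟨(Equiv.Perm.decomposeFin s).2, ?_⟩
  have h1 : (Equiv.Perm.decomposeFin s).1 = 0 := by
    have := Equiv.Perm.decomposeFin_symm_apply_zero (Equiv.Perm.decomposeFin s).1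
      (Equiv.Perm.decomposeFin s).2
    rw [Prod.mk.eta, Equiv.symm_apply_apply, h] at this
    exact this.symm
  rw [liftPerm, ← h1, Prod.mk.eta, Equiv.symm_apply_apply]

/-- A permutation is determined by the image of 0 and an induced permutation of the rest. This is
the combinatorial form of expansion along a first row. -/
lemma sum_perm_succ {n : ℕ} {M : Type*} [AddCommMonoid M] (f : Equiv.Perm (Fin (n + 1)) → M) :
    ∑ s, f s = ∑ q : Fin (n + 1), ∑ e : Equiv.Perm (Fin n), f (q.cycleRange.symm * liftPerm e) := by
  rw [← Fintype.sum_prod_type']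
  refine (Fintype.sum_bijective
    (fun x : Fin (n + 1) × Equiv.Perm (Fin n) => x.1.cycleRange.symm * liftPerm x.2)
    ⟨?_, ?_⟩ _ _ fun x => rfl).symm
  · rintro ⟨q, e⟩ ⟨q', e'⟩ h
    have h0 : q = q' := by
      have := congrArg (fun s : Equiv.Perm (Fin (n + 1)) => s 0) h
      simpa [liftPerm_zero] using this
    subst h0
    have h1 : liftPerm e = liftPerm e' := mul_left_cancel h
    have h2 := Equiv.Perm.decomposeFin.symm.injective h1
    simpa using h2
  · intro s
    obtain ⟨e, he⟩ := exists_liftPerm ((s 0).cycleRange * s) (by simp)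
    refine ⟨(s 0, e), ?_⟩
    show (s 0).cycleRange⁻¹ * liftPerm e = s
    rw [← he, inv_mul_cancel_left]

lemma cycleRange_symm_mul_liftPerm_zero {n : ℕ} (q : Fin (n + 1)) (e : Equiv.Perm (Fin n)) :
    (q.cycleRange.symm * liftPerm e) 0 = q := by
  simp [liftPerm_zero]

lemma cycleRange_symm_mul_liftPerm_succ {n : ℕ} (q : Fin (n + 1)) (e : Equiv.Perm (Fin n))
    (i : Fin n) : (q.cycleRange.symm * liftPerm e) i.succ = q.succAbove (e i) := by
  simp [liftPerm_succ]

lemma sign_cycleRange_symm_mul_liftPerm {n : ℕ} (q : Fin (n + 1)) (e : Equiv.Perm (Fin n)) :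
    ((Equiv.Perm.sign (q.cycleRange.symm * liftPerm e) : ℤˣ) : ℤ) =
      (-1) ^ (q : ℕ) * (Equiv.Perm.sign e : ℤˣ) := by
  rw [Equiv.Perm.sign_mul, sign_liftPerm, Equiv.Perm.sign_symm, Fin.sign_cycleRange]
  simp

variable {S V W : Type*} [CommRing S] [AddCommGroup V] [Module S V] [AddCommGroup W] [Module S W]

/-- Contraction of an element of the exterior algebra with a linear form. -/
abbrev contract (d : Module.Dual S V) : ExteriorAlgebra S V →ₗ[S] ExteriorAlgebra S V :=
  CliffordAlgebra.contractLeft d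

lemma contract_ι_mul (d : Module.Dual S V) (v : V) (x : ExteriorAlgebra S V) :
    contract d (ι S v * x) = d v • x - ι S v * contract d x :=
  CliffordAlgebra.contractLeft_ι_mul ..

lemma contract_one (d : Module.Dual S V) : contract d (1 : ExteriorAlgebra S V) = 0 :=
  CliffordAlgebra.contractLeft_one ..

lemma contract_contract (d : Module.Dual S V) (x : ExteriorAlgebra S V) :
    contract d (contract d x) = 0 :=
  CliffordAlgebra.contractLeft_contractLeft ..

lemma exterior_induction {C : ExteriorAlgebra S V → Prop} (h0 : ∀ r, C (algebraMap S _ r))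
    (hadd : ∀ x y, C x → C y → C (x + y)) (hι : ∀ v x, C x → C (ι S v * x))
    (x : ExteriorAlgebra S V) : C x :=
  CliffordAlgebra.left_induction _ h0 hadd (fun x v h => hι v x h) x

lemma contract_map (f : V →ₗ[S] W) (d : Module.Dual S W) (x : ExteriorAlgebra S V) :
    contract d (map f x) = map f (contract (d ∘ₗ f) x) := by
  induction x using exterior_induction with
  | h0 r =>
    rw [AlgHom.commutes]
    simp only [contract, CliffordAlgebra.contractLeft_algebraMap, map_zero]
  | hadd x y hx hy => simp only [map_add, hx, hy]
  | hι v x hx => simp [contract_ι_mul, hx, map_apply_ι]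

/-- Contraction is an antiderivation, so passing each factor costs one sign. -/
lemma contract_ιMulti {n : ℕ} (d : Module.Dual S V) (w : Fin (n + 1) → V) :
    contract d (ιMulti S (n + 1) w) =
      ∑ q : Fin (n + 1), ((-1) ^ (q : ℕ) * d (w q)) • ιMulti S n (w ∘ q.succAbove) := by
  induction n with
  | zero =>
    rw [ιMulti_succ_apply, contract_ι_mul]
    simp
  | succ n ih =>
    rw [ιMulti_succ_apply, contract_ι_mul, ih, Fin.sum_univ_succ (n := n + 1)]
    simp only [Fin.val_zero, pow_zero, one_mul]
    rw [sub_eq_add_neg]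
    refine congrArg₂ _ ?_ ?_
    · rfl
    · rw [Finset.mul_sum, ← Finset.sum_neg_distrib]
      refine Finset.sum_congr rfl fun q _ => ?_
      rw [ιMulti_succ_apply (w ∘ q.succ.succAbove), mul_smul_comm, Fin.val_succ, pow_succ,
        ← neg_smul]
      have h1 : (Matrix.vecTail w ∘ q.succAbove) = Matrix.vecTail (w ∘ q.succ.succAbove) := by
        ext i
        simp [Matrix.vecTail]
      rw [h1]
      simp [Matrix.vecTail]

section ChangeForm

variable (B : LinearMap.BilinForm S V) 

/-- An alternating form changes the zero quadratic form into itself, so `changeForm` becomes an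
endomorphism of the exterior algebra rather than a map to another Clifford algebra. -/
lemma isAlt_toQuadraticMap {B : LinearMap.BilinForm S V} (hB : B.IsAlt) :
    B.toQuadraticMap = (0 : QuadraticForm S V) - 0 := by
  ext v
  simpa using hB v

/-- The exponential of the contraction with an alternating form, an endomorphism of the
exterior algebra. -/
def expContract {B : LinearMap.BilinForm S V} (hB : B.IsAlt) :
    ExteriorAlgebra S V →ₗ[S] ExteriorAlgebra S V :=
  CliffordAlgebra.changeForm (isAlt_toQuadraticMap hB)

variable {B} (hB : B.IsAlt)

lemma expContract_ι_mul (v : V) (x : ExteriorAlgebra S V) :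
    expContract hB (ι S v * x) = ι S v * expContract hB x - contract (B v) (expContract hB x) :=
  CliffordAlgebra.changeForm_ι_mul ..

lemma expContract_algebraMap (r : S) :
    expContract hB (algebraMap S _ r) = algebraMap S _ r :=
  CliffordAlgebra.changeForm_algebraMap ..

lemma expContract_one : expContract hB 1 = 1 :=
  CliffordAlgebra.changeForm_one ..

lemma expContract_contract (d : Module.Dual S V) (x : ExteriorAlgebra S V) :
    expContract hB (contract d x) = contract d (expContract hB x) :=
  CliffordAlgebra.changeForm_contractLeft ..

/-- The exponential law: the contributions of the two forms add up in the exponent. -/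
lemma expContract_expContract {B' : LinearMap.BilinForm S V} (hB' : B'.IsAlt)
    (hadd : (B + B').IsAlt) (x : ExteriorAlgebra S V) :
    expContract hB' (expContract hB x) = expContract hadd x :=
  CliffordAlgebra.changeForm_changeForm ..

/-- Contraction is natural: a form may be pulled back before the linear map is applied, or used
after it. -/
lemma map_expContract {C : LinearMap.BilinForm S W} (hC : C.IsAlt) (f : V →ₗ[S] W)
    (hf : (C.comp f f).IsAlt) (x : ExteriorAlgebra S V) :
    map f (expContract hf x) = expContract hC (map f x) := by
  induction x using exterior_induction with
  | h0 r => simp only [expContract_algebraMap, AlgHom.commutes]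
  | hadd x y hx hy => simp only [map_add, hx, hy]
  | hι v x hx =>
    rw [expContract_ι_mul, map_sub, map_mul, hx, map_mul, map_apply_ι, expContract_ι_mul, ← hx,
      contract_map]
    rfl

/-- The scalar part of an element of the exterior algebra. -/
abbrev scalarPart : ExteriorAlgebra S V →ₗ[S] S := (algebraMapInv (M := V)).toLinearMap

lemma scalarPart_one : scalarPart (1 : ExteriorAlgebra S V) = 1 := by
  simp [scalarPart]

lemma scalarPart_ι_mul (v : V) (x : ExteriorAlgebra S V) : scalarPart (ι S v * x) = 0 := by
  simp [scalarPart, algebraMapInv]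

lemma scalarPart_map (f : V →ₗ[S] W) (x : ExteriorAlgebra S V) :
    scalarPart (map f x) = scalarPart x := by
  induction x using exterior_induction with
  | h0 r => simp [scalarPart, algebraMapInv]
  | hadd x y hx hy => simp only [map_add, hx, hy]
  | hι v x hx => rw [map_mul, map_apply_ι, scalarPart_ι_mul, scalarPart_ι_mul]

/-- Only the contraction term can reach degree zero; this is the expansion of a Pfaffian along its
first row. -/
lemma scalarPart_expContract_ι_mul (v : V) (x : ExteriorAlgebra S V) :
    scalarPart (expContract hB (ι S v * x)) = - scalarPart (expContract hB (contract (B v) x)) := by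
  rw [expContract_ι_mul, map_sub, scalarPart_ι_mul, zero_sub, expContract_contract]

lemma scalarPart_expContract_cons {n : ℕ} (v : V) (w : Fin (n + 1) → V) :
    scalarPart (expContract hB (ι S v * ιMulti S (n + 1) w)) =
      - ∑ q : Fin (n + 1), (-1) ^ (q : ℕ) * B v (w q) *
        scalarPart (expContract hB (ιMulti S n (w ∘ q.succAbove))) := by
  rw [scalarPart_expContract_ι_mul, contract_ιMulti]
  simp [map_sum, smul_eq_mul]

/-- Moving the factor at position p to the front is a cycle of sign (-1)^p. -/
lemma ι_mul_ιMulti_succAbove {n : ℕ} (v : Fin (n + 1) → V) (p : Fin (n + 1)) :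
    ι S (v p) * ιMulti S n (v ∘ p.succAbove) = (-1 : S) ^ (p : ℕ) • ιMulti S (n + 1) v := by
  have h := (ιMulti S (n + 1)).map_perm v p.cycleRange.symm
  rw [Equiv.Perm.sign_symm, Fin.sign_cycleRange, ιMulti_succ_apply] at h
  have h1 : Matrix.vecTail (v ∘ p.cycleRange.symm) = v ∘ p.succAbove := by
    ext i
    simp [Matrix.vecTail]
  rw [h1] at h
  simp only [Function.comp_apply, Fin.cycleRange_symm_zero] at h
  rw [h, Units.smul_def]
  simp [← Int.cast_smul_eq_zsmul S]

/-- The unnormalized Pfaffian of the Gram matrix of `2 m` vectors. -/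
def gramSum (B : LinearMap.BilinForm S V) (m : ℕ) (v : Fin (2 * m) → V) : S :=
  ∑ s : Equiv.Perm (Fin (2 * m)), ((Equiv.Perm.sign s : ℤˣ) : ℤ) •
    ∏ i : Fin m, B (v (s ⟨2 * i, by omega⟩)) (v (s ⟨2 * i + 1, by omega⟩))

lemma gramSum_succ (B : LinearMap.BilinForm S V) (m : ℕ) (v : Fin (2 * m + 1 + 1) → V) :
    gramSum B (m + 1) v = ∑ p : Fin (2 * m + 2), (-1) ^ (p : ℕ) * ∑ q : Fin (2 * m + 1),
      (-1) ^ (q : ℕ) * B (v p) (v (p.succAbove q)) *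
        gramSum B m ((v ∘ p.succAbove) ∘ q.succAbove) := by
  have key : ∀ s : Equiv.Perm (Fin (2 * m + 1 + 1)),
      ∏ i : Fin (m + 1), B (v (s ⟨2 * i, by omega⟩)) (v (s ⟨2 * i + 1, by omega⟩)) =
        B (v (s 0)) (v (s (Fin.succ 0))) *
          ∏ i : Fin m, B (v (s (Fin.succ (Fin.succ ⟨2 * i, by omega⟩))))
          (v (s (Fin.succ (Fin.succ ⟨2 * i + 1, by omega⟩)))) := by
    intro s
    rw [Fin.prod_univ_succ]
    rfl
  have h1 : gramSum B (m + 1) v = ∑ s : Equiv.Perm (Fin (2 * m + 1 + 1)),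
      ((Equiv.Perm.sign s : ℤˣ) : ℤ) • (B (v (s 0)) (v (s (Fin.succ 0))) *
        ∏ i : Fin m, B (v (s (Fin.succ (Fin.succ ⟨2 * i, by omega⟩))))
          (v (s (Fin.succ (Fin.succ ⟨2 * i + 1, by omega⟩))))) :=
    Finset.sum_congr rfl fun s _ => by rw [← key s]
  rw [h1, sum_perm_succ]
  refine Finset.sum_congr rfl fun p _ => ?_
  rw [sum_perm_succ, Finset.mul_sum]
  refine Finset.sum_congr rfl fun q _ => ?_
  rw [gramSum, Finset.mul_sum, Finset.mul_sum]
  refine Finset.sum_congr rfl fun e _ => ?_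
  simp only [cycleRange_symm_mul_liftPerm_zero, cycleRange_symm_mul_liftPerm_succ,
    sign_cycleRange_symm_mul_liftPerm, Function.comp_apply]
  simp only [zsmul_eq_mul, Int.cast_mul, Int.cast_pow, Int.cast_neg, Int.cast_one]
  ring

/-- Each choice of p for the first vector contributes the same amount, since moving it to the front
and expanding gives the same scalar part. The 2m + 2 choices account for the step from 2^m m! to
2^(m+1) (m+1)!. -/
lemma gramSum_eq (m : ℕ) (v : Fin (2 * m) → V) :
    gramSum (-B) m v =
      ((2 ^ m * m.factorial : ℕ) : S) * scalarPart (expContract hB (ιMulti S (2 * m) v)) := by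
  induction m with
  | zero =>
    have : ιMulti S (2 * 0) v = 1 := ιMulti_zero_apply v
    rw [this, expContract_one, scalarPart_one]
    simp [gramSum]
  | succ m ih =>
    rw [gramSum_succ]
    have h : ∀ p : Fin (2 * m + 2), (-1) ^ (p : ℕ) * ∑ q : Fin (2 * m + 1),
      (-1) ^ (q : ℕ) * (-B) (v p) (v (p.succAbove q)) *
        gramSum (-B) m ((v ∘ p.succAbove) ∘ q.succAbove) =
        ((2 ^ m * m.factorial : ℕ) : S) *
          scalarPart (expContract hB (ιMulti S (2 * m + 1 + 1) v)) := by
      intro p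
      have h1 := ι_mul_ιMulti_succAbove (S := S) (n := 2 * m + 1) v p
      have h2 := congrArg (fun x => scalarPart (expContract hB x)) h1
      simp only [map_smul] at h2
      rw [scalarPart_expContract_cons] at h2
      have h3 : ((-1 : S) ^ (p : ℕ)) * (-1) ^ (p : ℕ) = 1 := by
        rw [← mul_pow, neg_one_mul, neg_neg, one_pow]
      rw [smul_eq_mul] at h2
      -- The sign is squared away so that the inner sum can be matched with the expansion of the
      -- vectors reordered with v p in front.
      have h4 : scalarPart (expContract hB (ιMulti S (2 * m + 1 + 1) v)) = (-1 : S) ^ (p : ℕ) *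
          ((-1) ^ (p : ℕ) * scalarPart (expContract hB (ιMulti S (2 * m + 1 + 1) v))) := by
        rw [← mul_assoc, h3, one_mul]
      rw [h4, mul_left_comm]
      refine congrArg _ ?_
      refine Eq.trans ?_ (congrArg _ h2)
      rw [← Finset.sum_neg_distrib, Finset.mul_sum]
      refine Finset.sum_congr rfl fun q _ => ?_
      rw [ih]
      simp only [LinearMap.neg_apply, Function.comp_apply]
      ring
    rw [Finset.sum_congr rfl fun p _ => h p, Finset.sum_const, Finset.card_univ, Fintype.card_fin,
      nsmul_eq_mul, Nat.factorial_succ, ← mul_assoc]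
    congr 1
    push_cast
    ring

variable [Algebra ℚ S]

/-- The Pfaffian of a Gram matrix, as the scalar part of an element of the exterior algebra. -/
lemma pfaffian_gram {N : ℕ} (hN : Even N) (v : Fin N → V) :
    pfaffian (Matrix.of fun i j => - B (v i) (v j)) =
      scalarPart (expContract hB (ιMulti S N v)) := by
  obtain ⟨m, rfl⟩ := even_iff_exists_two_mul.mp hN
  have h1 : pfaffian (Matrix.of fun i j => - B (v i) (v j)) =
      ((2 : ℚ) ^ m * m.factorial)⁻¹ • gramSum (-B) m v := by
    have h0 : 2 * m / 2 = m := by omega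
    have h2 : ((2 : ℚ) ^ (2 * m / 2) * (2 * m / 2).factorial)⁻¹ =
      ((2 : ℚ) ^ m * m.factorial)⁻¹ := by rw [h0]
    rw [pfaffian, gramSum, h2]
    congr 1
    refine Finset.sum_congr rfl fun s _ => ?_
    congr 1
    exact Fintype.prod_equiv (finCongr h0) _ _ fun i => rfl
  rw [h1, gramSum_eq hB]
  rw [show ((2 ^ m * m.factorial : ℕ) : S) = algebraMap ℚ S ((2 : ℚ) ^ m * m.factorial) by
      rw [map_mul, map_pow, map_natCast, map_ofNat]; push_cast; rfl,
    ← Algebra.smul_def, smul_smul, inv_mul_cancel₀, one_smul]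
  positivity

end ChangeForm

end Pfaffian

/-! ### Block Pfaffians and successive contractions -/

section SkewPfaffian

open ExteriorAlgebra

variable {S V W : Type*} [CommRing S] [AddCommGroup V] [Module S V]

/-- Reversal sends each pair (2i, 2i+1) to another such pair with its two entries exchanged, which
the transposition undoes; conjugating by the reversal does not change the sign of a permutation. -/
lemma pfaffian_rev_transpose [Algebra ℚ S] {N : ℕ} (hN : Even N) (A : Matrix (Fin N) (Fin N) S) :
    pfaffian (Matrix.of fun i j => A j.rev i.rev) = pfaffian A := by
  obtain ⟨m, hm⟩ := even_iff_exists_two_mul.mp hN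
  rw [pfaffian, pfaffian]
  congr 1
  refine Fintype.sum_equiv ((Equiv.mulLeft Fin.revPerm).trans (Equiv.mulRight Fin.revPerm)) _ _
    fun s => ?_
  congr 1
  · simp only [Equiv.trans_apply, Equiv.coe_mulLeft, Equiv.coe_mulRight, Equiv.Perm.sign_mul]
    rw [mul_right_comm, Int.units_mul_self, one_mul]
  · refine Fintype.prod_equiv Fin.revPerm _ _ fun i => ?_
    have h1 : (Fin.rev ⟨2 * (Fin.rev i : Fin (N / 2)), by omega⟩ : Fin N) =
        ⟨2 * i + 1, by omega⟩ := by
      ext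
      simp only [Fin.val_rev]
      omega
    have h2 : (Fin.rev ⟨2 * (Fin.rev i : Fin (N / 2)) + 1, by omega⟩ : Fin N) =
        ⟨2 * i, by omega⟩ := by
      ext
      simp only [Fin.val_rev]
      omega
    simp only [Matrix.of_apply, Equiv.trans_apply, Equiv.coe_mulLeft, Equiv.coe_mulRight,
      Equiv.Perm.mul_apply, Fin.revPerm_apply, h1, h2]

/-- Reversing the wedge product absorbs the minus sign of `pfaffian_gram`, and puts the factors in
the increasing order used for partitions. -/
lemma pfaffian_gram_rev [Algebra ℚ S] {B : LinearMap.BilinForm S V} (hB : B.IsAlt) {N : ℕ}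
    (hN : Even N) (v : Fin N → V) :
    pfaffian (Matrix.of fun i j => B (v i) (v j)) =
      scalarPart (expContract hB (((List.ofFn v).map (ι S)).reverse.prod)) := by
  rw [← pfaffian_rev_transpose hN]
  have h := pfaffian_gram hB hN (v ∘ Fin.rev)
  rw [ιMulti_apply] at h
  convert h using 3
  · ext i j
    exact (hB.neg_eq _ _).symm
  · congr 1
    apply List.ext_getElem
    · simp
    · intro i h1 h2
      simp only [List.length_reverse, List.length_map, List.length_ofFn] at h1
      simp only [List.getElem_reverse, List.getElem_map, List.getElem_ofFn, List.length_map,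
        List.length_ofFn, Function.comp_apply]
      congr 2
      apply Fin.ext
      simp only [Fin.val_rev]
      omega

/-- The form on `V × S^s` which extends the form `K` on `V` and pairs `V` with the standard
basis of `S^s` through the linear forms `d`. -/
def extendForm (K : LinearMap.BilinForm S V) {s : ℕ} (d : Fin s → Module.Dual S V) :
    LinearMap.BilinForm S (V × (Fin s → S)) :=
  let δ : (Fin s → S) →ₗ[S] Module.Dual S V := Fintype.linearCombination S d
  K.compl₁₂ (LinearMap.fst S V (Fin s → S)) (LinearMap.fst S V (Fin s → S)) +
    δ.flip.compl₁₂ (LinearMap.fst S V (Fin s → S)) (LinearMap.snd S V (Fin s → S)) -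
    δ.compl₁₂ (LinearMap.snd S V (Fin s → S)) (LinearMap.fst S V (Fin s → S))

lemma extendForm_apply (K : LinearMap.BilinForm S V) {s : ℕ} (d : Fin s → Module.Dual S V)
    (x y : V × (Fin s → S)) : extendForm K d x y = K x.1 y.1 +
      Fintype.linearCombination S d y.2 x.1 - Fintype.linearCombination S d x.2 y.1 := by
  simp [extendForm]

lemma extendForm_isAlt {K : LinearMap.BilinForm S V} (hK : K.IsAlt) {s : ℕ}
    (d : Fin s → Module.Dual S V) : (extendForm K d).IsAlt := by
  intro x
  rw [extendForm_apply, hK, zero_add, sub_self]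

lemma expContract_congr {B B' : LinearMap.BilinForm S V} (hB : B.IsAlt) (hB' : B'.IsAlt)
    (h : B = B') (x : ExteriorAlgebra S V) : expContract hB x = expContract hB' x := by
  subst h
  rfl

lemma foldl_contract_smul (l : List (Module.Dual S V)) (c : S) (x : ExteriorAlgebra S V) :
    l.foldl (fun z d => contract d z) (c • x) = c • l.foldl (fun z d => contract d z) x := by
  induction l generalizing x with
  | nil => rfl
  | cons d l ih => rw [List.foldl_cons, map_smul, ih, List.foldl_cons]

lemma map_fst_expContract_inl {K : LinearMap.BilinForm S V} (hK : K.IsAlt) {s : ℕ}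
    (d : Fin s → Module.Dual S V) (x : ExteriorAlgebra S V) :
    map (LinearMap.fst S V (Fin s → S)) (expContract (extendForm_isAlt hK d)
      (map (LinearMap.inl S V (Fin s → S)) x)) = expContract hK x := by
  have hc : (extendForm K d).comp (LinearMap.inl S V (Fin s → S))
      (LinearMap.inl S V (Fin s → S)) = K := by
    ext v w
    simp [extendForm_apply]
  rw [← map_expContract (C := extendForm K d) (extendForm_isAlt hK d)
    (LinearMap.inl S V (Fin s → S)) (by rw [hc]; exact hK),
    ← AlgHom.comp_apply, map_comp_map, LinearMap.fst_comp_inl, map_id, AlgHom.id_apply]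
  exact expContract_congr _ _ hc x

/-- An auxiliary basis vector paired with V through d_j dies under the projection to V, so
multiplication by it leaves only its contraction term. By the sign convention in `extendForm`, this
is contraction with d_j. -/
lemma skewPfaffian_aux {K : LinearMap.BilinForm S V} (hK : K.IsAlt) {s : ℕ}
    (d : Fin s → Module.Dual S V) (l : List (Fin s)) (y : ExteriorAlgebra S (V × (Fin s → S))) :
    map (LinearMap.fst S V (Fin s → S)) (expContract (extendForm_isAlt hK d)
      ((l.map fun j => ι S ((0 : V), Pi.single j (1 : S))).reverse.prod * y)) =
    l.foldl (fun z j => contract (d j) z)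
      (map (LinearMap.fst S V (Fin s → S)) (expContract (extendForm_isAlt hK d) y)) := by
  induction l generalizing y with
  | nil => simp
  | cons j l ih =>
    rw [List.map_cons, List.reverse_cons, List.prod_append, mul_assoc, ih, List.foldl_cons]
    congr 1
    rw [List.prod_singleton, expContract_ι_mul, map_sub, map_mul, map_apply_ι]
    have h : extendForm K d ((0 : V), Pi.single j (1 : S)) =
        (- d j) ∘ₗ LinearMap.fst S V (Fin s → S) := by
      ext w <;> simp [extendForm_apply]
    rw [h, ← contract_map]
    simp [contract]

/-- The block matrix is the Gram matrix of `extendForm` on the given vectors followed by the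
auxiliary ones, so `skewPfaffian_aux` trades the auxiliary vectors for contractions. -/
lemma skewPfaffian [Algebra ℚ S] {K : LinearMap.BilinForm S V} (hK : K.IsAlt) {r s : ℕ}
    (hrs : Even (r + s)) (v : Fin r → V) (d : Fin s → Module.Dual S V) :
    pfaffian (Matrix.reindex finSumFinEquiv finSumFinEquiv
      (Matrix.fromBlocks (Matrix.of fun i j => K (v i) (v j)) (Matrix.of fun i j => d j (v i))
        (-(Matrix.of fun i j => d j (v i)).transpose) 0)) =
    scalarPart ((List.ofFn d).foldl (fun z d => contract d z)
      (expContract hK (((List.ofFn v).map (ι S)).reverse.prod))) := by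
  let w : Fin (r + s) → V × (Fin s → S) :=
    Fin.append (fun i => (v i, 0)) (fun j => (0, Pi.single j 1))
  have h := pfaffian_gram_rev (extendForm_isAlt hK d) hrs w
  have h1 : (Matrix.reindex finSumFinEquiv finSumFinEquiv
      (Matrix.fromBlocks (Matrix.of fun i j => K (v i) (v j)) (Matrix.of fun i j => d j (v i))
        (-(Matrix.of fun i j => d j (v i)).transpose) 0)) =
      Matrix.of fun i j => extendForm K d (w i) (w j) := by
    ext i j
    obtain ⟨i, rfl⟩ := finSumFinEquiv.surjective i
    obtain ⟨j, rfl⟩ := finSumFinEquiv.surjective j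
    rcases i with i | i <;> rcases j with j | j <;>
      simp [w, extendForm_apply, Fintype.linearCombination_apply_single]
  rw [h1, h, ← scalarPart_map (LinearMap.fst S V (Fin s → S))]
  congr 1
  have h2 : ((List.ofFn w).map (ι S)).reverse.prod =
      (((List.finRange s).map fun j => ι S ((0 : V), Pi.single j (1 : S))).reverse.prod) *
        map (LinearMap.inl S V (Fin s → S)) (((List.ofFn v).map (ι S)).reverse.prod) := by
    rw [List.ofFn_fin_append, List.map_append, List.reverse_append, List.prod_append]
    congr 1
    · rw [List.ofFn_eq_map, List.map_map]
      rfl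
    · rw [map_list_prod, List.map_reverse, List.map_map, List.ofFn_eq_map, List.map_map,
        List.ofFn_eq_map, List.map_map]
      congr 3
      ext i
      simp
  rw [h2, skewPfaffian_aux hK, map_fst_expContract_inl, List.ofFn_eq_map (f := d), List.foldl_map]

lemma map_neg_id_expContract {K : LinearMap.BilinForm S V} (hK : K.IsAlt)
    (x : ExteriorAlgebra S V) : map (-LinearMap.id) (expContract hK x) =
      expContract hK (map (-LinearMap.id) x) := by
  induction x using exterior_induction with
  | h0 r => simp only [expContract_algebraMap, AlgHom.commutes]
  | hadd x y hx hy => simp only [map_add, hx, hy]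
  | hι v x hx =>
    rw [expContract_ι_mul, map_sub, map_mul, hx, map_mul, map_apply_ι, expContract_ι_mul, ← hx,
      contract_map]
    congr 2
    simp [contract]

/-- The rational algebra structure makes 2 act invertibly. -/
lemma eq_zero_of_eq_neg_self [Algebra ℚ S] {x : S} (h : x = -x) : x = 0 := by
  have h2 : (2 : ℚ) • x = 0 := by
    rw [two_smul]
    nth_rewrite 1 [h]
    exact neg_add_cancel x
  exact (smul_eq_zero.mp h2).resolve_left two_ne_zero

/-- The scalar part of an element of odd degree vanishes. -/
lemma scalarPart_eq_zero_of_odd [Algebra ℚ S] {K : LinearMap.BilinForm S V} (hK : K.IsAlt)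
    (l : List (Module.Dual S V)) (m : List V) (h : Odd (l.length + m.length)) :
    scalarPart (l.foldl (fun z d => contract d z) (expContract hK ((m.map (ι S)).prod))) = 0 := by
  have h1 : ∀ (l : List (Module.Dual S V)) (x : ExteriorAlgebra S V),
      map (-LinearMap.id) (l.foldl (fun z d => contract d z) x) =
        (-1 : S) ^ l.length • l.foldl (fun z d => contract d z) (map (-LinearMap.id) x) := by
    intro l
    induction l with
    | nil => simp
    | cons d l ih =>
      intro x
      rw [List.foldl_cons, ih, List.foldl_cons, List.length_cons, pow_succ]
      have h2 : (d ∘ₗ (-LinearMap.id) : Module.Dual S V) = -d := by ext; simp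
      have h4 : contract d (map (-LinearMap.id) x) =
          (-1 : S) • map (-LinearMap.id) (contract d x) := by
        rw [contract_map, h2]
        simp [contract]
      rw [h4, foldl_contract_smul, smul_smul, mul_assoc, neg_one_mul, neg_neg, mul_one]
  have h2 : map (-LinearMap.id) ((m.map (ι S)).prod) =
      (-1 : S) ^ m.length • (m.map (ι S)).prod := by
    clear h
    induction m with
    | nil => simp
    | cons v m ih =>
      simp [ih, pow_succ]
  have h3 := h1 l (expContract hK ((m.map (ι S)).prod))
  rw [map_neg_id_expContract, h2] at h3
  have h4 := congrArg scalarPart h3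
  rw [scalarPart_map, map_smul (expContract hK), foldl_contract_smul, smul_smul, map_smul,
    ← pow_add,
    h.neg_one_pow, smul_eq_mul, neg_one_mul] at h4
  exact eq_zero_of_eq_neg_self h4

end SkewPfaffian

/-! ### Strict partitions in the exterior algebra and composition of operators -/

section Fock

open ExteriorAlgebra

variable {S V : Type*} [CommRing S] [AddCommGroup V] [Module S V]

lemma foldl_contract_add (l : List (Module.Dual S V)) (x y : ExteriorAlgebra S V) :
    l.foldl (fun z d => contract d z) (x + y) =
      l.foldl (fun z d => contract d z) x + l.foldl (fun z d => contract d z) y := by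
  induction l generalizing x y with
  | nil => rfl
  | cons d l ih => rw [List.foldl_cons, map_add, ih, List.foldl_cons, List.foldl_cons]

/-- The successive contraction with the linear forms of a list. -/
def contractList (l : List (Module.Dual S V)) :
    ExteriorAlgebra S V →ₗ[S] ExteriorAlgebra S V where
  toFun := l.foldl (fun z d => contract d z)
  map_add' := foldl_contract_add l
  map_smul' := foldl_contract_smul l

lemma contractList_nil (x : ExteriorAlgebra S V) : contractList [] x = x := rfl

lemma contractList_cons (d : Module.Dual S V) (l : List (Module.Dual S V))
    (x : ExteriorAlgebra S V) : contractList (d :: l) x = contractList l (contract d x) := rfl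

lemma contractList_ιMulti_of_ne (l : List (Module.Dual S V)) {n : ℕ} (v : Fin n → V)
    (h : l.length ≠ n) : scalarPart (contractList l (ιMulti S n v)) = 0 := by
  induction l generalizing n with
  | nil =>
    cases n with
    | zero => exact absurd rfl h
    | succ n => rw [contractList_nil, ιMulti_succ_apply, scalarPart_ι_mul]
  | cons d l ih =>
    cases n with
    | zero => rw [contractList_cons, ιMulti_zero_apply, contract_one, map_zero, map_zero]
    | succ n =>
      rw [contractList_cons, contract_ιMulti, map_sum, map_sum]
      refine Finset.sum_eq_zero fun q _ => ?_
      rw [map_smul, map_smul, ih _ (by simpa using h), smul_zero]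

/-- Contracting with the first form is the Laplace expansion along the first column. -/
lemma contractList_ιMulti {n : ℕ} (d : Fin n → Module.Dual S V) (v : Fin n → V) :
    scalarPart (contractList (List.ofFn d) (ιMulti S n v)) =
      (Matrix.of fun i j => d j (v i)).det := by
  induction n with
  | zero => rw [ιMulti_zero_apply, List.ofFn_zero, contractList_nil, scalarPart_one,
      Matrix.det_isEmpty]
  | succ n ih =>
    rw [List.ofFn_succ, contractList_cons, contract_ιMulti, map_sum, map_sum,
      Matrix.det_succ_column_zero]
    refine Finset.sum_congr rfl fun q _ => ?_
    rw [map_smul, map_smul, ih, smul_eq_mul]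
    rfl

variable (S) in
/-- The wedge product of basis vectors of the free module with basis `e_0, e_1, ...`. -/
def wedge (m : List ℕ) : ExteriorAlgebra S (ℕ →₀ S) :=
  (m.map fun i => ι S (Finsupp.single i (1 : S))).prod

lemma wedge_cons (i : ℕ) (m : List ℕ) :
    wedge S (i :: m) = ι S (Finsupp.single i (1 : S)) * wedge S m := by
  simp [wedge]

variable (S) in
/-- The `i`-th coordinate form. -/
abbrev coordForm (i : ℕ) : Module.Dual S (ℕ →₀ S) := Finsupp.lapply i

lemma contract_wedge_of_notMem (i : ℕ) (m : List ℕ) (h : i ∉ m) :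
    contract (coordForm S i) (wedge S m) = 0 := by
  induction m with
  | nil => exact contract_one _
  | cons j m ih =>
    rw [wedge_cons, contract_ι_mul, ih (fun h' => h (List.mem_cons_of_mem _ h')), mul_zero,
      sub_zero, Finsupp.lapply_apply, Finsupp.single_apply,
      if_neg (fun h' => h (by simp [h'])), zero_smul]

lemma contractList_ι_mul (i : ℕ) (m : List ℕ) (h : i ∉ m) (x : ExteriorAlgebra S (ℕ →₀ S)) :
    scalarPart (contractList (m.map (coordForm S)) (ι S (Finsupp.single i (1 : S)) * x)) = 0 := by
  induction m generalizing x with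
  | nil => exact scalarPart_ι_mul _ _
  | cons j m ih =>
    rw [List.map_cons, contractList_cons, contract_ι_mul, Finsupp.lapply_apply,
      Finsupp.single_apply, if_neg (fun h' => h (by simp [h'])), zero_smul, zero_sub, map_neg,
      map_neg, ih (fun h' => h (List.mem_cons_of_mem _ h')), neg_zero]

/-- Wedges of basis vectors and contractions with coordinate forms are dual. For increasing lists it
suffices to compare the smallest entries: the smaller one has no partner in the other list. -/
lemma contractList_wedge {m m' : List ℕ} (hm : m.Pairwise (· < ·)) (hm' : m'.Pairwise (· < ·)) :
    scalarPart (contractList (m.map (coordForm S)) (wedge S m')) = if m = m' then 1 else 0 := by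
  induction m generalizing m' with
  | nil =>
    cases m' with
    | nil => simp [wedge, contractList_nil]
    | cons j m' => simpa [wedge_cons] using contractList_ι_mul j [] (by simp) (wedge S m')
  | cons i m ih =>
    cases m' with
    | nil =>
      rw [List.map_cons, contractList_cons, show wedge S [] = 1 from rfl, contract_one]
      simp
    | cons j m' =>
      rw [List.pairwise_cons] at hm hm'
      rcases lt_trichotomy i j with h | h | h
      · rw [List.map_cons, contractList_cons, contract_wedge_of_notMem, map_zero, map_zero,
          if_neg]
        · simp [h.ne]
        · simp only [List.mem_cons, not_or]
          exact ⟨h.ne, fun h' => by have := hm'.1 i h'; omega⟩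
      · subst h
        rw [List.map_cons, contractList_cons, wedge_cons, contract_ι_mul,
          contract_wedge_of_notMem i m' (fun h' => (hm'.1 i h').false), mul_zero, sub_zero,
          Finsupp.lapply_apply, Finsupp.single_eq_same, one_smul, ih hm.2 hm'.2]
        simp
      · rw [wedge_cons, contractList_ι_mul j (i :: m), if_neg]
        · simp [h.ne']
        · simp only [List.mem_cons, not_or]
          exact ⟨h.ne, fun h' => by have := hm.1 j h'; omega⟩

lemma StrictPartition.ext_parts {mu nu : StrictPartition} (h : mu.parts = nu.parts) : mu = nu := by
  cases mu
  cases nu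
  simpa using h

lemma StrictPartition.reverse_pairwise (mu : StrictPartition) :
    mu.parts.reverse.Pairwise (· < ·) := by
  rw [List.pairwise_reverse]
  exact mu.decreasing

lemma StrictPartition.zero_notMem (mu : StrictPartition) : 0 ∉ mu.parts :=
  fun h => (mu.pos 0 h).false

variable (S) in
/-- The basis vector of the exterior algebra indexed by a strict partition. -/
def partWedge (mu : StrictPartition) : ExteriorAlgebra S (ℕ →₀ S) := wedge S mu.parts.reverse

/-- A finite set of natural numbers either contains 0 or not, and its positive elements form a
strict partition. -/
lemma span_wedge : (⊤ : Submodule S (ExteriorAlgebra S (ℕ →₀ S))) ≤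
    Submodule.span S {x | ∃ mu : StrictPartition, x = partWedge S mu ∨
      x = ι S (Finsupp.single 0 (1 : S)) * partWedge S mu} := by
  rw [← (Finsupp.basisSingleOne (R := S) (ι := ℕ)).ExteriorAlgebra.span_eq, Submodule.span_le]
  rintro _ ⟨s, rfl⟩
  apply Submodule.subset_span
  have h1 : (Finsupp.basisSingleOne (R := S) (ι := ℕ)).ExteriorAlgebra s = wedge S s.sort := by
    rw [ExteriorAlgebra.basis_apply]
    refine (ιMulti_apply _).trans ?_
    rw [wedge]
    congr 1
    apply List.ext_getElem
    · simp
    · intro i h1 h2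
      simp only [Set.powersetCard.prodEquiv_symm_apply, List.getElem_ofFn, Function.comp_apply,
        Finsupp.coe_basisSingleOne, List.getElem_map, Set.powersetCard.ofFinEmbEquiv_symm_apply]
      exact congrArg (fun k => ι S (Finsupp.single k (1 : S)))
        (Finset.orderEmbOfFin_apply s rfl ⟨i, by simpa using h2⟩)
  rw [h1]
  have hs := (Finset.sortedLT_sort s).pairwise
  cases hl : s.sort with
  | nil => exact ⟨⟨[], List.Pairwise.nil, by simp⟩, Or.inl (by simp [partWedge])⟩
  | cons i l =>
    rw [hl, List.pairwise_cons] at hs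
    rcases Nat.eq_zero_or_pos i with h | h
    · refine ⟨⟨l.reverse, ?_, ?_⟩, Or.inr ?_⟩
      · rw [List.pairwise_reverse]
        exact hs.2
      · intro p hp
        have := hs.1 p (List.mem_reverse.mp hp)
        omega
      · simp [partWedge, wedge_cons, h]
    · refine ⟨⟨(i :: l).reverse, ?_, ?_⟩, Or.inl ?_⟩
      · rw [List.pairwise_reverse, List.pairwise_cons]
        exact hs
      · intro p hp
        rw [List.mem_reverse, List.mem_cons] at hp
        rcases hp with rfl | hp
        · exact h
        · exact h.trans (hs.1 p hp)
      · simp [partWedge]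

/-- The Clifford action of the vector `e_0`. -/
def cliffordZero : ExteriorAlgebra S (ℕ →₀ S) →ₗ[S] ExteriorAlgebra S (ℕ →₀ S) :=
  LinearMap.mulLeft S (ι S (Finsupp.single 0 (1 : S))) + contract (coordForm S 0)

lemma cliffordZero_apply (x : ExteriorAlgebra S (ℕ →₀ S)) :
    cliffordZero x = ι S (Finsupp.single 0 (1 : S)) * x + contract (coordForm S 0) x := rfl

lemma cliffordZero_partWedge (mu : StrictPartition) :
    cliffordZero (partWedge S mu) = ι S (Finsupp.single 0 (1 : S)) * partWedge S mu := by
  rw [cliffordZero_apply, partWedge, contract_wedge_of_notMem, add_zero]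
  simpa using mu.zero_notMem

/-- The coefficient of `partWedge mu` in the quotient of the exterior algebra by the relation
that `cliffordZero` acts as the identity. -/
def skewCoef (mu : StrictPartition) : ExteriorAlgebra S (ℕ →₀ S) →ₗ[S] S :=
  scalarPart ∘ₗ contractList (mu.parts.reverse.map (coordForm S)) ∘ₗ
    (LinearMap.id + contract (coordForm S 0))

lemma skewCoef_apply (mu : StrictPartition) (x : ExteriorAlgebra S (ℕ →₀ S)) : skewCoef mu x =
    scalarPart (contractList (mu.parts.reverse.map (coordForm S)) x) +
    scalarPart (contractList (mu.parts.reverse.map (coordForm S))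
      (contract (coordForm S 0) x)) := by
  simp [skewCoef]

/-- The forms indexed by the positive parts do not see e_0. Hence the action of e_0 merely exchanges
the two summands of the functional. -/
lemma skewCoef_cliffordZero (mu : StrictPartition) (x : ExteriorAlgebra S (ℕ →₀ S)) :
    skewCoef mu (cliffordZero x) = skewCoef mu x := by
  have h : ∀ y, scalarPart (contractList (mu.parts.reverse.map (coordForm S))
      (ι S (Finsupp.single 0 (1 : S)) * y)) = 0 :=
    contractList_ι_mul 0 _ (by simpa using mu.zero_notMem)
  rw [skewCoef_apply, skewCoef_apply, cliffordZero_apply, map_add, map_add, h, zero_add, map_add,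
    contract_contract, add_zero, contract_ι_mul, map_sub, map_sub, h, sub_zero, add_comm]
  simp

lemma skewCoef_partWedge (mu nu : StrictPartition) :
    skewCoef mu (partWedge S nu) = open scoped Classical in if mu = nu then 1 else 0 := by
  rw [skewCoef_apply, partWedge, contract_wedge_of_notMem _ _ (by simpa using nu.zero_notMem),
    map_zero, map_zero, add_zero, contractList_wedge mu.reverse_pairwise nu.reverse_pairwise]
  by_cases h : mu = nu
  · rw [if_pos h, if_pos (h ▸ rfl)]
  · rw [if_neg h, if_neg]
    rw [List.reverse_inj]
    exact fun h' => h (StrictPartition.ext_parts h')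

/-- Expansion of a `cliffordZero`-invariant functional. -/
lemma finite_and_expansion (f : ExteriorAlgebra S (ℕ →₀ S) →ₗ[S] S)
    (hf : ∀ x, f (cliffordZero x) = f x) (y : ExteriorAlgebra S (ℕ →₀ S)) :
    (Function.support fun mu => skewCoef mu y).Finite ∧
      f y = ∑ᶠ mu, skewCoef mu y * f (partWedge S mu) := by
  have hfin : ∀ y, (Function.support fun mu => skewCoef mu y).Finite →
      (Function.support fun mu => skewCoef mu y * f (partWedge S mu)).Finite := fun y h =>
    h.subset fun mu hmu => by
      intro h0
      exact hmu (by simp only at h0 ⊢; rw [h0, zero_mul])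
  refine Submodule.span_induction (p := fun y _ =>
    (Function.support fun mu => skewCoef mu y).Finite ∧
      f y = ∑ᶠ mu, skewCoef mu y * f (partWedge S mu)) ?_ ?_ ?_ ?_
      (span_wedge (Submodule.mem_top (x := y)))
  · have key : ∀ nu : StrictPartition,
        (Function.support fun mu => skewCoef mu (partWedge S nu)).Finite ∧
          f (partWedge S nu) = ∑ᶠ mu, skewCoef mu (partWedge S nu) * f (partWedge S mu) := by
      intro nu
      constructor
      · refine (Set.finite_singleton nu).subset fun mu hmu => ?_
        by_contra h
        exact hmu (by simp only [skewCoef_partWedge]; exact if_neg h)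
      · rw [finsum_eq_single _ nu]
        · rw [skewCoef_partWedge, if_pos rfl, one_mul]
        · intro mu hmu
          rw [skewCoef_partWedge, if_neg hmu, zero_mul]
    rintro _ ⟨nu, rfl | rfl⟩
    · exact key nu
    · rw [← cliffordZero_partWedge]
      simp only [skewCoef_cliffordZero, hf]
      exact key nu
  · simp
  · intro x y _ _ hx hy
    refine ⟨(hx.1.union hy.1).subset ?_, ?_⟩
    · simp only [map_add]
      exact Function.support_add _ _
    · simp only [map_add, add_mul]
      rw [finsum_add_distrib (hfin x hx.1) (hfin y hy.1), ← hx.2, ← hy.2]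
  · intro c x _ hx
    refine ⟨hx.1.subset ?_, ?_⟩
    · simp only [map_smul]
      exact fun mu hmu h0 => hmu (by simp only at h0 ⊢; rw [h0, smul_zero])
    · simp only [map_smul, smul_eq_mul, mul_assoc]
      rw [← mul_finsum' _ _ (hfin x hx.1), ← hx.2]

/-- The endomorphism of the exterior algebra given by an alternating form and a linear map. -/
def fockMap {K : LinearMap.BilinForm S V} (hK : K.IsAlt) (φ : V →ₗ[S] V) :
    ExteriorAlgebra S V →ₗ[S] ExteriorAlgebra S V :=
  (map φ).toLinearMap ∘ₗ expContract hK

lemma fockMap_apply {K : LinearMap.BilinForm S V} (hK : K.IsAlt) (φ : V →ₗ[S] V)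
    (x : ExteriorAlgebra S V) : fockMap hK φ x = map φ (expContract hK x) := rfl

/-- The inner linear map is moved past the outer exponential by naturality, after which the two
exponentials merge. -/
lemma fockMap_fockMap {K₁ K₂ K₃ : LinearMap.BilinForm S V} (h₁ : K₁.IsAlt) (h₂ : K₂.IsAlt)
    (h₃ : K₃.IsAlt) {φ₁ φ₂ φ₃ : V →ₗ[S] V} (hφ : φ₃ = φ₂ ∘ₗ φ₁) (hK : K₃ = K₁ + K₂.comp φ₁ φ₁)
    (x : ExteriorAlgebra S V) : fockMap h₂ φ₂ (fockMap h₁ φ₁ x) = fockMap h₃ φ₃ x := by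
  have h : (K₂.comp φ₁ φ₁).IsAlt := fun v => h₂ (φ₁ v)
  subst hK
  rw [fockMap_apply, fockMap_apply, fockMap_apply, ← map_expContract h₂ φ₁ h,
    expContract_expContract h₁ h h₃, hφ, ← AlgHom.comp_apply, map_comp_map]

/-- Moving e_0 through the exponential adds a contraction with -K(e_0, ·). The hypothesis on K turns
the coordinate form e_0* into e_0*∘φ, which is what pulling the contraction through Λφ requires. -/
lemma fockMap_cliffordZero {K : LinearMap.BilinForm S (ℕ →₀ S)} (hK : K.IsAlt)
    {φ : (ℕ →₀ S) →ₗ[S] (ℕ →₀ S)} (hφ : φ (Finsupp.single 0 1) = Finsupp.single 0 1)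
    (hK0 : K (Finsupp.single 0 1) = coordForm S 0 - coordForm S 0 ∘ₗ φ)
    (x : ExteriorAlgebra S (ℕ →₀ S)) :
    fockMap hK φ (cliffordZero x) = cliffordZero (fockMap hK φ x) := by
  rw [cliffordZero_apply, cliffordZero_apply, fockMap_apply, fockMap_apply, map_add,
    expContract_ι_mul, hK0, expContract_contract, contract_map]
  have h : ι S (Finsupp.single 0 (1 : S)) = map φ (ι S (Finsupp.single 0 (1 : S))) := by
    rw [map_apply_ι, hφ]
  conv_rhs => rw [h, ← map_mul, ← map_add]
  congr 1
  simp only [contract, map_sub, LinearMap.sub_apply]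
  abel

/-- The abstract source of both identities: the second operator followed by a coordinate functional
is again invariant, so it can be expanded in the basis of partitions. -/
theorem skewCoef_fockMap_comp {K₁ K₂ K₃ : LinearMap.BilinForm S (ℕ →₀ S)} (h₁ : K₁.IsAlt)
    (h₂ : K₂.IsAlt) (h₃ : K₃.IsAlt) {φ₁ φ₂ φ₃ : (ℕ →₀ S) →ₗ[S] (ℕ →₀ S)} (hφ : φ₃ = φ₂ ∘ₗ φ₁)
    (hK : K₃ = K₁ + K₂.comp φ₁ φ₁) (hφ₂ : φ₂ (Finsupp.single 0 1) = Finsupp.single 0 1)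
    (hK₂ : K₂ (Finsupp.single 0 1) = coordForm S 0 - coordForm S 0 ∘ₗ φ₂)
    (nu : StrictPartition) (x : ExteriorAlgebra S (ℕ →₀ S)) :
    skewCoef nu (fockMap h₃ φ₃ x) = ∑ᶠ mu, skewCoef mu (fockMap h₁ φ₁ x) *
      skewCoef nu (fockMap h₂ φ₂ (partWedge S mu)) := by
  rw [← fockMap_fockMap h₁ h₂ h₃ hφ hK]
  exact (finite_and_expansion (skewCoef nu ∘ₗ fockMap h₂ φ₂) (fun x => by
    rw [LinearMap.comp_apply, fockMap_cliffordZero h₂ hφ₂ hK₂, skewCoef_cliffordZero,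
      LinearMap.comp_apply]) _).2

lemma contractList_map (f : V →ₗ[S] V) (l : List (Module.Dual S V)) (x : ExteriorAlgebra S V) :
    contractList l (map f x) = map f (contractList (l.map fun d => d ∘ₗ f) x) := by
  induction l generalizing x with
  | nil => rfl
  | cons d l ih => rw [contractList_cons, contract_map, ih, List.map_cons, contractList_cons]

lemma wedge_reverse (l : List ℕ) : wedge S l.reverse =
    ((List.ofFn fun i => Finsupp.single (l.get i) (1 : S)).map (ι S)).reverse.prod := by
  rw [wedge, List.map_reverse]
  congr 2
  conv_lhs => rw [← List.ofFn_get l]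
  rw [List.map_ofFn, List.map_ofFn]
  rfl

lemma length_padded (lam mu : StrictPartition) :
    Even (lam.parts.length + (padded lam mu).length) := by
  rw [padded]
  split_ifs with h
  · exact h
  · rw [List.length_append, List.length_singleton, ← add_assoc, Nat.even_add_one]
    exact h

/-- The block Pfaffian in the definition of a skew function is a matrix coefficient. -/
theorem pfaffian_eq_skewCoef [Algebra ℚ S] {K : LinearMap.BilinForm S (ℕ →₀ S)} (hK : K.IsAlt)
    (φ : (ℕ →₀ S) →ₗ[S] (ℕ →₀ S)) (lam mu : StrictPartition) :
    pfaffian (Matrix.reindex finSumFinEquiv finSumFinEquiv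
      (Matrix.fromBlocks
        (Matrix.of fun i j : Fin lam.parts.length => K (Finsupp.single (lam.parts.get i) 1)
          (Finsupp.single (lam.parts.get j) 1))
        (Matrix.of fun (i : Fin lam.parts.length) (j : Fin (padded lam mu).length) =>
          φ (Finsupp.single (lam.parts.get i) 1) ((padded lam mu).get j.rev))
        (-(Matrix.of fun (i : Fin lam.parts.length) (j : Fin (padded lam mu).length) =>
          φ (Finsupp.single (lam.parts.get i) 1) ((padded lam mu).get j.rev)).transpose) 0)) =
    skewCoef mu (fockMap hK φ (partWedge S lam)) := by
  have h := skewPfaffian hK (length_padded lam mu)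
    (fun i => Finsupp.single (lam.parts.get i) (1 : S))
    (fun j => coordForm S ((padded lam mu).get j.rev) ∘ₗ φ)
  have h1 : (List.ofFn fun j : Fin (padded lam mu).length =>
      coordForm S ((padded lam mu).get j.rev) ∘ₗ φ) =
      ((padded lam mu).reverse.map (coordForm S)).map fun d => d ∘ₗ φ := by
    apply List.ext_getElem
    · simp
    · intro i h1 h2
      simp only [List.length_ofFn] at h1
      simp only [List.getElem_ofFn, List.getElem_map, List.getElem_reverse, List.get_eq_getElem,
        Fin.val_rev]
      congr 3
      omega
  rw [← wedge_reverse, h1] at h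
  have h2 : ∀ m : List ℕ, scalarPart (contractList (m.map (coordForm S))
        (fockMap hK φ (partWedge S lam))) =
      scalarPart (((m.map (coordForm S)).map fun d => d ∘ₗ φ).foldl (fun z d => contract d z)
        (expContract hK (wedge S lam.parts.reverse))) := by
    intro m
    rw [fockMap_apply, contractList_map, scalarPart_map]
    rfl
  have h3 : ∀ m : List ℕ, Odd (m.length + lam.parts.length) →
      scalarPart (contractList (m.map (coordForm S)) (fockMap hK φ (partWedge S lam))) = 0 := by
    intro m hm
    rw [h2, wedge_reverse, ← List.map_reverse]
    apply scalarPart_eq_zero_of_odd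
    simpa using hm
  refine h.trans ?_
  rw [← h2, skewCoef_apply, ← contractList_cons, ← List.map_cons]
  have hlen : lam.length + mu.length = mu.parts.reverse.length + lam.parts.length := by
    rw [StrictPartition.length, StrictPartition.length, List.length_reverse, add_comm]
  -- Of the two summands of `skewCoef`, one contracts with the parts of μ and the other also with
  -- e_0. Parity kills one of them, and the survivor is the one prescribed by `padded`.
  by_cases hp : Even (lam.length + mu.length)
  · rw [h3 (0 :: mu.parts.reverse), add_zero, padded, if_pos hp]
    rw [List.length_cons, add_right_comm, ← hlen, Nat.odd_add_one, Nat.not_odd_iff_even]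
    exact hp
  · rw [h3 mu.parts.reverse, zero_add, padded, if_neg hp, List.reverse_append]
    · rfl
    · rw [← hlen]
      exact Nat.not_even_iff_odd.mp hp

end Fock

/-! ### Partial fractions from Lagrange interpolation -/

section PartialFractions

variable {F ι : Type*} [Field F] [DecidableEq ι]

open Polynomial in
-- The difference of two monic polynomials of equal degree has smaller degree, so it is interpolated
-- by its values at the roots z_i of the second.
lemma prod_sub_div_prod_sub (s : Finset ι) (w z : ι → F) (hz : Set.InjOn z s) (U : F)
    (hU : ∀ i ∈ s, U ≠ z i) :
    ∏ i ∈ s, (U - w i) / (U - z i) =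
      1 + ∑ i ∈ s, (z i - w i) * (∏ j ∈ s.erase i, (z i - w j) / (z i - z j)) / (U - z i) := by
  have hdeg : (∏ i ∈ s, (X - C (w i)) - Lagrange.nodal s z).degree < s.card := by
    rw [Lagrange.nodal]
    have h1 : (∏ i ∈ s, (X - C (w i))).degree = (s.card : WithBot ℕ) := by simp [degree_prod]
    have h2 : (∏ i ∈ s, (X - C (z i))).degree = (s.card : WithBot ℕ) := by simp [degree_prod]
    rw [← h1]
    refine degree_sub_lt_left (h1.trans h2.symm) ?_ ?_
    · exact (monic_prod_of_monic _ _ fun i _ => monic_X_sub_C _).ne_zero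
    · rw [(monic_prod_of_monic s (fun i => X - C (w i)) fun i _ => monic_X_sub_C _).leadingCoeff,
        (monic_prod_of_monic s (fun i => X - C (z i)) fun i _ => monic_X_sub_C _).leadingCoeff]
  have h := Lagrange.eq_interpolate_of_eval_eq (r := fun i => ∏ j ∈ s, (z i - w j)) hz hdeg (by
    intro i hi
    rw [eval_sub, Lagrange.eval_nodal_at_node hi, eval_prod]
    simp)
  have h' := congrArg (eval U) h
  rw [Lagrange.eval_interpolate_not_at_node _ hU, eval_sub, eval_prod, Lagrange.eval_nodal] at h'
  simp only [eval_sub, eval_X, eval_C] at h'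
  have hne : ∏ i ∈ s, (U - z i) ≠ 0 :=
    Finset.prod_ne_zero_iff.mpr fun i hi => sub_ne_zero.mpr (hU i hi)
  rw [Finset.prod_div_distrib, div_eq_iff hne, sub_eq_iff_eq_add'.mp h', add_mul, one_mul,
    mul_comm _ (∏ i ∈ s, (U - z i))]
  congr 2
  refine Finset.sum_congr rfl fun i hi => ?_
  rw [Lagrange.nodalWeight, ← Finset.mul_prod_erase s _ hi, Finset.prod_div_distrib,
    Finset.prod_inv_distrib]
  field_simp

lemma prod_add_div_sub (s : Finset ι) (z : ι → F) (hz : Set.InjOn z s) (U : F)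
    (hU : ∀ i ∈ s, U ≠ z i) :
    ∏ i ∈ s, (U + z i) / (U - z i) =
      1 + ∑ i ∈ s, 2 * z i * (∏ j ∈ s.erase i, (z i + z j) / (z i - z j)) / (U - z i) := by
  have h := prod_sub_div_prod_sub s (fun i => - z i) z hz U hU
  simp only [sub_neg_eq_add] at h
  rw [h]
  congr 1
  refine Finset.sum_congr rfl fun i _ => ?_
  rw [two_mul]

/-- This is the partial fraction identity with numerator roots t z_i, evaluated at U = 0. -/
lemma sum_prod_sub_mul_div (s : Finset ι) (z : ι → F) (hz : Set.InjOn z s) (t : F)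
    (h0 : ∀ i ∈ s, z i ≠ 0) :
    (1 - t) * ∑ i ∈ s, ∏ j ∈ s.erase i, (z i - t * z j) / (z i - z j) = 1 - t ^ s.card := by
  have h := prod_sub_div_prod_sub s (fun i => t * z i) z hz 0 (fun i hi => (h0 i hi).symm)
  have h1 : ∏ i ∈ s, (0 - t * z i) / (0 - z i) = t ^ s.card := by
    rw [← Finset.prod_const]
    refine Finset.prod_congr rfl fun i hi => ?_
    have := h0 i hi
    field_simp
    ring
  rw [h1] at h
  rw [h, Finset.mul_sum, ← sub_sub, sub_self, zero_sub, ← Finset.sum_neg_distrib]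
  refine Finset.sum_congr rfl fun i hi => ?_
  have := h0 i hi
  field_simp
  ring

end PartialFractions

/-! ### Products over pairs of indices -/

section PairProd

variable {F ι : Type*} [Field F]

/-- The product of `σ (w i) (w j)` over all pairs `i < j`. -/
def pairProd (σ : ι → ι → F) : ∀ {l : ℕ}, (Fin l → ι) → F
  | 0, _ => 1
  | _ + 1, w => (∏ j, σ (w 0) (w (Fin.succ j))) * pairProd σ (w ∘ Fin.succ)

lemma pairProd_zero (σ : ι → ι → F) (w : Fin 0 → ι) : pairProd σ w = 1 := rfl

lemma pairProd_succ (σ : ι → ι → F) {l : ℕ} (w : Fin (l + 1) → ι) :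
    pairProd σ w = (∏ j, σ (w 0) (w (Fin.succ j))) * pairProd σ (w ∘ Fin.succ) := rfl

/-- Bringing index q to the front reverses its q pairs with earlier indices, each giving a sign by
antisymmetry. -/
lemma pairProd_succAbove (σ : ι → ι → F) (hσ : ∀ i j, σ j i = - σ i j) {l : ℕ}
    (w : Fin (l + 1) → ι) (q : Fin (l + 1)) :
    pairProd σ w = (-1) ^ (q : ℕ) * (∏ j, σ (w q) (w (q.succAbove j))) *
      pairProd σ (w ∘ q.succAbove) := by
  induction l with
  | zero =>
    obtain rfl : q = 0 := Fin.fin_one_eq_zero q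
    simp [pairProd]
  | succ l ih =>
    refine Fin.cases ?_ (fun q => ?_) q
    · simp [pairProd_succ σ w, Function.comp_def]
    · rw [pairProd_succ σ w, pairProd_succ σ (w ∘ q.succ.succAbove), ih (w ∘ Fin.succ) q,
        Fin.prod_univ_succAbove (fun j => σ (w 0) (w (Fin.succ j))) q,
        Fin.prod_univ_succ (fun j => σ (w q.succ) (w (q.succ.succAbove j)))]
      have h : (w ∘ q.succ.succAbove) ∘ Fin.succ = (w ∘ Fin.succ) ∘ q.succAbove := by
        ext j
        simp
      rw [h]
      simp only [Function.comp_apply, Fin.succ_succAbove_zero, Fin.succ_succAbove_succ,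
        Fin.val_succ, pow_succ, hσ (w 0) (w q.succ)]
      ring

lemma pairProd_eq_zero (σ : ι → ι → F) (hσ : ∀ i j, σ j i = - σ i j) (hσ' : ∀ i, σ i i = 0)
    {l : ℕ} (w : Fin l → ι) (hw : ¬ Function.Injective w) : pairProd σ w = 0 := by
  cases l with
  | zero => exact absurd (Function.injective_of_subsingleton w) hw
  | succ l =>
    rw [Function.not_injective_iff] at hw
    obtain ⟨i, j, hij, hne⟩ := hw
    obtain ⟨k, rfl⟩ := Fin.exists_succAbove_eq hne.symm
    rw [pairProd_succAbove σ hσ w i, Finset.prod_eq_zero (Finset.mem_univ k), mul_zero, zero_mul]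
    rw [hij, hσ']

lemma pairProd_comp {κ : Type*} (σ : ι → ι → F) (f : κ → ι) {l : ℕ} (w : Fin l → κ) :
    pairProd (fun i j => σ (f i) (f j)) w = pairProd σ (f ∘ w) := by
  induction l with
  | zero => rfl
  | succ l ih => rw [pairProd_succ, pairProd_succ, ih]; rfl

end PairProd

/-! ### Schur's Pfaffian, including a point at infinity -/

section SchurPfaffian

open ExteriorAlgebra

variable {F : Type*} [Field F]

/-- The function `(z_j - z_i) / (z_j + z_i)`. -/
def tanhKernel {ι : Type*} (z : ι → F) (i j : ι) : F := (z j - z i) / (z j + z i)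

lemma tanhKernel_swap {ι : Type*} (z : ι → F) (i j : ι) :
    tanhKernel z j i = - tanhKernel z i j := by
  rw [tanhKernel, tanhKernel, ← neg_div, neg_sub, add_comm]

lemma tanhKernel_self {ι : Type*} (z : ι → F) (i : ι) : tanhKernel z i i = 0 := by
  rw [tanhKernel, sub_self, zero_div]

lemma prod_erase_succAbove {n : ℕ} {M : Type*} [CommMonoid M] (q : Fin (n + 1))
    (f : Fin (n + 1) → M) : ∏ j ∈ Finset.univ.erase q, f j = ∏ j, f (q.succAbove j) := by
  rw [show Finset.univ.erase q = Finset.univ.map q.succAboveEmb by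
    rw [← Finset.compl_singleton, Finset.map_eq_image, ← Fin.image_succAbove_univ]; rfl,
    Finset.prod_map]
  rfl

variable {l : ℕ} (z : Fin (l + 1) → F) (hz : Function.Injective z)
  (hz2 : ∀ i j, z i + z j ≠ 0)

include hz hz2

/-- Removing an index divides by its factors, each of which is minus the inverse of (z_q + z_j)/(z_q
- z_j). The alternating sums below thus become partial fraction sums. -/
lemma pairProd_comp_succAbove (q : Fin (l + 1)) :
    (-1) ^ (q : ℕ) * pairProd (tanhKernel z) (Fin.succAbove q) =
      (-1) ^ l * (∏ j, (z q + z (q.succAbove j)) / (z q - z (q.succAbove j))) *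
        pairProd (tanhKernel z) id := by
  rw [pairProd_succAbove _ (tanhKernel_swap z) id q]
  have h : (∏ j, (z q + z (q.succAbove j)) / (z q - z (q.succAbove j))) * 
      (∏ j, tanhKernel z (id q) (id (q.succAbove j))) = (-1) ^ l := by
    rw [← Finset.prod_mul_distrib]
    refine (Finset.prod_congr rfl fun j _ => ?_).trans (by simp : ∏ _j : Fin l, (-1 : F) = _)
    have h1 := hz2 q (q.succAbove j)
    have h2 := hz2 (q.succAbove j) q
    have h3 : z q - z (q.succAbove j) ≠ 0 :=
      sub_ne_zero.mpr fun h => q.succAbove_ne j (hz h).symm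
    rw [tanhKernel, id, id]
    field_simp
    ring
  rw [Function.id_comp]
  calc _ = (-1) ^ l * (-1) ^ l * ((-1) ^ (q : ℕ) * pairProd (tanhKernel z) q.succAbove) := by
        rw [← mul_pow, neg_one_mul, neg_neg, one_pow, one_mul]
    _ = _ := by
      conv_lhs => rw [← h]
      rw [← h]
      ring

lemma sum_prod_add_div_sub (hl : Even l) :
    ∑ q, ∏ j, (z q + z (q.succAbove j)) / (z q - z (q.succAbove j)) = 1 := by
  have h2 : (2 : F) ≠ 0 := fun h => hz2 0 0 (by rw [← two_mul, h, zero_mul])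
  have h := sum_prod_sub_mul_div Finset.univ z hz.injOn (-1)
    (fun i _ h => hz2 i i (by rw [h, add_zero]))
  rw [Finset.card_univ, Fintype.card_fin, hl.add_one.neg_one_pow, sub_neg_eq_add,
    one_add_one_eq_two] at h
  have h3 := mul_left_cancel₀ h2 (h.trans (mul_one 2).symm)
  simp only [prod_erase_succAbove, neg_one_mul, sub_neg_eq_add] at h3
  exact h3

lemma pairProd_odd (hl : Even l) :
    ∑ q : Fin (l + 1), (-1) ^ (q : ℕ) * pairProd (tanhKernel z) (Fin.succAbove q) =
      pairProd (tanhKernel z) id := by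
  simp only [pairProd_comp_succAbove z hz hz2]
  rw [← Finset.sum_mul, ← Finset.mul_sum, sum_prod_add_div_sub z hz hz2 hl, hl.neg_one_pow,
    one_mul, one_mul]

/-- Partial fractions at U = -u express the product as a constant plus simple poles. Replacing the
constant by the sum in `sum_prod_add_div_sub` combines each residue into (z_q - u)/(z_q + u). -/
lemma pairProd_even (hl : Even l) (u : F) (hu : ∀ i, z i + u ≠ 0) :
    ∑ q : Fin (l + 1), (-1) ^ (q : ℕ) * ((z q - u) / (z q + u)) *
      pairProd (tanhKernel z) (Fin.succAbove q) =
      (∏ q, (z q - u) / (z q + u)) * pairProd (tanhKernel z) id := by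
  have h1 : ∀ q : Fin (l + 1), (-1) ^ (q : ℕ) * ((z q - u) / (z q + u)) *
      pairProd (tanhKernel z) (Fin.succAbove q) = ((z q - u) / (z q + u)) *
      ((-1) ^ l * (∏ j, (z q + z (q.succAbove j)) / (z q - z (q.succAbove j))) *
        pairProd (tanhKernel z) id) := fun q => by
    rw [← pairProd_comp_succAbove z hz hz2]
    ring
  simp only [h1, hl.neg_one_pow, one_mul, ← mul_assoc]
  rw [← Finset.sum_mul]
  congr 1
  have h := prod_add_div_sub Finset.univ z hz.injOn (-u) (fun i _ h => hu i (by rw [← h]; ring))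
  simp only [prod_erase_succAbove] at h
  have h3 : ∏ i, (-u + z i) / (-u - z i) = - ∏ i, (z i - u) / (z i + u) := by
    have : ∀ i, (-u + z i) / (-u - z i) = (-1) * ((z i - u) / (z i + u)) := fun i => by
      rw [show -u - z i = -(z i + u) by ring, div_neg, neg_one_mul, neg_add_eq_sub]
    simp only [this]
    rw [Finset.prod_mul_distrib, Finset.prod_const, Finset.card_univ, Fintype.card_fin,
      hl.add_one.neg_one_pow, neg_one_mul]
  rw [h3] at h
  rw [neg_eq_iff_eq_neg.mp h, ← sum_prod_add_div_sub z hz hz2 hl, ← Finset.sum_add_distrib,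
    ← Finset.sum_neg_distrib]
  refine Finset.sum_congr rfl fun q _ => ?_
  have := hu q
  rw [show -u - z q = -(z q + u) by ring, div_neg]
  field_simp
  ring

end SchurPfaffian

section SchurPfaffian

open ExteriorAlgebra

variable {F κ : Type*} [Field F]

lemma ι_mul_ιMulti_comm {S V : Type*} [CommRing S] [AddCommGroup V] [Module S V] {n : ℕ} (v : V)
    (w : Fin n → V) : ι S v * ιMulti S n w = (-1 : S) ^ n • (ιMulti S n w * ι S v) := by
  induction n with
  | zero => simp
  | succ n ih =>
    rw [ιMulti_succ_apply, ← mul_assoc, eq_neg_of_add_eq_zero_left (ι_add_mul_swap v (w 0)),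
      neg_mul, mul_assoc, ih, mul_smul_comm, pow_succ, mul_neg_one, neg_smul, mul_assoc]

/-- The kernel `tanhKernel` extended by a point at infinity. -/
def extKernel (z : κ → F) : Option κ → Option κ → F
  | some i, some j => tanhKernel z i j
  | some _, none => 1
  | none, some _ => -1
  | none, none => 0

lemma extKernel_swap (z : κ → F) (i j : Option κ) : extKernel z j i = - extKernel z i j := by
  rcases i with _ | i <;> rcases j with _ | j
  · simp [extKernel]
  · simp [extKernel]
  · simp [extKernel]
  · exact tanhKernel_swap z i j

variable [Fintype κ] [DecidableEq κ]

/-- The bilinear form with matrix `- extKernel z`. -/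
def kernelForm (z : κ → F) : LinearMap.BilinForm F (Option κ → F) :=
  Matrix.toBilin' (Matrix.of fun i j => - extKernel z i j)

lemma kernelForm_single (z : κ → F) (i j : Option κ) :
    kernelForm z (Pi.single i 1) (Pi.single j 1) = - extKernel z i j := by
  simp [kernelForm]

lemma kernelForm_apply (z : κ → F) (x y : Option κ → F) :
    kernelForm z x y = - ∑ i, ∑ j, x i * y j * extKernel z i j := by
  rw [kernelForm, Matrix.toBilin'_apply, ← Finset.sum_neg_distrib]
  refine Finset.sum_congr rfl fun i _ => ?_
  rw [← Finset.sum_neg_distrib]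
  refine Finset.sum_congr rfl fun j _ => ?_
  simp only [Matrix.of_apply]
  ring

lemma kernelForm_isAlt [Algebra ℚ F] (z : κ → F) : (kernelForm z).IsAlt := by
  intro x
  apply eq_zero_of_eq_neg_self
  have h : ∑ i, ∑ j, x i * x j * extKernel z i j = - ∑ i, ∑ j, x i * x j * extKernel z i j := by
    conv_lhs => rw [Finset.sum_comm]
    rw [← Finset.sum_neg_distrib]
    refine Finset.sum_congr rfl fun i _ => ?_
    rw [← Finset.sum_neg_distrib]
    refine Finset.sum_congr rfl fun j _ => ?_
    rw [extKernel_swap z i j]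
    ring
  rw [kernelForm_apply, ← h]
  exact h

variable (F κ) in
/-- The last factor, which makes the degree even. -/
def parityFactor (l : ℕ) : ExteriorAlgebra F (Option κ → F) :=
  if Even l then 1 else ι F (Pi.single none 1)

/-- The vector with coordinates `g r`, or the point at infinity for `r = 0`. -/
def rowVector (g : ℕ → κ → F) (r : ℕ) : Option κ → F :=
  if r = 0 then Pi.single none 1 else ∑ i, g r i • Pi.single (some i) 1

lemma rowVector_of_pos (g : ℕ → κ → F) {r : ℕ} (hr : 0 < r) :
    rowVector g r = ∑ i, g r i • Pi.single (some i) 1 := if_neg hr.ne'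

variable [Algebra ℚ F]

/-- Induction by removing two vectors. For even length, expansion along the first vector reduces to
`pairProd_even`; for odd length, expansion along the point at infinity reduces to `pairProd_odd`. If
an index is repeated, both sides vanish. -/
theorem schur_pfaffian (z : κ → F) (hz : Function.Injective z) (hz2 : ∀ i j, z i + z j ≠ 0)
    {l : ℕ} (w : Fin l → κ) :
    scalarPart (expContract (kernelForm_isAlt z)
      (ιMulti F l (fun k => Pi.single (some (w k)) 1) * parityFactor F κ l)) =
    pairProd (tanhKernel z) w := by
  induction l using Nat.strong_induction_on with
  | _ l ih =>
  by_cases hw : Function.Injective w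
  swap
  · rw [pairProd_eq_zero _ (tanhKernel_swap z) (tanhKernel_self z) _ hw,
      (ιMulti F l).map_eq_zero_of_not_injective, zero_mul, map_zero, map_zero]
    intro h
    apply hw
    intro i j hij
    exact h (by simp [hij])
  rcases Nat.even_or_odd l with hl | hl
  · obtain rfl | ⟨l, rfl⟩ : l = 0 ∨ ∃ m, l = m + 2 := by
      rcases l with _ | _ | l
      · exact Or.inl rfl
      · exact absurd hl (by decide)
      · exact Or.inr ⟨l, rfl⟩
    · simp [parityFactor, pairProd_zero, expContract_one]
    · have hl' : Even l := by simpa [Nat.even_add] using hl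
      have hw' : Function.Injective (w ∘ Fin.succ) := hw.comp (Fin.succ_injective _)
      rw [parityFactor, if_pos hl, mul_one, ιMulti_succ_apply, scalarPart_expContract_cons,
        pairProd_succ, ← Finset.sum_neg_distrib]
      have h := pairProd_even (z ∘ (w ∘ Fin.succ)) (hz.comp hw') (fun i j => hz2 _ _) hl'
        (z (w 0)) (fun i => hz2 _ _)
      have h1 : pairProd (tanhKernel (z ∘ w ∘ Fin.succ)) id =
          pairProd (tanhKernel z) (w ∘ Fin.succ) :=
        pairProd_comp (tanhKernel z) (w ∘ Fin.succ) id
      rw [h1] at h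
      refine Eq.trans (Finset.sum_congr rfl fun q _ => ?_) h
      have h2 := ih l (by omega) ((w ∘ Fin.succ) ∘ q.succAbove)
      rw [parityFactor, if_pos hl', mul_one] at h2
      have h3 : pairProd (tanhKernel (z ∘ w ∘ Fin.succ)) q.succAbove = 
          pairProd (tanhKernel z) ((w ∘ Fin.succ) ∘ q.succAbove) :=
        pairProd_comp (tanhKernel z) (w ∘ Fin.succ) q.succAbove
      rw [h3, ← h2]
      simp only [Matrix.vecTail, Function.comp_apply, kernelForm_single, extKernel, tanhKernel]
      simp only [Function.comp_def]
      ring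
  · obtain ⟨l, rfl⟩ : ∃ m, l = m + 1 := ⟨l - 1, by have := hl.pos; omega⟩
    have hl' : Even l := by simpa [Nat.odd_add_one] using hl
    rw [parityFactor, if_neg (Nat.not_even_iff_odd.mpr hl)]
    -- The point at infinity stands last; moving it past an odd number of vectors costs a sign.
    have h0 := ι_mul_ιMulti_comm (S := F) (Pi.single none (1 : F))
      (fun k => (Pi.single (some (w k)) 1 : Option κ → F))
    rw [hl.neg_one_pow, neg_one_smul, eq_comm, neg_eq_iff_eq_neg] at h0
    rw [h0, map_neg, map_neg, scalarPart_expContract_cons, neg_neg]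
    have h := pairProd_odd (z ∘ w) (hz.comp hw) (fun i j => hz2 _ _) hl'
    have h1 : pairProd (tanhKernel (z ∘ w)) id = pairProd (tanhKernel z) w :=
      pairProd_comp (tanhKernel z) w id
    rw [h1] at h
    refine Eq.trans (Finset.sum_congr rfl fun q _ => ?_) h
    have h2 := ih l (by omega) (w ∘ q.succAbove)
    rw [parityFactor, if_pos hl', mul_one] at h2
    have h3 : pairProd (tanhKernel (z ∘ w)) q.succAbove =
        pairProd (tanhKernel z) (w ∘ q.succAbove) :=
      pairProd_comp (tanhKernel z) w q.succAbove
    rw [h3, ← h2]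
    simp only [kernelForm_single, extKernel, neg_neg, mul_one]
    rfl

lemma ιMulti_get {S V : Type*} [CommRing S] [AddCommGroup V] [Module S V] (u : ℕ → V)
    (β : List ℕ) : ιMulti S β.length (fun i => u (β.get i)) =
      (β.map fun r => ι S (u r)).prod := by
  rw [ιMulti_apply]
  congr 1
  conv_rhs => rw [← List.ofFn_get β]
  rw [List.map_ofFn]
  rfl

/-- Expand every row vector in the basis by multilinearity and apply Schur's Pfaffian to each term.
-/
lemma scalarPart_prod_rowVector (z : κ → F) (hz : Function.Injective z)
    (hz2 : ∀ i j, z i + z j ≠ 0) (g : ℕ → κ → F) (m : List ℕ) (hm : ∀ r ∈ m, 0 < r) :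
    scalarPart (expContract (kernelForm_isAlt z)
      ((m.map fun r => ι F (rowVector g r)).prod * parityFactor F κ m.length)) =
    ∑ w : Fin m.length → κ, (∏ k, g (m.get k) (w k)) * pairProd (tanhKernel z) w := by
  let L : ExteriorAlgebra F (Option κ → F) →ₗ[F] F :=
    scalarPart ∘ₗ expContract (kernelForm_isAlt z) ∘ₗ
      LinearMap.mulRight F (parityFactor F κ m.length)
  have h2 : ∀ v : Fin m.length → (Option κ → F), scalarPart (expContract (kernelForm_isAlt z)
      (ιMulti F _ v * parityFactor F κ m.length)) =
        (L.compMultilinearMap (ιMulti F m.length).toMultilinearMap) v := fun v => rfl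
  have h3 : (fun k => rowVector g (m.get k)) =
      fun k => ∑ i, g (m.get k) i • (Pi.single (some i) 1 : Option κ → F) := by
    ext1 k
    exact rowVector_of_pos g (hm _ (List.get_mem m k))
  rw [← ιMulti_get, h2, h3, MultilinearMap.map_sum]
  refine Finset.sum_congr rfl fun w _ => ?_
  rw [MultilinearMap.map_smul_univ, ← h2, schur_pfaffian z hz hz2, smul_eq_mul]

theorem pfaffian_kernel (z : κ → F) (hz : Function.Injective z) (hz2 : ∀ i j, z i + z j ≠ 0)
    (g : ℕ → κ → F) (m β : List ℕ) (hm : ∀ r ∈ m, 0 < r)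
    (hβ : β = m ++ if Even m.length then [] else [0]) :
    pfaffian (Matrix.of fun i j : Fin β.length =>
      - kernelForm z (rowVector g (β.get i)) (rowVector g (β.get j))) =
    ∑ w : Fin m.length → κ, (∏ k, g (m.get k) (w k)) * pairProd (tanhKernel z) w := by
  have heven : Even β.length := by
    rw [hβ]
    split_ifs with h
    · simpa using h
    · rw [List.length_append, List.length_singleton, Nat.even_add_one]
      exact h
  rw [pfaffian_gram (kernelForm_isAlt z) heven (fun i => rowVector g (β.get i)), ιMulti_get,
    ← scalarPart_prod_rowVector z hz hz2 g m hm, hβ, List.map_append, List.prod_append,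
    parityFactor]
  congr 3
  split_ifs
  · rfl
  · simp [rowVector]

end SchurPfaffian

/-! ### The hyperoctahedral sum, one variable at a time -/

section HallLittlewoodSum

variable {E : Type*} [Field E]

/-- The factor of `hlSummand` involving only the first variable. -/
def hlHead (d : ℕ) (t a : E) : E := a ^ d * ((1 - t * (a ^ 2)⁻¹) / (1 - (a ^ 2)⁻¹))

/-- The factor of `hlSummand` involving the first variable and another one. -/
def hlCross (t a u : E) : E :=
  ((1 - t * a⁻¹ * u) / (1 - a⁻¹ * u)) * ((1 - t * a⁻¹ * u⁻¹) / (1 - a⁻¹ * u⁻¹))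

/-- Inverting u exchanges the two factors; hence the signs of the remaining variables do not affect
the part involving the first one. -/
lemma hlCross_zpow (t a u : E) (e : ℤˣ) : hlCross t a (u ^ (e : ℤ)) = hlCross t a u := by
  rcases Int.units_eq_one_or e with rfl | rfl
  · simp
  · simp only [hlCross, Units.val_neg, Units.val_one, zpow_neg, zpow_one, inv_inv]
    ring

lemma hlSummand_succ {n : ℕ} (lam : Fin (n + 1) → ℕ) (t : E) (y : Fin (n + 1) → E) :
    hlSummand lam t y = hlHead (lam 0) t (y 0) * (∏ j, hlCross t (y 0) (y (Fin.succ j))) *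
      hlSummand (lam ∘ Fin.succ) t (y ∘ Fin.succ) := by
  simp only [hlSummand, Fin.prod_univ_succ, Fin.prod_Ioi_zero, Fin.prod_Ioi_succ, hlHead, hlCross,
    Function.comp_apply]
  ring

/-- The sum over the hyperoctahedral group. -/
def hlSum {n : ℕ} (lam : Fin n → ℕ) (t : E) (y : Fin n → E) : E :=
  ∑ w : Equiv.Perm (Fin n), ∑ e : Fin n → ℤˣ, hlSummand lam t fun i => y (w i) ^ ((e i : ℤˣ) : ℤ)

/-- Split the group by the signed variable placed first; the rest is the same sum in the other
variables. -/
lemma hlSum_succ {n : ℕ} (lam : Fin (n + 1) → ℕ) (t : E) (y : Fin (n + 1) → E) :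
    hlSum lam t y = ∑ q, ∑ ε : ℤˣ, hlHead (lam 0) t (y q ^ (ε : ℤ)) *
      (∏ j, hlCross t (y q ^ (ε : ℤ)) (y (q.succAbove j))) *
        hlSum (lam ∘ Fin.succ) t (y ∘ q.succAbove) := by
  rw [hlSum, sum_perm_succ]
  refine Finset.sum_congr rfl fun q _ => ?_
  simp only [hlSum, Finset.mul_sum]
  rw [Finset.sum_comm' (t' := Finset.univ) (s' := fun _ => Finset.univ) (by simp)]
  conv_rhs => rw [Finset.sum_comm' (t' := Finset.univ) (s' := fun _ => Finset.univ) (by simp)]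
  conv_lhs => rw [Finset.sum_comm' (t' := Finset.univ) (s' := fun _ => Finset.univ) (by simp)]
  refine Finset.sum_congr rfl fun w _ => ?_
  rw [← Fintype.sum_prod_type']
  refine (Fintype.sum_equiv (Fin.consEquiv fun _ => ℤˣ) _ _ fun x => ?_).symm
  obtain ⟨ε, e⟩ := x
  rw [hlSummand_succ]
  simp only [Fin.consEquiv_apply, cycleRange_symm_mul_liftPerm_zero, Fin.cons_zero,
    cycleRange_symm_mul_liftPerm_succ, Fin.cons_succ, hlCross_zpow, Function.comp_def]
  congr 2
  exact (Equiv.prod_comp w fun j => hlCross t (y q ^ (ε : ℤ)) (y (q.succAbove j))).symm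

/-- The variables and their inverses are pairwise different and nonzero. -/
def IsGeneric {n : ℕ} (y : Fin n → E) : Prop :=
  (∀ i, y i ≠ 0) ∧ Function.Injective fun p : Fin n × ℤˣ => y p.1 ^ (p.2 : ℤ)

lemma IsGeneric.comp {m n : ℕ} {y : Fin n → E} (hy : IsGeneric y) {f : Fin m → Fin n}
    (hf : Function.Injective f) : IsGeneric (y ∘ f) :=
  ⟨fun i => hy.1 (f i), hy.2.comp (hf.prodMap Function.injective_id)⟩

lemma IsGeneric.map {E' : Type*} [Field E'] (φ : E →+* E') {n : ℕ} {y : Fin n → E}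
    (hy : IsGeneric y) : IsGeneric (φ ∘ y) := by
  refine ⟨fun i => (map_ne_zero φ).mpr (hy.1 i), ?_⟩
  have : (fun p : Fin n × ℤˣ => (φ ∘ y) p.1 ^ (p.2 : ℤ)) =
      φ ∘ fun p : Fin n × ℤˣ => y p.1 ^ (p.2 : ℤ) := by
    ext p
    simp
  rw [this]
  exact φ.injective.comp hy.2

/-- This is `sum_prod_sub_mul_div` for the 2n points x_i and 1/x_i. The point inverse to the chosen
one supplies the head factor, and the other inverse pairs supply the cross factors. -/
lemma sum_hlHead_zero {n : ℕ} (t : E) (y : Fin n → E) (hy : IsGeneric y) :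
    (1 - t) * ∑ q, ∑ ε : ℤˣ, hlHead 0 t (y q ^ (ε : ℤ)) *
      (∏ j ∈ Finset.univ.erase q, hlCross t (y q ^ (ε : ℤ)) (y j)) = 1 - t ^ (2 * n) := by
  have h := sum_prod_sub_mul_div (Finset.univ : Finset (Fin n × ℤˣ)) (fun p => y p.1 ^ (p.2 : ℤ))
    hy.2.injOn t (fun p _ => zpow_ne_zero _ (hy.1 p.1))
  have hcard : (Finset.univ : Finset (Fin n × ℤˣ)).card = 2 * n := by
    rw [Finset.card_univ, Fintype.card_prod, Fintype.card_fin, Fintype.card_units_int, mul_comm]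
  rw [hcard] at h
  rw [← h, Fintype.sum_prod_type]
  congr 1
  refine Finset.sum_congr rfl fun q _ => Finset.sum_congr rfl fun ε _ => ?_
  have hdisj : (Finset.univ : Finset (Fin n × ℤˣ)).erase (q, ε) =
      Finset.cons (q, -ε) ((Finset.univ.erase q) ×ˢ Finset.univ) (by simp) := by
    ext ⟨j, δ⟩
    simp only [Finset.mem_erase, ne_eq, Prod.mk.injEq, Finset.mem_univ, and_true,
      Finset.mem_cons, Finset.mem_product]
    have := Int.units_ne_iff_eq_neg (u := δ) (v := ε)
    by_cases hj : j = q <;> simp [hj, this]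
  rw [hdisj, Finset.prod_cons, Finset.prod_product]
  have hinv : y q ^ ((-ε : ℤˣ) : ℤ) = (y q ^ (ε : ℤ))⁻¹ := by simp
  have ha : y q ^ (ε : ℤ) ≠ 0 := zpow_ne_zero _ (hy.1 q)
  congr 1
  · rw [hlHead, pow_zero, one_mul, hinv]
    generalize y q ^ (ε : ℤ) = a at ha
    have h1 : ∀ c : E, a - c * a⁻¹ = a * (1 - c * (a ^ 2)⁻¹) := fun c => by field_simp
    have h2 := h1 1
    rw [one_mul, one_mul] at h2
    rw [h1, h2, mul_div_mul_left _ _ ha]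
  · refine Finset.prod_congr rfl fun j _ => ?_
    have h1 : ∀ c u : E, y q ^ (ε : ℤ) - c * u =
        y q ^ (ε : ℤ) * (1 - c * (y q ^ (ε : ℤ))⁻¹ * u) := fun c u => by field_simp
    have h2 : ∀ u : E, (y q ^ (ε : ℤ) - t * u) / (y q ^ (ε : ℤ) - u) =
        (1 - t * (y q ^ (ε : ℤ))⁻¹ * u) / (1 - (y q ^ (ε : ℤ))⁻¹ * u) := fun u => by
      have h3 := h1 1 u
      rw [one_mul, one_mul] at h3
      rw [h1 t u, h3, mul_div_mul_left _ _ ha]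
    have h4 : (Finset.univ : Finset ℤˣ) = {1, -1} := rfl
    rw [h4, Finset.prod_pair (by decide), h2, h2, hlCross]
    simp

lemma hlSum_zero {n : ℕ} (t : E) (ht : t ≠ 1) (y : Fin n → E) (hy : IsGeneric y) :
    hlSum (fun _ => 0) t y = ∏ i ∈ Finset.Icc 1 n, (1 - t ^ (2 * i)) / (1 - t) := by
  induction n with
  | zero => simp [hlSum, hlSummand]
  | succ n ih =>
    rw [hlSum_succ]
    have h1 : ∀ q : Fin (n + 1), hlSum ((fun _ => 0) ∘ Fin.succ) t (y ∘ q.succAbove) =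
        ∏ i ∈ Finset.Icc 1 n, (1 - t ^ (2 * i)) / (1 - t) := fun q =>
      ih (y ∘ q.succAbove) (hy.comp Fin.succAbove_right_injective)
    simp only [h1]
    rw [← Finset.insert_Icc_right_eq_Icc_add_one (by omega), Finset.prod_insert (by simp)]
    simp only [← Finset.sum_mul]
    congr 1
    have h2 := sum_hlHead_zero t y hy
    simp only [prod_erase_succAbove] at h2
    rw [eq_div_iff (sub_ne_zero.mpr ht.symm), mul_comm]
    exact h2

end HallLittlewoodSum

/-! ### Cancelling the normalization before t is specialized -/

section HallLittlewoodPoly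

open Polynomial

variable {F : Type*} [Field F]

/-- The factor `hlHead d t a` as a polynomial in `t`. -/
def hlHeadPoly (d : ℕ) (a : F) : F[X] :=
  C (a ^ d) * ((1 - X * C ((a ^ 2)⁻¹)) * C ((1 - (a ^ 2)⁻¹)⁻¹))

/-- The factor `hlCross t a u` as a polynomial in `t`. -/
def hlCrossPoly (a u : F) : F[X] :=
  ((1 - X * C (a⁻¹ * u)) * C ((1 - a⁻¹ * u)⁻¹)) *
    ((1 - X * C (a⁻¹ * u⁻¹)) * C ((1 - a⁻¹ * u⁻¹)⁻¹))

/-- The Hall-Littlewood function of type `C` as a polynomial in `t`. -/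
def hlPoly : ∀ {n : ℕ}, (Fin n → ℕ) → (Fin n → F) → F[X]
  | 0, _, _ => 1
  | _ + 1, lam, y => if lam 0 = 0 then 1 else ∑ q, ∑ ε : ℤˣ,
      hlHeadPoly (lam 0) (y q ^ (ε : ℤ)) * (∏ j, hlCrossPoly (y q ^ (ε : ℤ)) (y (q.succAbove j))) *
        hlPoly (lam ∘ Fin.succ) (y ∘ q.succAbove)

lemma hlPoly_succ {n : ℕ} (lam : Fin (n + 1) → ℕ) (y : Fin (n + 1) → F) (h : lam 0 ≠ 0) :
    hlPoly lam y = ∑ q, ∑ ε : ℤˣ,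
      hlHeadPoly (lam 0) (y q ^ (ε : ℤ)) * (∏ j, hlCrossPoly (y q ^ (ε : ℤ)) (y (q.succAbove j))) *
        hlPoly (lam ∘ Fin.succ) (y ∘ q.succAbove) := by
  rw [hlPoly, if_neg h]

lemma hlPoly_of_zero {n : ℕ} (lam : Fin n → ℕ) (y : Fin n → F) (h : ∀ i, lam i = 0) :
    hlPoly lam y = 1 := by
  cases n with
  | zero => rfl
  | succ n => rw [hlPoly, if_pos (h 0)]

lemma algebraMap_hlHeadPoly (d : ℕ) (a : F) :
    algebraMap F[X] (RatFunc F) (hlHeadPoly d a) = hlHead d RatFunc.X (RatFunc.C a) := by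
  simp only [hlHeadPoly, hlHead, div_eq_mul_inv, map_mul, map_sub, map_one, map_pow, map_inv₀,
    RatFunc.algebraMap_X, RatFunc.algebraMap_C]

lemma algebraMap_hlCrossPoly (a u : F) :
    algebraMap F[X] (RatFunc F) (hlCrossPoly a u) =
      hlCross RatFunc.X (RatFunc.C a) (RatFunc.C u) := by
  simp [hlCrossPoly, hlCross, div_eq_mul_inv, mul_assoc]

/-- The sequence decreases strictly until it vanishes. -/
def IsStrictSeq {n : ℕ} (lam : Fin n → ℕ) : Prop := ∀ i j, i < j → lam j < lam i ∨ lam j = 0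

lemma IsStrictSeq.succ {n : ℕ} {lam : Fin (n + 1) → ℕ} (h : IsStrictSeq lam) :
    IsStrictSeq (lam ∘ Fin.succ) := fun _ _ hij => h _ _ (Fin.succ_lt_succ_iff.mpr hij)

lemma IsStrictSeq.eq_zero {n : ℕ} {lam : Fin (n + 1) → ℕ} (h : IsStrictSeq lam) (h0 : lam 0 = 0)
    (i : Fin (n + 1)) : lam i = 0 := by
  rcases Fin.eq_zero_or_eq_succ i with rfl | ⟨j, rfl⟩
  · exact h0
  · have := h 0 j.succ (Fin.succ_pos j)
    omega

/-- Positive parts have multiplicity at most one, so their factors are 1. -/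
lemma IsStrictSeq.hlNorm_eq {E : Type*} [Field E] {n : ℕ} {lam : Fin n → ℕ} (h : IsStrictSeq lam)
    (t : E) (ht : t ≠ 1) :
    hlNorm lam t = ∏ i ∈ Finset.Icc 1 (multiplicity lam 0), (1 - t ^ (2 * i)) / (1 - t) := by
  rw [hlNorm]
  refine (congrArg _ (Finset.prod_eq_one fun r hr => ?_)).trans (mul_one _)
  have hr0 : r ≠ 0 := (Finset.mem_erase.mp hr).1
  have h1 : multiplicity lam r ≤ 1 := by
    rw [multiplicity, Finset.card_le_one]
    intro i hi j hj
    simp only [Finset.mem_filter, Finset.mem_univ, true_and] at hi hj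
    rcases lt_trichotomy i j with hij | hij | hij
    · have := h i j hij
      omega
    · exact hij
    · have := h j i hij
      omega
  refine Finset.prod_eq_one fun i hi => ?_
  rw [Finset.mem_Icc] at hi
  obtain rfl : i = 1 := by omega
  rw [pow_one, div_self (sub_ne_zero.mpr ht.symm)]

lemma multiplicity_succ {n : ℕ} (lam : Fin (n + 1) → ℕ) (h : lam 0 ≠ 0) :
    multiplicity lam 0 = multiplicity (lam ∘ Fin.succ) 0 := by
  rw [multiplicity, multiplicity, Fin.univ_succ, Finset.filter_cons, if_neg h, Finset.filter_map,
    Finset.card_map]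
  rfl

lemma ratFunc_X_ne_one : (RatFunc.X : RatFunc F) ≠ 1 := by
  rw [← RatFunc.algebraMap_X, ← map_one (algebraMap F[X] (RatFunc F)), Ne,
    (RatFunc.algebraMap_injective F).eq_iff]
  intro h
  have h1 := congrArg natDegree h
  simp at h1

/-- Peel off the positive parts one by one; once only zeros remain, the sum equals the normalizing
factor. Since that factor may vanish at t = -1, the quotient must be identified as a polynomial in t
before evaluation. -/
lemma hlSum_eq {n : ℕ} {lam : Fin n → ℕ} (hlam : IsStrictSeq lam) (y : Fin n → F)
    (hy : IsGeneric y) : hlSum lam RatFunc.X (RatFunc.C ∘ y) =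
      hlNorm lam RatFunc.X * algebraMap F[X] (RatFunc F) (hlPoly lam y) := by
  by_cases h0 : ∀ i, lam i = 0
  · obtain rfl : lam = fun _ => 0 := funext h0
    rw [hlSum_zero _ ratFunc_X_ne_one _ (hy.map RatFunc.C), hlPoly_of_zero _ _ h0, map_one, mul_one,
      hlam.hlNorm_eq _ ratFunc_X_ne_one]
    simp [multiplicity]
  · induction n with
    | zero => exact absurd (fun i => i.elim0) h0
    | succ n ih =>
      have h00 : lam 0 ≠ 0 := fun h => h0 (hlam.eq_zero h)
      rw [hlSum_succ, hlPoly_succ _ _ h00, map_sum, Finset.mul_sum]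
      refine Finset.sum_congr rfl fun q _ => ?_
      rw [map_sum, Finset.mul_sum]
      refine Finset.sum_congr rfl fun ε _ => ?_
      have hq : IsGeneric (y ∘ q.succAbove) := hy.comp Fin.succAbove_right_injective
      have h1 : hlSum (lam ∘ Fin.succ) RatFunc.X ((RatFunc.C ∘ y) ∘ q.succAbove) =
          hlNorm (lam ∘ Fin.succ) RatFunc.X *
            algebraMap F[X] (RatFunc F) (hlPoly (lam ∘ Fin.succ) (y ∘ q.succAbove)) := by
        -- A tail of zeros lies outside the induction hypothesis and is summed by `hlSum_zero`.
        by_cases h2 : ∀ i, (lam ∘ Fin.succ) i = 0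
        · have h3 : lam ∘ Fin.succ = fun _ => 0 := funext h2
          rw [Function.comp_assoc, hlPoly_of_zero _ _ h2, h3,
            hlSum_zero _ ratFunc_X_ne_one _ (hq.map RatFunc.C), map_one, mul_one,
            IsStrictSeq.hlNorm_eq (h3 ▸ hlam.succ) _ ratFunc_X_ne_one]
          simp [multiplicity]
        · exact ih hlam.succ _ hq h2
      rw [h1, hlam.hlNorm_eq _ ratFunc_X_ne_one, hlam.succ.hlNorm_eq _ ratFunc_X_ne_one,
        multiplicity_succ _ h00, map_mul, map_mul, map_prod, algebraMap_hlHeadPoly]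
      simp only [algebraMap_hlCrossPoly, map_zpow₀, Function.comp_apply]
      ring

lemma hlNorm_X_ne_zero {n : ℕ} {lam : Fin n → ℕ} (hlam : IsStrictSeq lam) :
    hlNorm lam (RatFunc.X : RatFunc F) ≠ 0 := by
  rw [hlam.hlNorm_eq _ ratFunc_X_ne_one, Finset.prod_ne_zero_iff]
  intro i hi
  rw [Finset.mem_Icc] at hi
  refine div_ne_zero (sub_ne_zero.mpr fun h => ?_) (sub_ne_zero.mpr ratFunc_X_ne_one.symm)
  rw [← RatFunc.algebraMap_X, ← map_one (algebraMap F[X] (RatFunc F)), ← map_pow,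
    (RatFunc.algebraMap_injective F).eq_iff] at h
  have h2 := congrArg natDegree h
  rw [natDegree_one, natDegree_X_pow] at h2
  omega

end HallLittlewoodPoly

/-! ### Evaluation at t = -1 in the variables z = x + 1/x -/

section FiniteRows

open Polynomial

variable {F : Type*} [Field F]

/-- The variables `x + 1 / x`. -/
def zvar {n : ℕ} (y : Fin n → F) (i : Fin n) : F := y i + (y i)⁻¹

/-- The summands of the one-row functions. -/
def rowTerm {n : ℕ} (y : Fin n → F) (d : ℕ) (i : Fin n) : F :=
  2 * (∏ j ∈ Finset.univ.erase i, (zvar y i + zvar y j) / (zvar y i - zvar y j)) *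
    (zvar y i * (y i ^ d - (y i)⁻¹ ^ d) / (y i - (y i)⁻¹))

/-- The function `finiteQ`, as a sum over the sequences of indices. -/
def seqSum {n : ℕ} (y : Fin n → F) (m : List ℕ) : F :=
  ∑ w : Fin m.length → Fin n,
    (∏ k, rowTerm y (m.get k) (w k)) * pairProd (tanhKernel (zvar y)) w

lemma IsGeneric.sub_inv_ne_zero {n : ℕ} {y : Fin n → F} (hy : IsGeneric y) (i : Fin n) :
    y i - (y i)⁻¹ ≠ 0 := by
  intro h
  have h1 := @hy.2 (i, 1) (i, -1) (by simpa using sub_eq_zero.mp h)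
  simp at h1

lemma IsGeneric.zvar_sub {n : ℕ} {y : Fin n → F} (hy : IsGeneric y) {i j : Fin n} (hij : i ≠ j) :
    zvar y i - zvar y j ≠ 0 := by
  have hi := hy.1 i
  have hj := hy.1 j
  have h1 : y i - y j ≠ 0 := fun h => hij (by
    have h1 := @hy.2 (i, 1) (j, 1) (by simpa using sub_eq_zero.mp h)
    simpa using h1)
  have h2 : y i - (y j)⁻¹ ≠ 0 := fun h => hij (by
    have h1 := @hy.2 (i, 1) (j, -1) (by simpa using sub_eq_zero.mp h)
    simp at h1)
  have h3 : zvar y i - zvar y j = (y i - y j) * (y i - (y j)⁻¹) * (y i)⁻¹ := by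
    rw [zvar, zvar]
    field_simp
    ring
  rw [h3]
  exact mul_ne_zero (mul_ne_zero h1 h2) (inv_ne_zero hi)

/-- At t = ∓1 the product of the two linear factors in u is a⁻¹(z_i ± z_j), up to matching signs in
numerator and denominator; the result does not depend on the sign ε. -/
lemma eval_hlCrossPoly {n : ℕ} {y : Fin n → F} (hy : IsGeneric y) {i j : Fin n} (hij : i ≠ j)
    (ε : ℤˣ) : (hlCrossPoly (y i ^ (ε : ℤ)) (y j)).eval (-1) =
      (zvar y i + zvar y j) / (zvar y i - zvar y j) := by
  have h0 := hy.zvar_sub hij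
  have hz : zvar y i = y i ^ (ε : ℤ) + (y i ^ (ε : ℤ))⁻¹ := by
    rcases Int.units_eq_one_or ε with rfl | rfl
    · simp [zvar]
    · simp [zvar, add_comm]
  have ha : y i ^ (ε : ℤ) ≠ 0 := zpow_ne_zero _ (hy.1 i)
  rw [hz, zvar] at h0 ⊢
  generalize y i ^ (ε : ℤ) = a at *
  have hj := hy.1 j
  generalize y j = u at *
  have h1 : ∀ c : F, (1 - c * (a⁻¹ * u)) * (1 - c * (a⁻¹ * u⁻¹)) =
      a⁻¹ * (a + c ^ 2 * a⁻¹ - c * (u + u⁻¹)) := fun c => by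
    field_simp
    ring
  have h2 := h1 1
  have h3 := h1 (-1)
  simp only [one_mul, one_pow, neg_sq] at h2 h3
  have h4 : (hlCrossPoly a u).eval (-1) = ((1 - -1 * (a⁻¹ * u)) * (1 - -1 * (a⁻¹ * u⁻¹))) /
      ((1 - (a⁻¹ * u)) * (1 - (a⁻¹ * u⁻¹))) := by
    simp only [hlCrossPoly, eval_mul, eval_sub, eval_one, eval_X, eval_C, div_eq_mul_inv, mul_inv]
    ring
  rw [h4, h2, h3, mul_div_mul_left _ _ (inv_ne_zero ha)]
  congr 1
  ring

lemma eval_hlHeadPoly {n : ℕ} {y : Fin n → F} (hy : IsGeneric y) (d : ℕ) (i : Fin n) :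
    ∑ ε : ℤˣ, (hlHeadPoly d (y i ^ (ε : ℤ))).eval (-1) =
      zvar y i * (y i ^ d - (y i)⁻¹ ^ d) / (y i - (y i)⁻¹) := by
  have h1 := hy.sub_inv_ne_zero i
  have h2 := hy.1 i
  have h3 : ∀ a : F, a ≠ 0 → (hlHeadPoly d a).eval (-1) = (a + a⁻¹) * a ^ d / (a - a⁻¹) := by
    intro a ha
    have h4 : (1 - -1 * (a ^ 2)⁻¹) = a⁻¹ * (a + a⁻¹) := by field_simp; ring
    have h5 : (1 - (a ^ 2)⁻¹) = a⁻¹ * (a - a⁻¹) := by field_simp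
    simp only [hlHeadPoly, eval_mul, eval_sub, eval_one, eval_X, eval_C]
    rw [h4, h5, mul_inv, inv_inv]
    field_simp
  have h4 : (Finset.univ : Finset ℤˣ) = {1, -1} := rfl
  rw [h4, Finset.sum_pair (by decide), h3 _ (zpow_ne_zero _ h2), h3 _ (zpow_ne_zero _ h2)]
  simp only [Units.val_one, zpow_one, Units.val_neg, zpow_neg, inv_inv]
  rw [← neg_sub (y i) (y i)⁻¹, div_neg, zvar]
  ring

/-- Sequences returning to the first index q contribute 0, because the kernel vanishes on the
diagonal. For the others, dropping the variable x_q from a row term has the same effect as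
multiplying it by the kernel between q and its index. -/
lemma seqSum_cons {n : ℕ} {y : Fin (n + 1) → F} (hy : IsGeneric y)
    (hy2 : ∀ i j, zvar y i + zvar y j ≠ 0) (r : ℕ) (m : List ℕ) :
    seqSum y (r :: m) = ∑ q, rowTerm y r q * seqSum (y ∘ q.succAbove) m := by
  refine (Equiv.sum_comp (Fin.consEquiv fun _ : Fin (m.length + 1) => Fin (n + 1))
    (fun w : Fin (m.length + 1) → Fin (n + 1) => (∏ k, rowTerm y ((r :: m).get k) (w k)) *
      pairProd (tanhKernel (zvar y)) w)).symm.trans ?_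
  rw [Fintype.sum_prod_type]
  refine Finset.sum_congr rfl fun q _ => ?_
  rw [seqSum, Finset.mul_sum]
  refine (Finset.sum_of_injOn (fun w => q.succAbove ∘ w) ?_ ?_ ?_ ?_).symm
  · intro w _ w' _ h
    exact Fin.succAbove_right_injective.comp_left h
  · intro w _
    simp
  · intro w _ hw
    obtain ⟨k, hk⟩ : ∃ k, w k = q := by
      by_contra! hne
      apply hw
      choose v hv using fun k => Fin.exists_succAbove_eq (hne k)
      exact ⟨v, by simp, funext hv⟩
    simp only [Fin.consEquiv_apply]
    rw [pairProd_succ, Finset.prod_eq_zero (Finset.mem_univ k), zero_mul, mul_zero]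
    simp [hk, tanhKernel_self]
  · intro w _
    have hc : (Fin.consEquiv fun _ : Fin (m.length + 1) => Fin (n + 1)) (q, q.succAbove ∘ w) =
      (Fin.cons q (q.succAbove ∘ w) : Fin (m.length + 1) → Fin (n + 1)) := rfl
    simp only [hc]
    rw [pairProd_succ]
    have h1 : (Fin.cons q (q.succAbove ∘ w) : Fin (m.length + 1) → Fin (n + 1)) ∘ Fin.succ =
        q.succAbove ∘ w := by
      ext
      simp
    have h2 : pairProd (tanhKernel (zvar (y ∘ q.succAbove))) w =
        pairProd (tanhKernel (zvar y)) (q.succAbove ∘ w) :=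
      pairProd_comp (tanhKernel (zvar y)) q.succAbove w
    have h3 : ∀ d j, rowTerm (y ∘ q.succAbove) d j =
        rowTerm y d (q.succAbove j) * tanhKernel (zvar y) q (q.succAbove j) := by
      intro d j
      have h4 := hy.zvar_sub (q.succAbove_ne j)
      have h5 := hy2 (q.succAbove j) q
      have h6 : ∏ k ∈ Finset.univ.erase (q.succAbove j),
          (zvar y (q.succAbove j) + zvar y k) / (zvar y (q.succAbove j) - zvar y k) =
          ((zvar y (q.succAbove j) + zvar y q) / (zvar y (q.succAbove j) - zvar y q)) *
          ∏ k ∈ Finset.univ.erase j, (zvar y (q.succAbove j) + zvar y (q.succAbove k)) /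
            (zvar y (q.succAbove j) - zvar y (q.succAbove k)) := by
        rw [← Finset.mul_prod_erase _ _ (Finset.mem_erase.mpr ⟨(q.succAbove_ne j).symm,
          Finset.mem_univ q⟩)]
        congr 1
        have : (Finset.univ.erase (q.succAbove j)).erase q =
            (Finset.univ.erase j).map q.succAboveEmb := by
          ext k
          simp only [Finset.mem_erase, Finset.mem_univ, and_true, Finset.mem_map,
            Fin.succAboveEmb_apply]
          constructor
          · rintro ⟨hk1, hk2⟩
            obtain ⟨l, rfl⟩ := Fin.exists_succAbove_eq hk1
            exact ⟨l, fun h => hk2 (h ▸ rfl), rfl⟩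
          · rintro ⟨l, hl, rfl⟩
            exact ⟨q.succAbove_ne l, fun h => hl (Fin.succAbove_right_injective h)⟩
        rw [this, Finset.prod_map]
        rfl
      have h7 : (zvar y (q.succAbove j) + zvar y q) / (zvar y (q.succAbove j) - zvar y q) *
          tanhKernel (zvar y) q (q.succAbove j) = 1 := by
        rw [tanhKernel]
        field_simp
      have h8 : ∀ k, zvar (y ∘ q.succAbove) k = zvar y (q.succAbove k) := fun _ => rfl
      rw [rowTerm, rowTerm, h6]
      simp only [h8, Function.comp_apply]
      linear_combination (-(2 * (∏ k ∈ Finset.univ.erase j,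
        (zvar y (q.succAbove j) + zvar y (q.succAbove k)) /
            (zvar y (q.succAbove j) - zvar y (q.succAbove k))) * (zvar y (q.succAbove j) *
          (y (q.succAbove j) ^ d - (y (q.succAbove j))⁻¹ ^ d) /
            (y (q.succAbove j) - (y (q.succAbove j))⁻¹)))) * h7
    rw [h1, h2]
    simp only [h3]
    have h4 : (∏ x, rowTerm y ((r :: m).get x)
        ((Fin.cons q (q.succAbove ∘ w) : Fin (m.length + 1) → Fin (n + 1)) x)) =
        rowTerm y r q * ∏ x, rowTerm y (m.get x) (q.succAbove (w x)) :=
      (Fin.prod_univ_succ (n := m.length) _).trans (by simp)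
    rw [h4]
    simp only [Fin.cons_zero, Fin.cons_succ, Function.comp_apply, Finset.prod_mul_distrib]
    ring

/-- Both sides satisfy the same recursion on the first row, the factor 2 per part being built into
`rowTerm`. -/
theorem two_pow_mul_eval_hlPoly {n : ℕ} (y : Fin n → F) (hy : IsGeneric y)
    (hy2 : ∀ i j, zvar y i + zvar y j ≠ 0) (m : List ℕ) (hm : ∀ r ∈ m, 0 < r)
    (hlen : m.length ≤ n) :
    2 ^ m.length * (hlPoly (fun i : Fin n => m.getD i 0) y).eval (-1) = seqSum y m := by
  induction m generalizing n with
  | nil =>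
    rw [hlPoly_of_zero _ _ (by simp)]
    simp [seqSum, pairProd]
  | cons r m ih =>
    cases n with
    | zero => simp at hlen
    | succ n =>
      have hr : r ≠ 0 := (hm r (by simp)).ne'
      rw [seqSum_cons hy hy2, hlPoly_succ _ _ (by simpa using hr), eval_finsetSum, Finset.mul_sum]
      refine Finset.sum_congr rfl fun q _ => ?_
      rw [← ih (y ∘ q.succAbove) (hy.comp Fin.succAbove_right_injective) (fun i j => hy2 _ _)
        (fun r hr => hm r (List.mem_cons_of_mem _ hr)) (by simpa using hlen)]
      have h1 : (fun i : Fin (n + 1) => (r :: m).getD i 0) ∘ Fin.succ =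
          fun i : Fin n => m.getD i 0 := by
        ext i
        simp
      rw [h1, eval_finsetSum]
      simp only [eval_mul, eval_prod, ← Finset.sum_mul,
        eval_hlCrossPoly hy (q.succAbove_ne _).symm]
      simp only [Fin.val_zero, List.getD_cons_zero]
      rw [eval_hlHeadPoly hy, rowTerm, prod_erase_succAbove, List.length_cons, pow_succ]
      ring

end FiniteRows

/-! ### Genericity of the variables and the formula for `finiteQ` -/

section FiniteQ

open Polynomial

lemma xvar_injective {n : ℕ} : Function.Injective (xvar (n := n)) :=
  (IsFractionRing.injective (MvPolynomial (Fin n) ℚ) (RatFunField n)).comp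
    MvPolynomial.X_injective

lemma xvar_ne_zero {n : ℕ} (i : Fin n) : xvar i ≠ 0 := fun h => by
  have h1 := IsFractionRing.injective (MvPolynomial (Fin n) ℚ) (RatFunField n)
    (h.trans (map_zero _).symm)
  exact MvPolynomial.X_ne_zero i h1

lemma xvar_mul_xvar_ne_one {n : ℕ} (i j : Fin n) : xvar i * xvar j ≠ 1 := fun h => by
  rw [xvar, xvar, ← map_mul, ← map_one (algebraMap (MvPolynomial (Fin n) ℚ) (RatFunField n))] at h
  have h1 := IsFractionRing.injective (MvPolynomial (Fin n) ℚ) (RatFunField n) h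
  simpa using congrArg (MvPolynomial.eval 0) h1

lemma isGeneric_xvar (n : ℕ) : IsGeneric (xvar (n := n)) := by
  refine ⟨xvar_ne_zero, ?_⟩
  have h0 : ∀ i j : Fin n, xvar i ≠ (xvar j)⁻¹ := fun i j h =>
    xvar_mul_xvar_ne_one i j (by rw [h, inv_mul_cancel₀ (xvar_ne_zero j)])
  rintro ⟨i, ε⟩ ⟨j, δ⟩ h
  rcases Int.units_eq_one_or ε with rfl | rfl <;> rcases Int.units_eq_one_or δ with rfl | rfl
  · rw [xvar_injective (by simpa using h : xvar i = xvar j)]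
  · exact absurd (by simpa using h) (h0 i j)
  · exact absurd (by simpa using h.symm) (h0 j i)
  · rw [xvar_injective (by simpa using h : xvar i = xvar j)]

lemma zvar_xvar_add_ne_zero {n : ℕ} (i j : Fin n) :
    zvar (xvar (n := n)) i + zvar xvar j ≠ 0 := by
  intro h
  have hi := xvar_ne_zero i
  have hj := xvar_ne_zero j
  have h1 : (xvar i ^ 2 + 1) * xvar j + (xvar j ^ 2 + 1) * xvar i = 0 := by
    have h2 : (xvar i ^ 2 + 1) * xvar j + (xvar j ^ 2 + 1) * xvar i =
        xvar i * xvar j * (zvar xvar i + zvar xvar j) := by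
      rw [zvar, zvar]
      field_simp
    rw [h2, h, mul_zero]
  simp only [xvar] at h1
  simp only [← map_one (algebraMap (MvPolynomial (Fin n) ℚ) (RatFunField n)), ← map_pow,
    ← map_add, ← map_mul] at h1
  have h2 := IsFractionRing.injective (MvPolynomial (Fin n) ℚ) (RatFunField n)
    (h1.trans (map_zero _).symm)
  have h3 := congrArg (MvPolynomial.eval 1) h2
  norm_num at h3

lemma part_isStrictSeq (n : ℕ) (lam : StrictPartition) :
    IsStrictSeq fun i : Fin n => lam.part i := by
  intro i j hij
  simp only [StrictPartition.part]
  by_cases hj : (j : ℕ) < lam.parts.length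
  · left
    have hi : (i : ℕ) < lam.parts.length := lt_trans hij hj
    rw [List.getD_eq_getElem _ _ hj, List.getD_eq_getElem _ _ hi]
    exact List.pairwise_iff_getElem.mp lam.decreasing i j hi hj hij
  · right
    rw [List.getD_eq_default _ _ (not_lt.mp hj)]

theorem finiteQ_eq (n : ℕ) (lam : StrictPartition) (h : lam.length ≤ n) :
    finiteQ n lam = seqSum (xvar (n := n)) lam.parts := by
  rw [finiteQ, hallLittlewoodC]
  have h1 := hlSum_eq (part_isStrictSeq n lam) (xvar (n := n)) (isGeneric_xvar n)
  have h2 := hlNorm_X_ne_zero (F := RatFunField n) (part_isStrictSeq n lam)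
  rw [hlSum] at h1
  simp only [Function.comp_apply] at h1
  rw [h1, inv_mul_cancel_left₀ h2, RatFunc.eval_algebraMap]
  exact two_pow_mul_eval_hlPoly _ (isGeneric_xvar n) zvar_xvar_add_ne_zero lam.parts lam.pos h

end FiniteQ

/-! ### Two-row functions as polynomials in one-row functions -/

section PairRecursion

variable {S : Type*} [CommRing S]

/-- The two-row functions `Q_{(r,s)}`, as polynomials in the one-row functions `q`. -/
def pairQ (q : ℕ → S) : ℕ → ℕ → S
  | 0, 0 => 0
  | r + 1, 0 => q (r + 1)
  | 0, s + 1 => - q (s + 1)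
  | 1, 1 => q 1 * q 1 - 2 * q 2
  | r + 2, 1 => q (r + 2) * q 1 - 2 * q (r + 3) - 2 * q (r + 1)
  | r + 1, s + 2 => q (r + 1) * (q (s + 2) + q s) - (q (r + 2) + q r) * q (s + 1) -
      pairQ q (r + 2) (s + 1) - pairQ q r (s + 1) - pairQ q (r + 1) s

lemma map_pairQ {S' : Type*} [CommRing S'] (f : S →+* S') (q : ℕ → S) (r s : ℕ) :
    f (pairQ q r s) = pairQ (fun k => f (q k)) r s := by
  induction s using Nat.twoStepInduction generalizing r with
  | zero => cases r <;> simp [pairQ]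
  | one => rcases r with _ | _ | r <;> simp [pairQ, map_ofNat f 2]
  | more s ih0 ih1 => cases r <;> simp [pairQ, ih0, ih1]

lemma eq_pairQ {q : ℕ → S} {K : ℕ → ℕ → S} (h00 : K 0 0 = 0)
    (hr0 : ∀ r, K (r + 1) 0 = q (r + 1)) (h0s : ∀ s, K 0 (s + 1) = - q (s + 1))
    (h11 : K 1 1 = q 1 * q 1 - 2 * q 2)
    (hr1 : ∀ r, K (r + 2) 1 = q (r + 2) * q 1 - 2 * q (r + 3) - 2 * q (r + 1))
    (hrs : ∀ r s, K (r + 1) (s + 2) = q (r + 1) * (q (s + 2) + q s) -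
      (q (r + 2) + q r) * q (s + 1) - K (r + 2) (s + 1) - K r (s + 1) - K (r + 1) s) (r s : ℕ) :
    K r s = pairQ q r s := by
  induction s using Nat.twoStepInduction generalizing r with
  | zero => cases r <;> simp [pairQ, h00, hr0]
  | one => rcases r with _ | _ | r <;> simp [pairQ, h0s, h11, hr1]
  | more s ih0 ih1 => cases r <;> simp [pairQ, h0s, hrs, ih0, ih1]

end PairRecursion

/-! ### One-row and two-row functions in finitely many variables -/

section FiniteRows

variable {F : Type*} [Field F] {n : ℕ}

lemma rowTerm_zero (y : Fin n → F) (i : Fin n) : rowTerm y 0 i = 0 := by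
  simp [rowTerm]

lemma rowTerm_one {y : Fin n → F} (hy : IsGeneric y) (i : Fin n) : rowTerm y 1 i =
    2 * zvar y i * ∏ j ∈ Finset.univ.erase i, (zvar y i + zvar y j) / (zvar y i - zvar y j) := by
  rw [rowTerm, pow_one, pow_one, mul_div_cancel_right₀ _ (hy.sub_inv_ne_zero i)]
  ring

lemma rowTerm_add_two {y : Fin n → F} (hy : IsGeneric y) (d : ℕ) (i : Fin n) :
    rowTerm y (d + 2) i = zvar y i * rowTerm y (d + 1) i - rowTerm y d i := by
  have h1 : ∀ a b : F, a * b = 1 → a ^ (d + 2) - b ^ (d + 2) =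
      (a + b) * (a ^ (d + 1) - b ^ (d + 1)) - (a ^ d - b ^ d) := by
    intro a b hab
    linear_combination (b ^ d - a ^ d) * hab
  have h2 := h1 (y i) (y i)⁻¹ (mul_inv_cancel₀ (hy.1 i))
  rw [rowTerm, rowTerm, rowTerm, h2, ← zvar]
  ring

/-- The one-row functions in finitely many variables. -/
def rowSum (y : Fin n → F) (d : ℕ) : F := if d = 0 then 1 else ∑ i, rowTerm y d i

/-- The two-row functions in finitely many variables. -/
def pairSum (y : Fin n → F) (r s : ℕ) : F :=
  ∑ i, ∑ j, rowTerm y r i * rowTerm y s j * tanhKernel (zvar y) i j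

lemma pairSum_zero_left (y : Fin n → F) (s : ℕ) : pairSum y 0 s = 0 := by
  simp [pairSum, rowTerm_zero]

lemma pairSum_zero_right (y : Fin n → F) (s : ℕ) : pairSum y s 0 = 0 := by
  simp [pairSum, rowTerm_zero]

lemma zvar_injective {y : Fin n → F} (hy : IsGeneric y) : Function.Injective (zvar y) := by
  intro i j h
  by_contra hij
  exact hy.zvar_sub hij (sub_eq_zero.mpr h)

/-- The denominator z_i + z_j of the kernel is cleared by multiplication, and multiplying a row term
by z shifts its index up and down by one. This is where the recursion in `pairQ` comes from. -/
lemma pairSum_add_two {y : Fin n → F} (hy : IsGeneric y)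
    (hy2 : ∀ i j, zvar y i + zvar y j ≠ 0) (r s : ℕ) :
    pairSum y (r + 1) (s + 2) =
      (∑ i, rowTerm y (r + 1) i) * ((∑ i, rowTerm y (s + 2) i) + ∑ i, rowTerm y s i) -
      ((∑ i, rowTerm y (r + 2) i) + ∑ i, rowTerm y r i) * (∑ i, rowTerm y (s + 1) i) -
      pairSum y (r + 2) (s + 1) - pairSum y r (s + 1) - pairSum y (r + 1) s := by
  have h1 : ∀ d, (∑ i, rowTerm y (d + 2) i) + ∑ i, rowTerm y d i =
      ∑ i, zvar y i * rowTerm y (d + 1) i := by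
    intro d
    rw [← Finset.sum_add_distrib]
    refine Finset.sum_congr rfl fun i _ => ?_
    rw [rowTerm_add_two hy]
    ring
  rw [h1, h1]
  simp only [Finset.sum_mul_sum, pairSum, ← Finset.sum_sub_distrib]
  refine Finset.sum_congr rfl fun i _ => Finset.sum_congr rfl fun j _ => ?_
  have h2 : tanhKernel (zvar y) i j * (zvar y j + zvar y i) = zvar y j - zvar y i :=
    div_mul_cancel₀ _ (hy2 j i)
  rw [rowTerm_add_two hy, rowTerm_add_two hy]
  linear_combination (rowTerm y (r + 1) i * rowTerm y (s + 1) j) * h2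

/-- Partial fractions at U = -z_i, where the factor with index i makes the product vanish. -/
lemma sum_rowTerm_one_mul_tanhKernel {y : Fin n → F} (hy : IsGeneric y)
    (hy2 : ∀ i j, zvar y i + zvar y j ≠ 0) (i : Fin n) :
    ∑ j, rowTerm y 1 j * tanhKernel (zvar y) i j = (∑ j, rowTerm y 1 j) - 2 * zvar y i := by
  have h1 := prod_add_div_sub Finset.univ (zvar y) (zvar_injective hy).injOn (- zvar y i)
    (fun j _ h => hy2 i j (by rw [← h]; ring))
  rw [Finset.prod_eq_zero (Finset.mem_univ i) (by simp)] at h1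
  have h2 : ∑ j, rowTerm y 1 j * tanhKernel (zvar y) i j = (∑ j, rowTerm y 1 j) + 2 * zvar y i *
      ∑ j, 2 * zvar y j * (∏ k ∈ Finset.univ.erase j, (zvar y j + zvar y k) /
        (zvar y j - zvar y k)) / (- zvar y i - zvar y j) := by
    rw [Finset.mul_sum, ← Finset.sum_add_distrib]
    refine Finset.sum_congr rfl fun j _ => ?_
    have h3 := hy2 j i
    have h4 : - zvar y i - zvar y j ≠ 0 := fun h => h3 (by linear_combination -h)
    rw [← rowTerm_one hy, tanhKernel]
    field_simp
    ring
  linear_combination h2 - 2 * zvar y i * h1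

lemma pairSum_one {y : Fin n → F} (hy : IsGeneric y)
    (hy2 : ∀ i j, zvar y i + zvar y j ≠ 0) (r : ℕ) :
    pairSum y (r + 1) 1 = (∑ i, rowTerm y (r + 1) i) * (∑ i, rowTerm y 1 i) -
      2 * (∑ i, rowTerm y (r + 2) i) - 2 * ∑ i, rowTerm y r i := by
  simp only [pairSum, mul_assoc, ← Finset.mul_sum, sum_rowTerm_one_mul_tanhKernel hy hy2]
  rw [Finset.sum_mul, Finset.mul_sum, Finset.mul_sum, ← Finset.sum_sub_distrib,
    ← Finset.sum_sub_distrib]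
  refine Finset.sum_congr rfl fun i _ => ?_
  rw [rowTerm_add_two hy]
  ring

lemma neg_kernelForm_rowVector_eq {y : Fin n → F} (r s : ℕ) :
    - kernelForm (zvar y) (rowVector (rowTerm y) r) (rowVector (rowTerm y) s) =
      if r = 0 then if s = 0 then 0 else - ∑ i, rowTerm y s i
      else if s = 0 then ∑ i, rowTerm y r i else pairSum y r s := by
  have h : ∀ k (i : Fin n), rowVector (rowTerm y) k (some i) =
      if k = 0 then 0 else rowTerm y k i := by
    intro k i
    rw [rowVector]
    split_ifs
    · simp
    · simp [Finset.sum_apply, Pi.single_apply]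
  have h' : ∀ k, rowVector (rowTerm y) k none = if k = 0 then 1 else 0 := by
    intro k
    rw [rowVector]
    split_ifs
    · simp
    · simp [Finset.sum_apply]
  rw [kernelForm_apply, neg_neg]
  simp only [Fintype.sum_option, h, h', extKernel]
  split_ifs <;> simp [pairSum]

/-- The point at infinity accounts for the values at index 0. The boundary clauses of `pairQ`
compensate for the convention that the row term of index 0 vanishes while the one-row function is 1.
-/
theorem neg_kernelForm_rowVector {y : Fin n → F} (hy : IsGeneric y)
    (hy2 : ∀ i j, zvar y i + zvar y j ≠ 0) (r s : ℕ) :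
    - kernelForm (zvar y) (rowVector (rowTerm y) r) (rowVector (rowTerm y) s) =
      pairQ (rowSum y) r s := by
  rw [neg_kernelForm_rowVector_eq]
  refine eq_pairQ (K := fun r s => if r = 0 then if s = 0 then 0 else - ∑ i, rowTerm y s i
      else if s = 0 then ∑ i, rowTerm y r i else pairSum y r s) ?_ ?_ ?_ ?_ ?_ ?_ r s
  · simp
  · simp [rowSum]
  · simp [rowSum]
  · simp [rowSum, pairSum_one hy hy2 0, rowTerm_zero]
  · intro r
    simp [rowSum, pairSum_one hy hy2]
  · intro r s
    have h := pairSum_add_two hy hy2 r s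
    rcases r with _ | r <;> rcases s with _ | s <;>
      simp [rowSum, h, rowTerm_zero, pairSum_zero_left, pairSum_zero_right] <;> ring

open PowerSeries in
-- For each i the row terms obey a linear recursion, so their generating series is rational with
-- denominator 1 - zX + X². Adding them up is the partial fraction decomposition of the product.
lemma prod_one_add_mul {y : Fin n → F} (hy : IsGeneric y) :
    (∏ i, (1 - C (zvar y i) * X + X ^ 2 : PowerSeries F)) * mk (rowSum y) =
      ∏ i, (1 + C (zvar y i) * X + X ^ 2 : PowerSeries F) := by
  set A := algebraMap (PowerSeries F) (FractionRing (PowerSeries F))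
  have hA : Function.Injective A := IsFractionRing.injective _ _
  set z : Fin n → FractionRing (PowerSeries F) := fun i => A (C (zvar y i)) with hz
  have hzi : Function.Injective z :=
    hA.comp (MvPowerSeries.C_injective.comp (zvar_injective hy))
  have hX : A X ≠ 0 := (map_ne_zero_iff A hA).mpr X_ne_zero
  -- With U = X + 1/X the factors 1 ∓ zX + X² become X(U ∓ z).
  set U := (1 + A X ^ 2) / A X with hU
  have hD : ∀ i, A (1 - C (zvar y i) * X + X ^ 2) = A X * (U - z i) := by
    intro i
    simp only [map_add, map_sub, map_mul, map_one, map_pow, hU, hz]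
    field_simp
    ring
  have hE : ∀ i, A (1 + C (zvar y i) * X + X ^ 2) = A X * (U + z i) := by
    intro i
    simp only [map_add, map_mul, map_one, map_pow, hU, hz]
    field_simp
    ring
  have hD0 : ∀ i, (1 - C (zvar y i) * X + X ^ 2 : PowerSeries F) ≠ 0 := by
    intro i h
    simpa using congrArg (coeff 0) h
  have hUz : ∀ i, U - z i ≠ 0 := by
    intro i h
    have h1 := hD i
    rw [h, mul_zero] at h1
    exact hD0 i ((map_eq_zero_iff A hA).mp h1)
  have hg : ∀ i, (mk fun d => rowTerm y d i) * (1 - C (zvar y i) * X + X ^ 2) =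
      C (rowTerm y 1 i) * X := by
    intro i
    ext d
    rw [mul_add, mul_sub, mul_one, ← mul_assoc, mul_comm _ (C (zvar y i)), mul_assoc]
    rcases d with _ | _ | d
    · simp [rowTerm_zero]
    · simp [rowTerm_zero, coeff_succ_mul_X]
      rw [coeff_mul_X_pow' _ 2 1]
      simp
    · rw [map_add, map_sub, coeff_C_mul, coeff_succ_mul_X, coeff_mul_X_pow' _ 2 (d + 1 + 1),
        if_pos (by omega), coeff_C_mul, coeff_X]
      simp [rowTerm_add_two hy]
  have hsum : mk (rowSum y) = 1 + ∑ i, mk fun d => rowTerm y d i := by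
    ext d
    rw [coeff_mk, map_add, map_sum, coeff_one, rowSum]
    split_ifs with h
    · simp [h, rowTerm_zero]
    · simp
  have h1 := prod_add_div_sub Finset.univ z hzi.injOn U (fun i _ h => hUz i (sub_eq_zero.mpr h))
  have h2 : A (mk (rowSum y)) = ∏ i, (U + z i) / (U - z i) := by
    rw [h1, hsum, map_add, map_one, map_sum]
    congr 1
    refine Finset.sum_congr rfl fun i _ => ?_
    rw [eq_div_iff (hUz i)]
    refine mul_left_cancel₀ hX ?_
    have h3 := congrArg A (hg i)
    rw [map_mul, hD, map_mul, rowTerm_one hy] at h3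
    have h4 : A (C (2 * zvar y i * ∏ j ∈ Finset.univ.erase i, (zvar y i + zvar y j) /
        (zvar y i - zvar y j))) =
        2 * z i * ∏ j ∈ Finset.univ.erase i, (z i + z j) / (z i - z j) := by
      have : ∀ x, A (C x) = (A.comp (C (R := F))) x := fun _ => rfl
      simp only [this, map_mul, map_prod, map_div₀, map_add, map_sub, map_ofNat, hz]
    rw [h4] at h3
    linear_combination h3
  apply hA
  rw [map_mul, map_prod, map_prod, h2]
  simp only [hD, hE, Finset.prod_mul_distrib, Finset.prod_div_distrib]
  have h3 : ∏ i, (U - z i) ≠ 0 := Finset.prod_ne_zero_iff.mpr fun i _ => hUz i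
  field_simp

end FiniteRows

section PfaffianMap

lemma map_pfaffian {S S' : Type*} [CommRing S] [Algebra ℚ S] [CommRing S'] [Algebra ℚ S']
    (f : S →ₐ[ℚ] S') {N : ℕ} (A : Matrix (Fin N) (Fin N) S) :
    f (pfaffian A) = pfaffian (A.map f) := by
  simp [pfaffian, map_sum, map_prod]

end PfaffianMap

/-! ### Power series of bounded degree -/

section BoundedSeries

open MvPowerSeries

variable {κ σ : Type*}

/-- The exponents are bounded. -/
def IsBounded {R : Type*} [CommRing R] (f : MvPowerSeries σ R) : Prop :=
  ∃ N : ℕ, ∀ d : σ →₀ ℕ, N < d.degree → coeff d f = 0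

lemma isBounded_C {R : Type*} [CommRing R] (r : R) : IsBounded (C r : MvPowerSeries σ R) := by
  classical
  refine ⟨0, fun d hd => ?_⟩
  rw [coeff_C, if_neg]
  rintro rfl
  simp at hd

lemma IsBounded.add {R : Type*} [CommRing R] {f g : MvPowerSeries σ R} (hf : IsBounded f)
    (hg : IsBounded g) : IsBounded (f + g) := by
  obtain ⟨M, hM⟩ := hf
  obtain ⟨N, hN⟩ := hg
  refine ⟨M + N, fun d hd => ?_⟩
  rw [map_add, hM d (by omega), hN d (by omega), add_zero]

lemma IsBounded.mul {R : Type*} [CommRing R] {f g : MvPowerSeries σ R} (hf : IsBounded f)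
    (hg : IsBounded g) : IsBounded (f * g) := by
  classical
  obtain ⟨M, hM⟩ := hf
  obtain ⟨N, hN⟩ := hg
  refine ⟨M + N, fun d hd => ?_⟩
  rw [coeff_mul]
  refine Finset.sum_eq_zero fun x hx => ?_
  rw [Finset.HasAntidiagonal.mem_antidiagonal] at hx
  rw [← hx, map_add] at hd
  by_cases h : M < x.1.degree
  · rw [hM _ h, zero_mul]
  · rw [hN x.2 (by omega), mul_zero]

lemma degree_embDomain (e : κ ↪ σ) (d : κ →₀ ℕ) : (d.embDomain e).degree = d.degree := by
  rw [Finsupp.degree_apply, Finsupp.degree_apply, Finsupp.support_embDomain, Finset.sum_map]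
  simp

lemma IsBounded.killCompl {R : Type*} [CommRing R] {f : MvPowerSeries σ R} (hf : IsBounded f)
    (e : κ ↪ σ) : IsBounded (MvPowerSeries.killCompl e f) := by
  obtain ⟨M, hM⟩ := hf
  exact ⟨M, fun d hd => by rw [coeff_killCompl, hM _ (by rwa [degree_embDomain])]⟩

lemma exists_coe_eq [Finite κ] {R : Type*} [CommRing R] {f : MvPowerSeries κ R}
    (hf : IsBounded f) : ∃ P : MvPolynomial κ R, (P : MvPowerSeries κ R) = f := by
  obtain ⟨N, hN⟩ := hf
  have hfin : (Function.support fun d : κ →₀ ℕ => coeff d f).Finite := by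
    classical
    have := Fintype.ofFinite κ
    refine (Set.finite_Icc 0 (Finsupp.equivFunOnFinite.symm fun _ => N)).subset fun d hd =>
      ⟨zero_le, fun i => ?_⟩
    have h1 : d.degree ≤ N := by
      by_contra h
      exact hd (hN d (not_le.mp h))
    exact (Finsupp.le_degree i d).trans h1
  refine ⟨∑ d ∈ hfin.toFinset, MvPolynomial.monomial d (coeff d f), ?_⟩
  classical
  ext d
  rw [MvPolynomial.coeff_coe, MvPolynomial.coeff_sum]
  simp only [MvPolynomial.coeff_monomial, Finset.sum_ite_eq', Set.Finite.mem_toFinset,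
    Function.mem_support]
  split_ifs with h
  · rfl
  · exact (not_not.mp h).symm

end BoundedSeries

/-! ### Symmetric functions are determined by their specializations -/

section Specialization

open MvPowerSeries

variable {σ : Type*} {n : ℕ}

/-- The values of the variables. -/
def specPoint (n : ℕ) : Fin n ⊕ Fin n → RatFunField n :=
  Sum.elim xvar fun i => (xvar i)⁻¹

lemma specialize_eq (e : Fin n ⊕ Fin n ↪ σ) (f : MvPowerSeries σ ℚ) :
    specialize e f = ∑ᶠ d : Fin n ⊕ Fin n →₀ ℕ,
      algebraMap ℚ (RatFunField n) (coeff d (killCompl e f)) * ∏ k, specPoint n k ^ d k := by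
  simp [specialize, coeff_killCompl, specPoint, Fintype.prod_sum_type]

lemma specialize_eq_aeval (e : Fin n ⊕ Fin n ↪ σ) (f : MvPowerSeries σ ℚ)
    (P : MvPolynomial (Fin n ⊕ Fin n) ℚ) (hP : (P : MvPowerSeries _ ℚ) = killCompl e f) :
    specialize e f = MvPolynomial.aeval (specPoint n) P := by
  rw [specialize_eq, ← hP, MvPolynomial.aeval_def, MvPolynomial.eval₂_eq']
  refine finsum_eq_sum_of_support_subset _ fun d hd => ?_
  rw [Finset.mem_coe, MvPolynomial.mem_support_iff]
  intro h
  simp [h] at hd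

lemma specialize_add (e : Fin n ⊕ Fin n ↪ σ) {f g : MvPowerSeries σ ℚ} (hf : IsBounded f)
    (hg : IsBounded g) : specialize e (f + g) = specialize e f + specialize e g := by
  obtain ⟨P, hP⟩ := exists_coe_eq (hf.killCompl e)
  obtain ⟨Q, hQ⟩ := exists_coe_eq (hg.killCompl e)
  rw [specialize_eq_aeval e f P hP, specialize_eq_aeval e g Q hQ,
    specialize_eq_aeval e (f + g) (P + Q) (by simp [hP, hQ]), map_add]

lemma specialize_mul (e : Fin n ⊕ Fin n ↪ σ) {f g : MvPowerSeries σ ℚ} (hf : IsBounded f)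
    (hg : IsBounded g) : specialize e (f * g) = specialize e f * specialize e g := by
  obtain ⟨P, hP⟩ := exists_coe_eq (hf.killCompl e)
  obtain ⟨Q, hQ⟩ := exists_coe_eq (hg.killCompl e)
  rw [specialize_eq_aeval e f P hP, specialize_eq_aeval e g Q hQ,
    specialize_eq_aeval e (f * g) (P * Q) (by simp [hP, hQ]), map_mul]

lemma specialize_C (e : Fin n ⊕ Fin n ↪ σ) (c : ℚ) :
    specialize e (C c) = algebraMap ℚ (RatFunField n) c := by
  rw [specialize_eq_aeval e (C c) (MvPolynomial.C c) (by simp), MvPolynomial.aeval_C]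

lemma isSymmetricFunction_iff {f : MvPowerSeries σ ℚ} : IsSymmetricFunction f ↔
    IsBounded f ∧ ∀ p : Equiv.Perm σ, killCompl p.toEmbedding f = f := by
  refine and_congr Iff.rfl (forall_congr' fun p => ?_)
  rw [MvPowerSeries.ext_iff]
  refine forall_congr' fun d => ?_
  rw [coeff_killCompl, Finsupp.embDomain_eq_mapDomain, Finsupp.equivMapDomain_eq_mapDomain]
  rfl

variable (σ) in
/-- The algebra of symmetric functions. -/
def symmetricFunctions : Subalgebra ℚ (MvPowerSeries σ ℚ) where
  carrier := {f | IsSymmetricFunction f}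
  mul_mem' hf hg := by
    rw [Set.mem_ofPred_eq, isSymmetricFunction_iff] at *
    exact ⟨hf.1.mul hg.1, fun p => by rw [map_mul, hf.2, hg.2]⟩
  add_mem' hf hg := by
    rw [Set.mem_ofPred_eq, isSymmetricFunction_iff] at *
    exact ⟨hf.1.add hg.1, fun p => by rw [map_add, hf.2, hg.2]⟩
  algebraMap_mem' c := by
    rw [Set.mem_ofPred_eq, isSymmetricFunction_iff]
    exact ⟨isBounded_C c, fun p => killCompl_C c⟩

/-- The specialization of symmetric functions as a homomorphism. -/
def specializeHom (e : Fin n ⊕ Fin n ↪ σ) : symmetricFunctions σ →ₐ[ℚ] RatFunField n where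
  toFun f := specialize e f
  map_one' := by simpa using specialize_C e 1
  map_zero' := by simpa using specialize_C e 0
  map_mul' f g := specialize_mul e f.2.1 g.2.1
  map_add' f g := specialize_add e f.2.1 g.2.1
  commutes' c := specialize_C e c

/-- The variables of a given monomial are all placed among the x_i, so that none of them is
specialized to an inverse. -/
lemma exists_embedding [Infinite σ] (s : Finset σ) (N : ℕ) : ∃ n, N ≤ n ∧
    ∃ e : Fin n ⊕ Fin n ↪ σ, ∀ x ∈ s, ∃ i, e (Sum.inl i) = x := by
  classical
  obtain ⟨t, hst, ht⟩ := Infinite.exists_superset_card_eq s (max N s.card) (le_max_right _ _)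
  obtain ⟨u, htu, hu⟩ := Infinite.exists_superset_card_eq t (t.card + t.card) (by omega)
  refine ⟨t.card, by rw [ht]; exact le_max_left _ _, ?_⟩
  have h1 : (u \ t).card = t.card := by rw [Finset.card_sdiff_of_subset htu]; omega
  have e1 := t.equivFin
  have e2 := (u \ t).equivFinOfCardEq h1
  refine ⟨⟨Sum.elim (fun i => (e1.symm i : σ)) fun i => (e2.symm i : σ), ?_⟩, ?_⟩
  · refine Function.Injective.sumElim (Subtype.val_injective.comp e1.symm.injective)
      (Subtype.val_injective.comp e2.symm.injective) fun i j h => ?_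
    have h2 := (e2.symm j).2
    rw [← h, Finset.mem_sdiff] at h2
    exact h2.2 (e1.symm i).2
  · intro x hx
    exact ⟨e1 ⟨x, hst hx⟩, by simp⟩

/-- A monomial of top degree involving no inverses cannot be matched after specialization:
cancelling x_i against 1/x_i lowers the net degree, so a coinciding monomial would have larger
degree. -/
lemma eq_zero_of_aeval_specPoint (P : MvPolynomial (Fin n ⊕ Fin n) ℚ)
    (hP : MvPolynomial.aeval (specPoint n) P = 0) (d₀ : Fin n ⊕ Fin n →₀ ℕ)
    (hd₀ : ∀ i, d₀ (Sum.inr i) = 0) (hdeg : ∀ d ∈ P.support, d.degree ≤ d₀.degree) :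
    P.coeff d₀ = 0 := by
  classical
  set D := d₀.degree
  -- Exponents after multiplication by the product of all x_i^D; D bounds every exponent in the
  -- support, so the subtraction does not truncate.
  let ex : (Fin n ⊕ Fin n →₀ ℕ) → (Fin n →₀ ℕ) := fun d =>
    Finsupp.equivFunOnFinite.symm fun i => d (Sum.inl i) + (D - d (Sum.inr i))
  let Q : MvPolynomial (Fin n) ℚ := ∑ d ∈ P.support, MvPolynomial.monomial (ex d) (P.coeff d)
  have hQ : algebraMap (MvPolynomial (Fin n) ℚ) (RatFunField n) Q =
      (∏ i, xvar i ^ D) * MvPolynomial.aeval (specPoint n) P := by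
    rw [MvPolynomial.aeval_def, MvPolynomial.eval₂_eq', Finset.mul_sum, map_sum]
    refine Finset.sum_congr rfl fun d hd => ?_
    rw [MvPolynomial.monomial_eq, map_mul, Finsupp.prod_fintype _ _ (by simp), map_prod,
      Fintype.prod_sum_type, mul_left_comm, ← MvPolynomial.algebraMap_eq,
      ← IsScalarTower.algebraMap_apply]
    congr 1
    rw [← Finset.prod_mul_distrib, ← Finset.prod_mul_distrib]
    refine Finset.prod_congr rfl fun i _ => ?_
    have hle : d (Sum.inr i) ≤ D := (Finsupp.le_degree _ d).trans (hdeg d hd)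
    have hx := xvar_ne_zero i
    rw [map_pow, ← xvar]
    simp only [ex, specPoint, Sum.elim_inl, Sum.elim_inr, Finsupp.coe_equivFunOnFinite_symm]
    rw [pow_add, inv_pow, pow_sub₀ _ hx hle]
    ring
  rw [hP, mul_zero, map_eq_zero_iff _
    (IsFractionRing.injective (MvPolynomial (Fin n) ℚ) (RatFunField n))] at hQ
  have h1 := congrArg (MvPolynomial.coeff (ex d₀)) hQ
  simp only [Q, MvPolynomial.coeff_sum, MvPolynomial.coeff_monomial, MvPolynomial.coeff_zero] at h1
  by_contra hne
  rw [Finset.sum_eq_single d₀] at h1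
  · rw [if_pos rfl] at h1
    exact hne h1
  · intro d hd hdd
    rw [if_neg]
    intro h
    have h2 : ∀ i, d (Sum.inl i) = d₀ (Sum.inl i) + d (Sum.inr i) := by
      intro i
      have h3 := DFunLike.congr_fun h i
      simp only [ex, Finsupp.coe_equivFunOnFinite_symm, hd₀] at h3
      have hle : d (Sum.inr i) ≤ D := (Finsupp.le_degree _ d).trans (hdeg d hd)
      omega
    have h4 : d.degree = D + 2 * ∑ i, d (Sum.inr i) := by
      simp only [D, Finsupp.degree_eq_sum, Fintype.sum_sum_type, h2, hd₀, Finset.sum_add_distrib,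
        Finset.sum_const_zero]
      ring
    have h5 : ∑ i, d (Sum.inr i) = 0 := by
      have := hdeg d hd
      omega
    have h6 : ∀ i, d (Sum.inr i) = 0 := fun i =>
      Finset.sum_eq_zero_iff.mp h5 i (Finset.mem_univ i)
    apply hdd
    ext (i | i)
    · rw [h2, h6, add_zero]
    · rw [h6, hd₀]
  · intro h
    rw [if_pos rfl]
    exact MvPolynomial.notMem_support_iff.mp h

/-- Choose a nonzero term of maximal degree and an embedding that places its variables among the
x_i; the previous lemma then forces its coefficient to vanish. -/
theorem eq_zero_of_specialize [Infinite σ] {f : MvPowerSeries σ ℚ} (hf : IsBounded f) (N : ℕ)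
    (h : ∀ n, N ≤ n → ∀ e : Fin n ⊕ Fin n ↪ σ, specialize e f = 0) : f = 0 := by
  classical
  by_contra hne
  obtain ⟨M, hM⟩ := hf
  obtain ⟨d₁, hd₁⟩ : ∃ d, coeff d f ≠ 0 := by
    by_contra! h0
    exact hne (MvPowerSeries.ext h0)
  obtain ⟨D, ⟨d, hd, rfl⟩, hmax⟩ : ∃ D, (∃ d, coeff d f ≠ 0 ∧ d.degree = D) ∧
      ∀ d, coeff d f ≠ 0 → d.degree ≤ D := by
    have hb : ∀ d, coeff d f ≠ 0 → d.degree ≤ M := fun d hd => by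
      by_contra h1
      exact hd (hM d (not_le.mp h1))
    have h2 := Nat.findGreatest_spec (P := fun D => ∃ d, coeff d f ≠ 0 ∧ d.degree = D)
      (hb d₁ hd₁) ⟨d₁, hd₁, rfl⟩
    refine ⟨_, h2, fun d hd => Nat.le_findGreatest (hb d hd) ⟨d, hd, rfl⟩⟩
  obtain ⟨n, hn, e, he⟩ := exists_embedding d.support N
  obtain ⟨P, hP⟩ := exists_coe_eq (IsBounded.killCompl ⟨M, hM⟩ e)
  have hco : ∀ c, P.coeff c = coeff (c.embDomain e) f := fun c => by
    rw [← MvPolynomial.coeff_coe, hP, coeff_killCompl]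
  have hrange : d ∈ Set.range (Finsupp.embDomain e) := by
    rw [Finsupp.mem_range_embDomain_iff]
    intro x hx
    obtain ⟨i, hi⟩ := he x hx
    exact ⟨_, hi⟩
  obtain ⟨d₀, rfl⟩ := hrange
  refine hd ((hco d₀).symm.trans (eq_zero_of_aeval_specPoint P ?_ d₀ ?_ ?_))
  · rw [← specialize_eq_aeval e f P hP, h n hn e]
  · intro i
    by_contra hi
    obtain ⟨j, hj⟩ := he (e (Sum.inr i)) (by
      rw [Finsupp.mem_support_iff, Finsupp.embDomain_apply_self]
      exact hi)
    have := e.injective hj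
    simp at this
  · intro c hc
    rw [MvPolynomial.mem_support_iff, hco] at hc
    have := hmax _ hc
    rwa [degree_embDomain, degree_embDomain] at this

end Specialization

/-! ### The universal one-row functions -/

section RowSeries

open MvPowerSeries

variable {κ σ : Type*}

variable (σ) in
/-- The one-row functions, the coefficients of `∏ (1 + x u) / (1 - x u)`. -/
def rowSeries (R : Type*) [CommRing R] (r : ℕ) : MvPowerSeries σ R :=
  fun d => if d.degree = r then 2 ^ d.support.card else 0

lemma coeff_rowSeries {R : Type*} [CommRing R] (r : ℕ) (d : σ →₀ ℕ) :
    coeff d (rowSeries σ R r) = if d.degree = r then 2 ^ d.support.card else 0 := rfl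

lemma rowSeries_zero {R : Type*} [CommRing R] : rowSeries σ R 0 = 1 := by
  classical
  ext d
  rw [coeff_rowSeries, coeff_one]
  by_cases h : d = 0
  · simp [h]
  · rw [if_neg h, if_neg]
    rwa [Finsupp.degree_eq_zero_iff]

lemma map_rowSeries {R R' : Type*} [CommRing R] [CommRing R'] (f : R →+* R') (r : ℕ) :
    MvPowerSeries.map f (rowSeries σ R r) = rowSeries σ R' r := by
  ext d
  rw [coeff_map, coeff_rowSeries, coeff_rowSeries]
  split_ifs <;> simp [map_ofNat f 2]

lemma killCompl_rowSeries {R : Type*} [CommRing R] (e : κ ↪ σ) (r : ℕ) :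
    killCompl e (rowSeries σ R r) = rowSeries κ R r := by
  ext d
  rw [coeff_killCompl, coeff_rowSeries, coeff_rowSeries, degree_embDomain,
    Finsupp.support_embDomain, Finset.card_map]

lemma isSymmetricFunction_rowSeries (r : ℕ) : IsSymmetricFunction (rowSeries σ ℚ r) := by
  rw [isSymmetricFunction_iff]
  refine ⟨⟨r, fun d hd => ?_⟩, fun p => killCompl_rowSeries _ r⟩
  rw [coeff_rowSeries, if_neg (by omega)]

/-- The power series `(1 + a u) / (1 - a u)`. -/
def geomSeries {F : Type*} [Field F] (a : F) : PowerSeries F :=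
  PowerSeries.mk fun m => if m = 0 then 1 else 2 * a ^ m

lemma one_sub_mul_geomSeries {F : Type*} [Field F] (a : F) :
    (1 - PowerSeries.C a * PowerSeries.X) * geomSeries a =
      1 + PowerSeries.C a * PowerSeries.X := by
  ext m
  rw [sub_mul, one_mul, mul_assoc, mul_comm PowerSeries.X, map_sub, map_add,
    PowerSeries.coeff_C_mul, PowerSeries.coeff_C_mul, PowerSeries.coeff_one, PowerSeries.coeff_X]
  rcases m with _ | _ | m
  · simp [geomSeries]
  · rw [PowerSeries.coeff_succ_mul_X]
    simp [geomSeries]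
    ring
  · rw [PowerSeries.coeff_succ_mul_X]
    simp [geomSeries]
    ring

variable {n : ℕ}

lemma specialize_rowSeries_eq_coeff (e : Fin n ⊕ Fin n ↪ σ) (r : ℕ) :
    specialize e (rowSeries σ ℚ r) =
      PowerSeries.coeff r (∏ k, geomSeries (specPoint n k)) := by
  classical
  rw [specialize_eq, killCompl_rowSeries, PowerSeries.coeff_prod]
  rw [finsum_eq_sum_of_support_subset (s := Finset.finsuppAntidiag Finset.univ r)]
  · refine Finset.sum_congr rfl fun d hd => ?_
    rw [Finset.mem_finsuppAntidiag] at hd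
    rw [coeff_rowSeries, if_pos (by rw [Finsupp.degree_eq_sum]; exact hd.1), map_pow, map_ofNat]
    have h1 : (2 : RatFunField n) ^ d.support.card = ∏ k, if d k = 0 then 1 else 2 := by
      rw [← Finset.prod_const, ← Finset.prod_subset (Finset.subset_univ d.support)]
      · exact Finset.prod_congr rfl fun k hk => by rw [if_neg (Finsupp.mem_support_iff.mp hk)]
      · intro k _ hk
        rw [if_pos (Finsupp.notMem_support_iff.mp hk)]
    rw [h1, ← Finset.prod_mul_distrib]
    refine Finset.prod_congr rfl fun k _ => ?_
    rw [geomSeries, PowerSeries.coeff_mk]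
    split_ifs with h
    · simp [h]
    · rfl
  · intro d hd
    rw [Finset.mem_coe, Finset.mem_finsuppAntidiag]
    refine ⟨?_, Finset.subset_univ _⟩
    by_contra h
    apply hd
    dsimp only
    rw [coeff_rowSeries, if_neg (by rw [Finsupp.degree_eq_sum]; exact h), map_zero, zero_mul]

/-- The factors for x and 1/x multiply to (1 + zX + X²)/(1 - zX + X²), so the claim is
`prod_one_add_mul`. -/
theorem specialize_rowSeries (e : Fin n ⊕ Fin n ↪ σ) (r : ℕ) :
    specialize e (rowSeries σ ℚ r) = rowSum (xvar (n := n)) r := by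
  rw [specialize_rowSeries_eq_coeff]
  suffices h : ∏ k, geomSeries (specPoint n k) = PowerSeries.mk (rowSum (xvar (n := n))) by
    rw [h, PowerSeries.coeff_mk]
  have h1 := prod_one_add_mul (isGeneric_xvar n)
  have h2 : ∏ k, ((1 - PowerSeries.C (specPoint n k) * PowerSeries.X) *
      geomSeries (specPoint n k)) =
      ∏ k, (1 + PowerSeries.C (specPoint n k) * PowerSeries.X) :=
    Finset.prod_congr rfl fun k _ => one_sub_mul_geomSeries _
  have h3 : ∀ i : Fin n, (PowerSeries.C (xvar i) * PowerSeries.C (xvar i)⁻¹ :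
      PowerSeries (RatFunField n)) = 1 := fun i => by
    rw [← map_mul, mul_inv_cancel₀ (xvar_ne_zero i), map_one]
  have h4 : ∀ i : Fin n, (PowerSeries.C (zvar xvar i) : PowerSeries (RatFunField n)) =
      PowerSeries.C (xvar i) + PowerSeries.C (xvar i)⁻¹ := fun i => by rw [zvar, map_add]
  have h5 : ∏ k, (1 + PowerSeries.C (specPoint n k) * PowerSeries.X) =
      ∏ i : Fin n, (1 + PowerSeries.C (zvar xvar i) * PowerSeries.X + PowerSeries.X ^ 2) := by
    rw [Fintype.prod_sum_type, ← Finset.prod_mul_distrib]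
    refine Finset.prod_congr rfl fun i _ => ?_
    simp only [specPoint, Sum.elim_inl, Sum.elim_inr, h4]
    linear_combination PowerSeries.X ^ 2 * h3 i
  have h6 : ∏ k, (1 - PowerSeries.C (specPoint n k) * PowerSeries.X) =
      ∏ i : Fin n, (1 - PowerSeries.C (zvar xvar i) * PowerSeries.X + PowerSeries.X ^ 2) := by
    rw [Fintype.prod_sum_type, ← Finset.prod_mul_distrib]
    refine Finset.prod_congr rfl fun i _ => ?_
    simp only [specPoint, Sum.elim_inl, Sum.elim_inr, h4]
    linear_combination PowerSeries.X ^ 2 * h3 i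
  rw [Finset.prod_mul_distrib, h5, ← h1, h6] at h2
  refine mul_left_cancel₀ (Finset.prod_ne_zero_iff.mpr fun i _ h => ?_) h2
  simpa using congrArg (PowerSeries.coeff 0) h

end RowSeries

/-! ### The universal Q-functions as Pfaffians -/

section UniversalQ

variable {σ : Type*}

/-- The parts, followed by `0` if their number is odd. -/
def StrictPartition.evenParts (mu : StrictPartition) : List ℕ :=
  mu.parts ++ if Even mu.parts.length then [] else [0]

/-- The Pfaffian of two-row functions. -/
def pfaffianQ {S : Type*} [CommRing S] [Algebra ℚ S] (q : ℕ → S) (mu : StrictPartition) : S :=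
  pfaffian (Matrix.of fun i j : Fin mu.evenParts.length =>
    pairQ q (mu.evenParts.get i) (mu.evenParts.get j))

lemma map_pfaffianQ {S S' : Type*} [CommRing S] [Algebra ℚ S] [CommRing S'] [Algebra ℚ S']
    (f : S →ₐ[ℚ] S') (q : ℕ → S) (mu : StrictPartition) :
    f (pfaffianQ q mu) = pfaffianQ (fun k => f (q k)) mu := by
  rw [pfaffianQ, map_pfaffian]
  congr 1
  ext i j
  exact map_pairQ (f : S →+* S') q _ _

variable (σ) in
/-- The one-row functions as elements of the algebra of symmetric functions. -/
def symmetricRow (k : ℕ) : symmetricFunctions σ :=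
  ⟨rowSeries σ ℚ k, isSymmetricFunction_rowSeries k⟩

lemma coe_pairQ_symmetricRow (r s : ℕ) :
    ((pairQ (symmetricRow σ) r s : symmetricFunctions σ) : MvPowerSeries σ ℚ) =
      pairQ (rowSeries σ ℚ) r s :=
  map_pairQ (symmetricFunctions σ).val.toRingHom (symmetricRow σ) r s

lemma specialize_pairQ {n : ℕ} (e : Fin n ⊕ Fin n ↪ σ) (r s : ℕ) :
    specialize e (pairQ (rowSeries σ ℚ) r s) =
      - kernelForm (zvar (xvar (n := n))) (rowVector (rowTerm xvar) r)
        (rowVector (rowTerm xvar) s) := by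
  rw [neg_kernelForm_rowVector (isGeneric_xvar n) zvar_xvar_add_ne_zero, ← coe_pairQ_symmetricRow]
  refine (map_pairQ (specializeHom e).toRingHom (symmetricRow σ) r s).trans ?_
  congr 1
  ext1 k
  exact specialize_rowSeries e k

lemma isUniversalQ_pfaffianQ (mu : StrictPartition) :
    IsUniversalQ mu (pfaffianQ (rowSeries σ ℚ) mu) := by
  have h1 := map_pfaffianQ (symmetricFunctions σ).val (symmetricRow σ) mu
  change _ = pfaffianQ (rowSeries σ ℚ) mu at h1
  rw [← h1]
  refine ⟨(pfaffianQ (symmetricRow σ) mu).2, fun n hn e => ?_⟩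
  rw [finiteQ_eq n mu hn]
  refine (map_pfaffianQ (specializeHom e) (symmetricRow σ) mu).trans ?_
  rw [seqSum, ← pfaffian_kernel (zvar xvar) (zvar_injective (isGeneric_xvar n))
    zvar_xvar_add_ne_zero (rowTerm xvar) mu.parts mu.evenParts mu.pos rfl, pfaffianQ]
  congr 1
  ext i j
  rw [Matrix.of_apply, Matrix.of_apply,
    neg_kernelForm_rowVector (isGeneric_xvar n) zvar_xvar_add_ne_zero]
  congr 1
  ext1 k
  exact specialize_rowSeries e k

/-- The Pfaffian proves existence, so the chosen function has the defining property; uniqueness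
follows because specializations separate symmetric functions. -/
theorem universalQ_eq [Infinite σ] (mu : StrictPartition) :
    universalQ σ mu = pfaffianQ (rowSeries σ ℚ) mu := by
  have h1 : IsUniversalQ mu (pfaffianQ (rowSeries σ ℚ) mu) := isUniversalQ_pfaffianQ mu
  have h2 : IsUniversalQ mu (universalQ σ mu) := Classical.epsilon_spec ⟨_, h1⟩
  let f : symmetricFunctions σ := ⟨_, h1.1⟩
  let g : symmetricFunctions σ := ⟨_, h2.1⟩
  have h3 : ((g - f : symmetricFunctions σ) : MvPowerSeries σ ℚ) = 0 := by
    refine eq_zero_of_specialize (g - f).2.1 mu.length fun n hn e => ?_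
    refine (map_sub (specializeHom e) g f).trans (sub_eq_zero.mpr ?_)
    exact (h2.2 n hn e).trans (h1.2 n hn e).symm
  exact sub_eq_zero.mp h3

/-- The recursion does not treat the two indices alike, so skew-symmetry is not visible from it. It
holds after every specialization, where the values come from an alternating form, and is then
transported from ℚ to R. -/
theorem pairQ_rowSeries_swap [Infinite σ] (R : Type*) [CommRing R] [Algebra ℚ R] (r s : ℕ) :
    pairQ (rowSeries σ R) r s = - pairQ (rowSeries σ R) s r := by
  have h0 : pairQ (rowSeries σ ℚ) r s = - pairQ (rowSeries σ ℚ) s r := by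
    set q := symmetricRow σ
    have h1 : ((pairQ q r s + pairQ q s r : symmetricFunctions σ) : MvPowerSeries σ ℚ) = 0 := by
      refine eq_zero_of_specialize (pairQ q r s + pairQ q s r).2.1 0 fun n hn e => ?_
      refine (map_add (specializeHom e) (pairQ q r s) (pairQ q s r)).trans ?_
      have h2 : ∀ r s, specializeHom e (pairQ q r s) = _ := fun r s =>
        (congrArg (specialize e) (coe_pairQ_symmetricRow r s)).trans (specialize_pairQ e r s)
      rw [h2, h2, ← (kernelForm_isAlt (zvar (xvar (n := n)))).neg_eq]
      ring
    rw [Subalgebra.coe_add, coe_pairQ_symmetricRow, coe_pairQ_symmetricRow] at h1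
    exact eq_neg_of_add_eq_zero_left h1
  have h1 := congrArg (MvPowerSeries.map (σ := σ) (algebraMap ℚ R)) h0
  rw [map_neg, map_pairQ, map_pairQ] at h1
  simpa only [map_rowSeries] using h1

end UniversalQ

/-! ### Generating series and addition formula of the two-row functions -/

section PairComposition

open PowerSeries

variable {S : Type*} [CommRing S]

/-- The generating series of a matrix, the column index being the exponent of the outer
variable. -/
def matrixSeries (K : ℕ → ℕ → S) : S⟦X⟧⟦X⟧ := mk fun s => mk fun r => K r s

lemma matrixSeries_add (K K' : ℕ → ℕ → S) :
    matrixSeries K + matrixSeries K' = matrixSeries fun r s => K r s + K' r s := by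
  ext s r
  simp [matrixSeries]

lemma matrixSeries_injective : Function.Injective (matrixSeries (S := S)) := by
  intro K K' h
  ext r s
  simpa [matrixSeries] using congrArg (fun F => coeff r (coeff s F)) h

/-- The product of the generating series of `q` in the two variables. -/
def prodSeries (q : ℕ → S) : S⟦X⟧⟦X⟧ := C (mk q) * PowerSeries.map C (mk q)

lemma prodSeries_mul_matrixSeries (q : ℕ → S) (K : ℕ → ℕ → S) :
    prodSeries q * matrixSeries K = matrixSeries fun r s =>
      ∑ k ∈ Finset.range (r + 1), ∑ l ∈ Finset.range (s + 1), q (r - k) * q (s - l) * K k l := by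
  ext s r
  rw [prodSeries, mul_assoc, mul_comm, mul_comm (PowerSeries.map C (mk q)), coeff_mul_C, coeff_mul,
    Finset.Nat.sum_antidiagonal_eq_sum_range_succ_mk]
  simp only [matrixSeries, coeff_mk]
  refine Finset.sum_congr rfl fun k hk => ?_
  rw [coeff_mul, map_sum, Finset.sum_mul, Finset.Nat.sum_antidiagonal_eq_sum_range_succ_mk]
  refine Finset.sum_congr rfl fun l hl => ?_
  simp only [coeff_mk, coeff_map]
  rw [coeff_mul_C, coeff_mk]
  ring

lemma prodSeries_mul (q₁ q₂ q₃ : ℕ → S)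
    (h : ∀ r, q₃ r = ∑ k ∈ Finset.range (r + 1), q₁ k * q₂ (r - k)) :
    prodSeries q₃ = prodSeries q₁ * prodSeries q₂ := by
  have h1 : mk q₃ = mk q₁ * mk q₂ := by
    ext r
    rw [coeff_mk, coeff_mul, h, Finset.Nat.sum_antidiagonal_eq_sum_range_succ_mk]
    simp
  rw [prodSeries, prodSeries, prodSeries, h1, map_mul, map_mul]
  ring

/-- With inner variable u and outer variable v, the prefactors are uv(U + V) and uv(V - U) for U = u
+ 1/u, V = v + 1/v. Comparing coefficients gives the recursion; skew-symmetry is needed only near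
the boundary. -/
lemma matrixSeries_pairQ [Algebra ℚ S] (q : ℕ → S) (h0 : q 0 = 1)
    (hq : ∀ r s, pairQ q r s = - pairQ q s r) :
    (C X + X) * (1 + C X * X) * matrixSeries (pairQ q) =
      (C X - X) * (1 - C X * X) * (prodSeries q - 1) := by
  have h1 : ∀ s, pairQ q 1 (s + 2) = 2 * q (s + 3) + 2 * q (s + 1) - q (s + 2) * q 1 := by
    intro s
    rw [hq, pairQ]
    ring
  have h11 : q 1 * q 1 - 2 * q 2 = 0 := eq_zero_of_eq_neg_self (hq 1 1)
  have h2 : prodSeries q - 1 = matrixSeries fun r s =>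
      q r * q s - if r = 0 ∧ s = 0 then 1 else 0 := by
    ext s r
    rw [prodSeries, map_sub, map_sub, coeff_C_mul, coeff_map, coeff_mk, coeff_mul_C]
    simp only [matrixSeries, coeff_mk, coeff_one]
    by_cases hr : r = 0 <;> by_cases hs : s = 0 <;> simp [hr, hs]
  rw [h2]
  have h3 : ∀ F : S⟦X⟧⟦X⟧, (C X + X) * (1 + C X * X) * F =
      C X * F + F * X + C X * (C X * F) * X + C X * F * X * X := fun F => by ring
  have h4 : ∀ F : S⟦X⟧⟦X⟧, (C X - X) * (1 - C X * X) * F =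
      C X * F - F * X - C X * (C X * F) * X + C X * F * X * X := fun F => by ring
  rw [h3, h4]
  ext s r
  rcases s with _ | _ | s
  · rcases r with _ | _ | r <;>
      simp [matrixSeries, coeff_succ_X_mul, pairQ, h0]
  · rcases r with _ | _ | _ | r <;>
      simp [matrixSeries, coeff_succ_X_mul, coeff_succ_mul_X, pairQ, h0] <;> ring
  · rcases r with _ | _ | r
    · simp [matrixSeries, coeff_succ_mul_X, pairQ, h0]
    · rcases s with _ | s
      · simp [matrixSeries, coeff_succ_X_mul, coeff_succ_mul_X, pairQ, h0]
        linear_combination 2 * h11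
      · simp [matrixSeries, coeff_succ_X_mul, coeff_succ_mul_X, h0]
        rw [h1]
        simp [pairQ]
        ring
    · simp [matrixSeries, coeff_succ_X_mul, coeff_succ_mul_X, pairQ]
      ring

/-- For q₃ = q₁q₂ one has q₃q₃' - 1 = (q₁q₁' - 1) + q₁q₁'(q₂q₂' - 1), the prime marking the second
variable. The common prefactor is nonzero and cancels over a domain. -/
theorem pairQ_comp [IsDomain S] [Algebra ℚ S] (q₁ q₂ q₃ : ℕ → S) (h₁ : q₁ 0 = 1) (h₂ : q₂ 0 = 1)
    (hq₁ : ∀ r s, pairQ q₁ r s = - pairQ q₁ s r) (hq₂ : ∀ r s, pairQ q₂ r s = - pairQ q₂ s r)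
    (hq₃ : ∀ r s, pairQ q₃ r s = - pairQ q₃ s r)
    (h : ∀ r, q₃ r = ∑ k ∈ Finset.range (r + 1), q₁ k * q₂ (r - k)) (r s : ℕ) :
    pairQ q₃ r s = pairQ q₁ r s + ∑ k ∈ Finset.range (r + 1), ∑ l ∈ Finset.range (s + 1),
      q₁ (r - k) * q₁ (s - l) * pairQ q₂ k l := by
  have h₃ : q₃ 0 = 1 := by simp [h, h₁, h₂]
  suffices hs : matrixSeries (pairQ q₃) =
      matrixSeries (pairQ q₁) + prodSeries q₁ * matrixSeries (pairQ q₂) by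
    rw [prodSeries_mul_matrixSeries, matrixSeries_add] at hs
    exact congrFun (congrFun (matrixSeries_injective hs) r) s
  have hne : ((C X + X) * (1 + C X * X) : S⟦X⟧⟦X⟧) ≠ 0 := by
    intro h0
    have h5 := congrArg (fun F => coeff 0 F) h0
    simp at h5
  refine mul_left_cancel₀ hne ?_
  have e1 := matrixSeries_pairQ q₁ h₁ hq₁
  have e2 := matrixSeries_pairQ q₂ h₂ hq₂
  have e3 := matrixSeries_pairQ q₃ h₃ hq₃
  rw [prodSeries_mul q₁ q₂ q₃ h] at e3
  linear_combination e3 - e1 - prodSeries q₁ * e2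

end PairComposition

/-! ### Splitting the variables of a union -/

section Union

open MvPowerSeries

variable {σ τ : Type*}

/-- The exponents of the variables indexed by `σ`. -/
def leftPart (d : σ ⊕ τ →₀ ℕ) : σ →₀ ℕ := d.comapDomain Sum.inl Sum.inl_injective.injOn

/-- The exponents of the variables indexed by `τ`. -/
def rightPart (d : σ ⊕ τ →₀ ℕ) : τ →₀ ℕ := d.comapDomain Sum.inr Sum.inr_injective.injOn

lemma embDomain_inl_add_embDomain_inr (f : σ →₀ ℕ) (g : τ →₀ ℕ) (d : σ ⊕ τ →₀ ℕ) :
    f.embDomain Function.Embedding.inl + g.embDomain Function.Embedding.inr = d ↔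
      f = leftPart d ∧ g = rightPart d := by
  have h1 : ∀ x, f.embDomain (Function.Embedding.inl : σ ↪ σ ⊕ τ) (Sum.inl x) = f x := fun x =>
    Finsupp.embDomain_apply_self Function.Embedding.inl f x
  have h2 : ∀ x, f.embDomain (Function.Embedding.inl : σ ↪ σ ⊕ τ) (Sum.inr x) = 0 := fun x =>
    Finsupp.embDomain_of_notMem_range _ _ _ (by simp)
  have h3 : ∀ x, g.embDomain (Function.Embedding.inr : τ ↪ σ ⊕ τ) (Sum.inr x) = g x := fun x =>
    Finsupp.embDomain_apply_self Function.Embedding.inr g x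
  have h4 : ∀ x, g.embDomain (Function.Embedding.inr : τ ↪ σ ⊕ τ) (Sum.inl x) = 0 := fun x =>
    Finsupp.embDomain_of_notMem_range _ _ _ (by simp)
  simp only [DFunLike.ext_iff, Finsupp.add_apply, Sum.forall, h1, h2, h3, h4, add_zero, zero_add]
  rfl

lemma coeff_inX_mul_inY {R : Type*} [CommRing R] (f : MvPowerSeries σ R) (g : MvPowerSeries τ R)
    (d : σ ⊕ τ →₀ ℕ) : coeff d (inX τ f * inY σ g) =
      coeff (leftPart d) f * coeff (rightPart d) g := by
  classical
  rw [coeff_mul, Finset.sum_eq_single ((leftPart d).embDomain Function.Embedding.inl,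
    (rightPart d).embDomain Function.Embedding.inr)]
  · rw [inX, inY, coeff_embDomain_rename, coeff_embDomain_rename]
  · rintro ⟨x, y⟩ hxy hne
    rw [Finset.HasAntidiagonal.mem_antidiagonal] at hxy
    by_cases hx : x ∈ Set.range (Finsupp.mapDomain (Function.Embedding.inl : σ ↪ σ ⊕ τ))
    · by_cases hy : y ∈ Set.range (Finsupp.mapDomain (Function.Embedding.inr : τ ↪ σ ⊕ τ))
      · obtain ⟨x, rfl⟩ := hx
        obtain ⟨y, rfl⟩ := hy
        rw [← Finsupp.embDomain_eq_mapDomain, ← Finsupp.embDomain_eq_mapDomain] at hxy hne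
        obtain ⟨rfl, rfl⟩ := (embDomain_inl_add_embDomain_inr x y d).mp hxy
        exact absurd rfl hne
      · rw [inY, coeff_rename_eq_zero _ _ hy, mul_zero]
    · rw [inX, coeff_rename_eq_zero _ _ hx, zero_mul]
  · intro h
    rw [Finset.HasAntidiagonal.mem_antidiagonal] at h
    exact absurd ((embDomain_inl_add_embDomain_inr _ _ d).mpr ⟨rfl, rfl⟩) h

/-- Degree and support size are both additive over the two sets of variables. -/
lemma rowSeries_sum {R : Type*} [CommRing R] (r : ℕ) : rowSeries (σ ⊕ τ) R r =
    ∑ k ∈ Finset.range (r + 1), inX τ (rowSeries σ R k) * inY σ (rowSeries τ R (r - k)) := by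
  ext d
  have hdeg : d.degree = (leftPart d).degree + (rightPart d).degree := by
    conv_lhs => rw [← (embDomain_inl_add_embDomain_inr _ _ d).mpr ⟨rfl, rfl⟩]
    rw [map_add, degree_embDomain, degree_embDomain]
  have hcard : d.support.card = (leftPart d).support.card + (rightPart d).support.card := by
    rw [← Finset.card_disjSum]
    congr 1
    ext (x | x) <;> simp [leftPart, rightPart]
  rw [map_sum]
  simp only [coeff_inX_mul_inY, coeff_rowSeries]
  by_cases h : d.degree = r
  · rw [if_pos h, Finset.sum_eq_single (leftPart d).degree]
    · rw [if_pos rfl, if_pos (by omega), hcard, pow_add]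
    · intro k _ hk
      rw [if_neg hk.symm, zero_mul]
    · intro hk
      rw [Finset.mem_range] at hk
      omega
  · rw [if_neg h, Finset.sum_eq_zero]
    intro k hk
    rw [Finset.mem_range] at hk
    by_cases h1 : (leftPart d).degree = k
    · rw [if_neg (c := (rightPart d).degree = _) (by omega), mul_zero]
    · rw [if_neg h1, zero_mul]

end Union

/-! ### Elementary symmetric polynomials with one parameter replaced by zero -/

section ElementarySymmetric

variable {S : Type*} [CommRing S]

lemma elemSymm_zero_right (a : ℕ → S) (m : ℕ) : elemSymm a m 0 = 1 := by
  simp [elemSymm]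

lemma elemSymm_self (a : ℕ → S) (m : ℕ) : elemSymm a m m = ∏ i ∈ Finset.range m, a i := by
  have h := Finset.powersetCard_self (Finset.range m)
  rw [Finset.card_range] at h
  rw [elemSymm, h, Finset.sum_singleton]

lemma elemSymm_succ (a : ℕ → S) (m k : ℕ) :
    elemSymm a (m + 1) (k + 1) = elemSymm a m (k + 1) + a m * elemSymm a m k := by
  rw [elemSymm, Finset.range_add_one, Finset.powersetCard_succ_insert Finset.notMem_range_self,
    Finset.sum_union, Finset.sum_image, elemSymm, elemSymm, Finset.mul_sum]
  · congr 1
    refine Finset.sum_congr rfl fun s hs => ?_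
    rw [Finset.prod_insert]
    intro h
    exact Finset.notMem_range_self ((Finset.mem_powersetCard.mp hs).1 h)
  · intro s hs t ht h
    have h1 : ∀ u ∈ Finset.powersetCard k (Finset.range m), m ∉ u := fun u hu hm =>
      Finset.notMem_range_self ((Finset.mem_powersetCard.mp hu).1 hm)
    rw [← Finset.erase_insert (h1 s hs), h, Finset.erase_insert (h1 t ht)]
  · rw [Finset.disjoint_left]
    intro s hs h
    obtain ⟨t, _, rfl⟩ := Finset.mem_image.mp h
    exact Finset.notMem_range_self
      ((Finset.mem_powersetCard.mp hs).1 (Finset.mem_insert_self m t))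

lemma map_elemSymm {S' : Type*} [CommRing S'] (f : S →+* S') (a : ℕ → S) (m k : ℕ) :
    f (elemSymm a m k) = elemSymm (fun i => f (a i)) m k := by
  simp [elemSymm]

/-- The parameters `0, a_{k+1}, a_{k+2}, ...`. -/
def shiftSeq (a : ℕ → S) (k : ℕ) : ℕ → S := fun i => if i = 0 then 0 else a (k + i)

lemma elemSymm_shiftSeq_self (a : ℕ → S) (k : ℕ) {s : ℕ} (hs : 0 < s) :
    elemSymm (shiftSeq a k) s s = 0 := by
  rw [elemSymm_self]
  exact Finset.prod_eq_zero (Finset.mem_range.mpr hs) (if_pos rfl)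

/-- Sum over the position of the `m`-th index which is not chosen. -/
lemma sum_elemSymm_shiftSeq (a : ℕ → S) (m p r : ℕ) (h : p + m ≤ r) :
    ∑ i ∈ Finset.range (p + 1), elemSymm (shiftSeq a (m + i)) (r - (m + i)) (p - i) *
      elemSymm a (m + i) i = elemSymm a r p := by
  induction r generalizing p with
  | zero =>
    obtain ⟨rfl, rfl⟩ : p = 0 ∧ m = 0 := by omega
    simp [elemSymm_zero_right]
  | succ r ih =>
    -- In the boundary case p + m = r there are only m unchosen indices. Every term but the last
    -- vanishes, since it takes all the parameters including the inserted 0.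
    rcases eq_or_lt_of_le h with h | h
    · rw [Finset.sum_range_succ, Finset.sum_eq_zero, zero_add, Nat.sub_self, elemSymm_zero_right,
        one_mul, ← h, add_comm]
      intro i hi
      rw [Finset.mem_range] at hi
      rw [show r + 1 - (m + i) = p - i by omega, elemSymm_shiftSeq_self a _ (by omega), zero_mul]
    · rcases p with _ | p
      · simp [elemSymm_zero_right]
      · rw [elemSymm_succ, ← ih (p + 1) (by omega), ← ih p (by omega),
          Finset.sum_range_succ _ (p + 1), Finset.sum_range_succ _ (p + 1), Finset.mul_sum,
          add_right_comm, ← Finset.sum_add_distrib, Nat.sub_self, elemSymm_zero_right,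
          elemSymm_zero_right]
        congr 1
        refine Finset.sum_congr rfl fun i hi => ?_
        rw [Finset.mem_range] at hi
        have h1 : shiftSeq a (m + i) (r - (m + i)) = a r := by
          rw [shiftSeq, if_neg (by omega)]
          congr 1
          omega
        rw [show r + 1 - (m + i) = r - (m + i) + 1 by omega, show p + 1 - i = p - i + 1 by omega,
          elemSymm_succ, h1]
        ring

end ElementarySymmetric

/-! ### Row functions as triangular operators -/

section TriangularMaps

variable {S : Type*} [CommRing S]

/-- The linear map with a given lower triangular matrix. -/
def triMap (c : ℕ → ℕ → S) : (ℕ →₀ S) →ₗ[S] (ℕ →₀ S) :=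
  Finsupp.linearCombination S fun r => ∑ k ∈ Finset.range (r + 1), Finsupp.single k (c r k)

lemma triMap_single (c : ℕ → ℕ → S) (r : ℕ) : triMap c (Finsupp.single r 1) =
    ∑ k ∈ Finset.range (r + 1), Finsupp.single k (c r k) := by
  simp [triMap]

lemma triMap_single_apply (c : ℕ → ℕ → S) (r m : ℕ) :
    triMap c (Finsupp.single r 1) m = if m ≤ r then c r m else 0 := by
  rw [triMap_single, Finsupp.finsetSum_apply]
  simp [Finsupp.single_apply]

lemma triMap_triMap_apply (c d : ℕ → ℕ → S) (r m : ℕ) :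
    triMap c (triMap d (Finsupp.single r 1)) m =
      ∑ l ∈ Finset.range (r + 1), d r l * if m ≤ l then c l m else 0 := by
  rw [triMap_single, map_sum, Finsupp.finsetSum_apply]
  refine Finset.sum_congr rfl fun l _ => ?_
  have h : Finsupp.single l (d r l) = d r l • Finsupp.single l (1 : S) := by simp
  rw [h, map_smul, Finsupp.smul_apply, triMap_single_apply, smul_eq_mul]

lemma triMap_zero {c : ℕ → ℕ → S} (h : c 0 0 = 1) :
    triMap c (Finsupp.single 0 1) = Finsupp.single 0 1 := by
  rw [triMap_single]
  simp [h]

/-- The matrix of coefficients of factorial one-row functions. -/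
def factEntry (a : ℕ → S) (r k : ℕ) : S :=
  if k = 0 then if r = 0 then 1 else 0 else if k ≤ r then elemSymm a r (r - k) else 0

/-- The matrix of skew one-row functions. -/
def skewEntry (a q : ℕ → S) (r k : ℕ) : S :=
  if k = 0 then ∑ j ∈ Finset.range (r + 1), factEntry a r j * q j
  else ∑ j ∈ Finset.range (r - k + 1), elemSymm (shiftSeq a k) (r - k) (r - k - j) * q j

/-- The map given by the one-row functions. -/
abbrev rowMap (q : ℕ → S) : (ℕ →₀ S) →ₗ[S] (ℕ →₀ S) := triMap fun r k => q (r - k)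

/-- The map given by the coefficients of the factorial one-row functions. -/
abbrev factMap (a : ℕ → S) : (ℕ →₀ S) →ₗ[S] (ℕ →₀ S) := triMap (factEntry a)

/-- The map given by the skew one-row functions. -/
abbrev skewMap (a q : ℕ → S) : (ℕ →₀ S) →ₗ[S] (ℕ →₀ S) := triMap (skewEntry a q)

/-- The parameters act by a unitriangular change of basis which conjugates the Toeplitz map of q
into the map of skew one-row functions. For column 0 this is the definition of `skewEntry`; for the
others, comparing coefficients of each q_j gives `sum_elemSymm_shiftSeq`. -/
lemma rowMap_comp_factMap (a q : ℕ → S) : rowMap q ∘ₗ factMap a = factMap a ∘ₗ skewMap a q := by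
  refine Finsupp.lhom_ext' fun r => LinearMap.ext_ring (Finsupp.ext fun m => ?_)
  simp only [LinearMap.comp_apply, Finsupp.lsingle_apply]
  rw [triMap_triMap_apply, triMap_triMap_apply]
  rcases m with _ | m
  · rw [Finset.sum_eq_single (s := Finset.range (r + 1)) 0
      (f := fun l => skewEntry a q r l * if 0 ≤ l then factEntry a l 0 else 0)]
    · simp [skewEntry, factEntry]
    · intro k _ hk
      simp [factEntry, hk]
    · simp
  · by_cases hmr : m + 1 ≤ r
    · obtain ⟨p, rfl⟩ := Nat.exists_eq_add_of_le hmr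
      have h1 : ∀ f : ℕ → S, (∀ l < m + 1, f l = 0) →
          ∑ l ∈ Finset.range (m + 1 + p + 1), f l =
            ∑ i ∈ Finset.range (p + 1), f (m + 1 + i) := by
        intro f hf
        rw [add_assoc (m + 1), Finset.sum_range_add, Finset.sum_eq_zero (fun l hl =>
          hf l (Finset.mem_range.mp hl)), zero_add]
      rw [h1 _ fun l hl => by rw [if_neg (by omega), mul_zero],
        h1 _ fun l hl => by rw [if_neg (by omega), mul_zero]]
      have h2 : ∀ i ∈ Finset.range (p + 1), (skewEntry a q (m + 1 + p) (m + 1 + i) *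
          if m + 1 ≤ m + 1 + i then factEntry a (m + 1 + i) (m + 1) else 0) =
          ∑ j ∈ Finset.range (p - i + 1), q j * (elemSymm (shiftSeq a (m + 1 + i))
            (m + 1 + p - (m + 1 + i)) (p - j - i) * elemSymm a (m + 1 + i) i) := by
        intro i hi
        rw [if_pos (by omega), skewEntry, if_neg (by omega), factEntry, if_neg (by omega),
          if_pos (by omega), Finset.sum_mul]
        refine Finset.sum_congr (by congr 1; omega) fun j hj => ?_
        rw [show m + 1 + i - (m + 1) = i by omega,
          show m + 1 + p - (m + 1 + i) - j = p - j - i by omega]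
        ring
      rw [Finset.sum_congr rfl h2, Finset.sum_comm' (t' := Finset.range (p + 1))
        (s' := fun j => Finset.range (p - j + 1)) (by simp only [Finset.mem_range]; omega)]
      refine Finset.sum_congr rfl fun j hj => ?_
      rw [Finset.mem_range] at hj
      rw [← Finset.mul_sum, sum_elemSymm_shiftSeq a (m + 1) (p - j) _ (by omega), if_pos (by omega),
        factEntry, if_neg (by omega), if_pos (by omega), mul_comm]
      congr 2 <;> omega
    · rw [Finset.sum_eq_zero, Finset.sum_eq_zero]
      · intro l hl
        rw [Finset.mem_range] at hl
        rw [if_neg (by omega), mul_zero]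
      · intro l hl
        rw [Finset.mem_range] at hl
        rw [if_neg (by omega), mul_zero]

lemma factMap_zero (a : ℕ → S) : factMap a (Finsupp.single 0 1) = Finsupp.single 0 1 :=
  triMap_zero (by simp [factEntry])

lemma coordForm_zero_comp_factMap (a : ℕ → S) : coordForm S 0 ∘ₗ factMap a = coordForm S 0 := by
  refine Finsupp.lhom_ext' fun r => LinearMap.ext_ring ?_
  simp only [LinearMap.comp_apply, Finsupp.lsingle_apply, Finsupp.lapply_apply]
  rw [triMap_single_apply]
  simp [factEntry, Finsupp.single_apply]

lemma coordForm_zero_comp_skewMap (a q : ℕ → S) :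
    coordForm S 0 ∘ₗ skewMap a q = coordForm S 0 ∘ₗ rowMap q ∘ₗ factMap a := by
  rw [rowMap_comp_factMap, ← LinearMap.comp_assoc, coordForm_zero_comp_factMap]

/-- The two-row functions as a bilinear form. -/
def pairForm (q : ℕ → S) : LinearMap.BilinForm S (ℕ →₀ S) :=
  Finsupp.linearCombination S fun r => Finsupp.linearCombination S fun s => pairQ q r s

lemma pairForm_single (q : ℕ → S) (r s : ℕ) :
    pairForm q (Finsupp.single r 1) (Finsupp.single s 1) = pairQ q r s := by
  simp [pairForm]

/-- The properties of the sequence of one-row functions. -/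
structure IsRowSequence (q : ℕ → S) : Prop where
  zero : q 0 = 1
  swap : ∀ r s, pairQ q r s = - pairQ q s r

variable {q : ℕ → S}

lemma IsRowSequence.pairForm_isAlt [Algebra ℚ S] (hq : IsRowSequence q) : (pairForm q).IsAlt := by
  intro x
  apply eq_zero_of_eq_neg_self
  have h : pairForm q = - LinearMap.flip (pairForm q) := by
    refine Finsupp.lhom_ext' fun r => LinearMap.ext_ring ?_
    refine Finsupp.lhom_ext' fun s => LinearMap.ext_ring ?_
    simp only [LinearMap.comp_apply, Finsupp.lsingle_apply, LinearMap.neg_apply,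
      LinearMap.flip_apply, pairForm_single]
    exact hq.swap r s
  conv_lhs => rw [h]
  simp

/-- This is the compatibility with e_0 required by `fockMap_cliffordZero`; it dictates the values of
`pairQ` at index 0. -/
lemma IsRowSequence.pairForm_zero (hq : IsRowSequence q) :
    pairForm q (Finsupp.single 0 1) = coordForm S 0 - coordForm S 0 ∘ₗ rowMap q := by
  refine Finsupp.lhom_ext' fun s => LinearMap.ext_ring ?_
  simp only [LinearMap.comp_apply, Finsupp.lsingle_apply, LinearMap.sub_apply,
    Finsupp.lapply_apply, pairForm_single]
  rw [triMap_single_apply]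
  cases s <;> simp [pairQ, hq.zero]

lemma IsRowSequence.rowMap_zero (hq : IsRowSequence q) :
    rowMap q (Finsupp.single 0 1) = Finsupp.single 0 1 := triMap_zero hq.zero

lemma IsRowSequence.skewMap_zero (hq : IsRowSequence q) (a : ℕ → S) :
    skewMap a q (Finsupp.single 0 1) = Finsupp.single 0 1 :=
  triMap_zero (by simp [skewEntry, factEntry, hq.zero])

/-- The factorial two-row functions as a bilinear form. -/
def factForm (a q : ℕ → S) : LinearMap.BilinForm S (ℕ →₀ S) :=
  (pairForm q).comp (factMap a) (factMap a)

lemma IsRowSequence.factForm_isAlt [Algebra ℚ S] (hq : IsRowSequence q) (a : ℕ → S) :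
    (factForm a q).IsAlt :=
  fun x => hq.pairForm_isAlt (factMap a x)

/-- The change of basis preserves both e_0 and the coordinate form e_0*, so compatibility with e_0
is inherited from the case without parameters. -/
lemma IsRowSequence.factForm_zero (hq : IsRowSequence q) (a : ℕ → S) :
    factForm a q (Finsupp.single 0 1) = coordForm S 0 - coordForm S 0 ∘ₗ skewMap a q := by
  have h1 : factForm a q (Finsupp.single 0 1) =
      pairForm q (factMap a (Finsupp.single 0 1)) ∘ₗ factMap a := rfl
  rw [h1, factMap_zero, hq.pairForm_zero, LinearMap.sub_comp, coordForm_zero_comp_factMap,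
    coordForm_zero_comp_skewMap, LinearMap.comp_assoc]

/-- The entries of the matrix of factorial two-row functions. -/
def factPair (a q : ℕ → S) (r s : ℕ) : S :=
  ∑ k ∈ Finset.range (r + 1), ∑ l ∈ Finset.range (s + 1),
    factEntry a r k * factEntry a s l * pairQ q k l

lemma factForm_single (a q : ℕ → S) (r s : ℕ) :
    factForm a q (Finsupp.single r 1) (Finsupp.single s 1) = factPair a q r s := by
  have h1 : ∀ (k : ℕ) (c : S), Finsupp.single k c = c • Finsupp.single k (1 : S) := by simp
  rw [factForm, LinearMap.BilinForm.comp_apply, triMap_single, triMap_single, map_sum (pairForm q),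
    LinearMap.sum_apply, factPair]
  refine Finset.sum_congr rfl fun k _ => ?_
  rw [map_sum]
  refine Finset.sum_congr rfl fun l _ => ?_
  rw [h1 k, h1 l, map_smul, map_smul, LinearMap.smul_apply, pairForm_single, smul_eq_mul,
    smul_eq_mul]
  ring

end TriangularMaps

open ExteriorAlgebra

/-! ### Coefficients at the empty partition -/

section EmptyPartition

variable {S : Type*} [CommRing S]

/-- The empty partition. -/
def StrictPartition.empty : StrictPartition := ⟨[], List.Pairwise.nil, by simp⟩

lemma skewCoef_empty (x : ExteriorAlgebra S (ℕ →₀ S)) : skewCoef StrictPartition.empty x =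
    scalarPart x + scalarPart (contract (coordForm S 0) x) :=
  skewCoef_apply _ _

lemma skewCoef_empty_map {f : (ℕ →₀ S) →ₗ[S] (ℕ →₀ S)} (hf : coordForm S 0 ∘ₗ f = coordForm S 0)
    (x : ExteriorAlgebra S (ℕ →₀ S)) :
    skewCoef StrictPartition.empty (map f x) = skewCoef StrictPartition.empty x := by
  rw [skewCoef_empty, skewCoef_empty, contract_map, hf, scalarPart_map, scalarPart_map]

variable {K : LinearMap.BilinForm S (ℕ →₀ S)} (hK : K.IsAlt) (φ : (ℕ →₀ S) →ₗ[S] (ℕ →₀ S))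

lemma skewCoef_empty_row (r : ℕ) (hφ : φ (Finsupp.single 0 1) = Finsupp.single 0 1) :
    skewCoef StrictPartition.empty (fockMap hK φ (partWedge S (StrictPartition.row r))) =
      φ (Finsupp.single r 1) 0 := by
  rw [fockMap_apply, skewCoef_empty, partWedge, StrictPartition.row]
  split_ifs with h
  · simp [wedge, h, hφ, expContract_one]
  · have h1 : wedge S [r].reverse = ι S (Finsupp.single r (1 : S)) * 1 := by simp [wedge]
    rw [h1, expContract_ι_mul, expContract_one, contract_one, sub_zero, map_mul, map_one,
      map_apply_ι, scalarPart_ι_mul, contract_ι_mul, contract_one, mul_zero, sub_zero, map_smul,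
      scalarPart_one, smul_eq_mul, mul_one, zero_add]
    rfl

lemma skewCoef_empty_pair (lam : StrictPartition) (i j : Fin lam.parts.length) (h : i < j) :
    skewCoef StrictPartition.empty (fockMap hK φ (partWedge S (lam.pair i j h))) =
      K (Finsupp.single (lam.parts.get i) 1) (Finsupp.single (lam.parts.get j) 1) := by
  have h1 : partWedge S (lam.pair i j h) = ι S (Finsupp.single (lam.parts.get j) (1 : S)) *
      (ι S (Finsupp.single (lam.parts.get i) (1 : S)) * 1) := by
    simp [partWedge, wedge, StrictPartition.pair]
  have h2 : ∀ v : ℕ →₀ S, algebraMapInv (ι S v) = 0 := fun v => by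
    simpa using scalarPart_ι_mul v (1 : ExteriorAlgebra S (ℕ →₀ S))
  rw [fockMap_apply, skewCoef_empty, h1, expContract_ι_mul, expContract_ι_mul, expContract_one,
    contract_one, sub_zero, contract_ι_mul, contract_one, mul_zero, sub_zero, map_sub, map_mul,
    map_mul, map_apply_ι, map_apply_ι, map_smul, map_one, map_sub, map_sub, scalarPart_ι_mul,
    contract_ι_mul, contract_ι_mul, map_smul, contract_one, ← hK.neg_eq]
  simp [h2]

/-- A Pfaffian of two-row functions as a matrix coefficient. -/
lemma pfaffian_evenParts_eq [Algebra ℚ S] (hφ : φ (Finsupp.single 0 1) = Finsupp.single 0 1)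
    (hK0 : K (Finsupp.single 0 1) = coordForm S 0 - coordForm S 0 ∘ₗ φ) (mu : StrictPartition) :
    pfaffian (Matrix.of fun i j : Fin mu.evenParts.length =>
      K (Finsupp.single (mu.evenParts.get i) 1) (Finsupp.single (mu.evenParts.get j) 1)) =
    skewCoef StrictPartition.empty (fockMap hK φ (partWedge S mu)) := by
  have heven : Even mu.evenParts.length := by
    rw [StrictPartition.evenParts]
    split_ifs with h
    · simpa using h
    · rw [List.length_append, List.length_singleton, Nat.even_add_one]
      exact h
  have h1 : skewCoef StrictPartition.empty (fockMap hK φ (partWedge S mu)) =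
      skewCoef StrictPartition.empty (fockMap hK φ (wedge S mu.evenParts.reverse)) := by
    rw [StrictPartition.evenParts]
    split_ifs with h
    · rw [List.append_nil, partWedge]
    -- The additional entry 0 multiplies the wedge by e_0, which is the Clifford action and is
    -- invisible to the functional.
    · rw [← skewCoef_cliffordZero, ← fockMap_cliffordZero hK hφ hK0, cliffordZero_partWedge,
        partWedge, ← wedge_cons]
      simp
  rw [h1, pfaffian_gram_rev hK heven (fun i => Finsupp.single (mu.evenParts.get i) 1),
    ← wedge_reverse, skewCoef_empty, fockMap_apply, contract_map, scalarPart_map, scalarPart_map]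
  have h2 := scalarPart_eq_zero_of_odd hK [coordForm S 0 ∘ₗ φ]
    (mu.evenParts.reverse.map fun i => Finsupp.single i (1 : S)) (by
      rw [List.length_map, List.length_reverse, List.length_singleton, add_comm]
      exact heven.add_one)
  rw [List.map_map] at h2
  exact (add_eq_left.mpr h2).symm

end EmptyPartition

/-! ### Factorial functions and the minors of the change of basis -/

section FactorialExpansion

variable {S : Type*} [CommRing S]

lemma ιMulti_reverse (u : ℕ → (ℕ →₀ S)) (l : List ℕ) :
    (l.reverse.map fun r => ι S (u r)).prod =
      ιMulti S l.length fun i => u (l.get i.rev) := by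
  rw [ιMulti_apply]
  congr 1
  apply List.ext_getElem
  · simp
  · intro i h1 h2
    simp only [List.length_ofFn] at h2
    simp only [List.getElem_map, List.getElem_reverse, List.getElem_ofFn, List.get_eq_getElem,
      Fin.val_rev]
    congr 3
    omega

lemma part_eq_get (lam : StrictPartition) (i : Fin lam.parts.length) :
    lam.part i = lam.parts.get i := by
  simp [StrictPartition.part]

lemma map_partWedge (f : (ℕ →₀ S) →ₗ[S] (ℕ →₀ S)) (lam : StrictPartition) :
    map f (partWedge S lam) =
      ιMulti S lam.parts.length fun i => f (Finsupp.single (lam.parts.get i.rev) 1) := by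
  rw [← ιMulti_reverse fun r => f (Finsupp.single r 1), partWedge, wedge, map_list_prod,
    List.map_map]
  congr 1
  refine List.map_congr_left fun r _ => ?_
  simp

lemma contract_zero_map_factMap (a : ℕ → S) (lam : StrictPartition) :
    contract (coordForm S 0) (map (factMap a) (partWedge S lam)) = 0 := by
  rw [contract_map, coordForm_zero_comp_factMap, partWedge, contract_wedge_of_notMem, map_zero]
  simpa using lam.zero_notMem

lemma skewCoef_map_factMap_of_ne (a : ℕ → S) {lam mu : StrictPartition}
    (h : mu.length ≠ lam.length) :
    skewCoef mu (map (factMap a) (partWedge S lam)) = 0 := by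
  rw [skewCoef_apply, contract_zero_map_factMap, map_zero, map_zero, add_zero, map_partWedge,
    contractList_ιMulti_of_ne]
  simpa [StrictPartition.length] using h

/-- The coefficient of one wedge in the image of another is a minor. Only positive indices occur,
and on them `factEntry` agrees with the entries of `dCoeff`. -/
lemma skewCoef_map_factMap (a : ℕ → S) {lam mu : StrictPartition} (h : mu.length = lam.length) :
    skewCoef mu (map (factMap a) (partWedge S lam)) = dCoeff a lam mu := by
  have h1 : mu.parts.reverse.map (coordForm S) =
      List.ofFn fun j : Fin lam.parts.length => coordForm S (mu.part j.rev) := by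
    apply List.ext_getElem
    · simpa [StrictPartition.length] using h
    · intro i h1 h2
      simp only [List.length_ofFn] at h2
      have h3 : mu.parts.length = lam.parts.length := h
      simp only [List.getElem_map, List.getElem_reverse, List.getElem_ofFn, StrictPartition.part,
        Fin.val_rev]
      rw [List.getD_eq_getElem _ _ (by omega)]
      congr 2
      omega
  rw [skewCoef_apply, contract_zero_map_factMap, map_zero, map_zero, add_zero, map_partWedge, h1,
    contractList_ιMulti]
  have h2 : ∀ i j : Fin lam.parts.length,
      factMap a (Finsupp.single (lam.parts.get i.rev) 1) (mu.part j.rev) =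
        if mu.part j.rev ≤ lam.part i.rev then
          elemSymm a (lam.part i.rev) (lam.part i.rev - mu.part j.rev) else 0 := by
    intro i j
    have hj : (j.rev : ℕ) < mu.parts.length := lt_of_lt_of_eq j.rev.2 h.symm
    have hpos : mu.part j.rev ≠ 0 := by
      rw [StrictPartition.part, List.getD_eq_getElem _ _ hj]
      exact (mu.pos _ (List.getElem_mem hj)).ne'
    rw [triMap_single_apply, factEntry, if_neg hpos, ← part_eq_get]
    split_ifs <;> rfl
  exact (congrArg Matrix.det (Matrix.ext h2)).trans (Matrix.det_submatrix_equiv_self Fin.revPerm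
    (Matrix.of fun i j : Fin lam.parts.length => if mu.part j ≤ lam.part i then
      elemSymm a (lam.part i) (lam.part i - mu.part j) else 0))

lemma part_antitone (lam : StrictPartition) : Antitone lam.part := by
  intro i j hij
  simp only [StrictPartition.part]
  by_cases hj : j < lam.parts.length
  · rw [List.getD_eq_getElem _ _ hj, List.getD_eq_getElem _ _ (lt_of_le_of_lt hij hj)]
    rcases hij.eq_or_lt with rfl | hij
    · rfl
    · exact (List.pairwise_iff_getElem.mp lam.decreasing i j _ hj hij).le
  · rw [List.getD_eq_default _ _ (not_lt.mp hj)]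
    exact Nat.zero_le _

/-- If λ_k < μ_k, the entries in rows ≥ k and columns ≤ k vanish. By pigeonhole every permutation
meets this block. -/
lemma dCoeff_eq_zero (a : ℕ → S) {lam mu : StrictPartition} (h : mu.length = lam.length)
    (hc : ¬ lam.Contains mu) : dCoeff a lam mu = 0 := by
  rw [StrictPartition.Contains] at hc
  push Not at hc
  obtain ⟨k, hk⟩ := hc
  have hk' : k < lam.length := by
    rw [← h]
    by_contra hk'
    rw [StrictPartition.part, StrictPartition.part,
      List.getD_eq_default mu.parts _ (not_lt.mp hk')] at hk
    omega
  rw [dCoeff, Matrix.det_apply]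
  refine Finset.sum_eq_zero fun s _ => ?_
  obtain ⟨j, hj, hsj⟩ : ∃ j : Fin lam.length, j ≤ ⟨k, hk'⟩ ∧ ⟨k, hk'⟩ ≤ s j := by
    by_contra! hs
    have h1 := Finset.card_le_card_of_injOn s (s := Finset.Iic ⟨k, hk'⟩)
      (t := Finset.Iio ⟨k, hk'⟩) (fun j hj => by simpa using hs j (by simpa using hj))
      s.injective.injOn
    simp at h1
  rw [Finset.prod_eq_zero (Finset.mem_univ j), smul_zero]
  rw [Matrix.of_apply, if_neg]
  have h1 := part_antitone lam (show k ≤ (s j : ℕ) from hsj)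
  have h2 := part_antitone mu (show (j : ℕ) ≤ k from hj)
  omega

variable [Algebra ℚ S] {q : ℕ → S} (hq : IsRowSequence q) (a : ℕ → S)

include hq in
lemma pfaffianQ_eq (mu : StrictPartition) : pfaffianQ q mu = skewCoef StrictPartition.empty
    (fockMap hq.pairForm_isAlt (rowMap q) (partWedge S mu)) := by
  rw [← pfaffian_evenParts_eq _ _ hq.rowMap_zero hq.pairForm_zero, pfaffianQ]
  simp only [pairForm_single]

lemma map_factMap_fockMap (x : ExteriorAlgebra S (ℕ →₀ S)) :
    map (factMap a) (fockMap (hq.factForm_isAlt a) (skewMap a q) x) =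
      fockMap hq.pairForm_isAlt (rowMap q) (map (factMap a) x) := by
  rw [fockMap_apply, fockMap_apply, ← AlgHom.comp_apply, map_comp_map, ← rowMap_comp_factMap,
    ← map_comp_map, AlgHom.comp_apply]
  congr 1
  exact map_expContract hq.pairForm_isAlt (factMap a) _ x

/-- The change of basis can be moved from the outside, where the functional ignores it, to the
inside, where expanding the transformed wedge in partitions reproduces the defining sum. -/
theorem skewCoef_empty_eq_finsum (lam : StrictPartition) :
    skewCoef StrictPartition.empty
      (fockMap (hq.factForm_isAlt a) (skewMap a q) (partWedge S lam)) =
    ∑ᶠ mu ∈ {mu : StrictPartition | lam.Contains mu ∧ mu.length = lam.length},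
      dCoeff a lam mu * pfaffianQ q mu := by
  rw [← skewCoef_empty_map (coordForm_zero_comp_factMap a), map_factMap_fockMap hq]
  classical
  have h := (finite_and_expansion
    (skewCoef StrictPartition.empty ∘ₗ fockMap hq.pairForm_isAlt (rowMap q)) (fun x => by
      rw [LinearMap.comp_apply, fockMap_cliffordZero _ hq.rowMap_zero hq.pairForm_zero,
        skewCoef_cliffordZero, LinearMap.comp_apply]) (map (factMap a) (partWedge S lam))).2
  refine h.trans (finsum_congr fun mu => ?_)
  rw [LinearMap.comp_apply, ← pfaffianQ_eq hq, Set.mem_ofPred_eq]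
  by_cases hl : mu.length = lam.length
  · rw [skewCoef_map_factMap a hl]
    by_cases hc : lam.Contains mu
    · rw [finsum_eq_if, if_pos ⟨hc, hl⟩]
    · rw [finsum_eq_if, if_neg fun h => hc h.1, dCoeff_eq_zero a hl hc, zero_mul]
  · rw [skewCoef_map_factMap_of_ne a hl, zero_mul, finsum_eq_if, if_neg fun h => hl h.2]

end FactorialExpansion

/-! ### Base change of the block Pfaffians -/

section SkewPfaffians

variable {S : Type*} [CommRing S]

lemma map_factEntry {S' : Type*} [CommRing S'] (f : S →+* S') (a : ℕ → S) (r k : ℕ) :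
    f (factEntry a r k) = factEntry (fun i => f (a i)) r k := by
  rw [factEntry, factEntry]
  split_ifs <;> simp [map_elemSymm]

lemma map_factPair {S' : Type*} [CommRing S'] (f : S →+* S') (a q : ℕ → S) (r s : ℕ) :
    f (factPair a q r s) = factPair (fun i => f (a i)) (fun i => f (q i)) r s := by
  simp [factPair, map_factEntry, map_pairQ]

lemma map_skewEntry {S' : Type*} [CommRing S'] (f : S →+* S') (a q : ℕ → S) (r k : ℕ) :
    f (skewEntry a q r k) = skewEntry (fun i => f (a i)) (fun i => f (q i)) r k := by
  have h : (fun i => f (shiftSeq a k i)) = shiftSeq (fun i => f (a i)) k := by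
    ext i
    rw [shiftSeq, shiftSeq]
    split_ifs <;> simp
  rw [skewEntry, skewEntry]
  split_ifs <;> simp [map_elemSymm, map_factEntry, h]

variable [Algebra ℚ S]

/-- The block Pfaffian of factorial two-row and skew one-row functions. -/
def blockPfaffian (a q : ℕ → S) (lam mu : StrictPartition) : S :=
  pfaffian <| Matrix.reindex finSumFinEquiv finSumFinEquiv <|
    Matrix.fromBlocks
      (Matrix.of fun i j : Fin lam.parts.length =>
        factPair a q (lam.parts.get i) (lam.parts.get j))
      (Matrix.of fun (i : Fin lam.parts.length) (j : Fin (padded lam mu).length) =>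
        triMap (skewEntry a q) (Finsupp.single (lam.parts.get i) 1) ((padded lam mu).get j.rev))
      (-(Matrix.of fun (i : Fin lam.parts.length) (j : Fin (padded lam mu).length) =>
        triMap (skewEntry a q) (Finsupp.single (lam.parts.get i) 1)
          ((padded lam mu).get j.rev)).transpose) 0

lemma map_blockPfaffian {S' : Type*} [CommRing S'] [Algebra ℚ S'] (f : S →+* S') (a q : ℕ → S)
    (lam mu : StrictPartition) : f (blockPfaffian a q lam mu) =
      blockPfaffian (fun i => f (a i)) (fun i => f (q i)) lam mu := by
  refine (map_pfaffian f.toRatAlgHom _).trans ?_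
  rw [blockPfaffian]
  congr 1
  ext i j
  simp only [Matrix.map_apply, Matrix.reindex_apply, Matrix.submatrix_apply]
  rcases finSumFinEquiv.symm i with i | i <;> rcases finSumFinEquiv.symm j with j | j
  · exact map_factPair f a q _ _
  · simp only [Matrix.fromBlocks_apply₁₂, Matrix.of_apply, triMap_single_apply]
    split_ifs
    · exact map_skewEntry f a q _ _
    · exact map_zero f
  · simp only [Matrix.fromBlocks_apply₂₁, Matrix.neg_apply, Matrix.transpose_apply,
      Matrix.of_apply, triMap_single_apply]
    split_ifs
    · exact (map_neg f _).trans (congrArg _ (map_skewEntry f a q _ _))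
    · simp
  · exact map_zero f

theorem blockPfaffian_eq {q : ℕ → S} (hq : IsRowSequence q) (a : ℕ → S)
    (lam mu : StrictPartition) : blockPfaffian a q lam mu =
      skewCoef mu (fockMap (hq.factForm_isAlt a) (skewMap a q) (partWedge S lam)) := by
  rw [← pfaffian_eq_skewCoef, blockPfaffian]
  simp only [factForm_single]

end SkewPfaffians

/-! ### The composition law with parameters -/

section Composition

variable {S : Type*} [CommRing S]

/-- The coordinate at the largest index of the support is unchanged. -/
lemma triMap_injective {c : ℕ → ℕ → S} (hc : ∀ r, c r r = 1) : Function.Injective (triMap c) := by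
  rw [← LinearMap.ker_eq_bot, LinearMap.ker_eq_bot']
  intro x hx
  by_contra hne
  have hs : x.support.Nonempty := Finsupp.support_nonempty_iff.mpr hne
  have h1 := DFunLike.congr_fun hx (x.support.max' hs)
  rw [triMap, Finsupp.linearCombination_apply, Finsupp.sum, Finsupp.finsetSum_apply,
    Finset.sum_eq_single (x.support.max' hs)] at h1
  · have h2 := triMap_single_apply c (x.support.max' hs) (x.support.max' hs)
    rw [triMap_single, if_pos le_rfl, hc] at h2
    rw [Finsupp.smul_apply, h2, smul_eq_mul, mul_one] at h1
    exact Finsupp.mem_support_iff.mp (x.support.max'_mem hs) h1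
  · intro r hr hrm
    have h2 := triMap_single_apply c r (x.support.max' hs)
    rw [triMap_single, if_neg (lt_of_le_of_ne (x.support.le_max' r hr) hrm).not_ge] at h2
    rw [Finsupp.smul_apply, h2, smul_zero]
  · intro h
    exact absurd (x.support.max'_mem hs) h

lemma factMap_injective (a : ℕ → S) : Function.Injective (factMap a) := by
  refine triMap_injective fun r => ?_
  rw [factEntry]
  split_ifs <;> simp_all [elemSymm_zero_right]

variable {q₁ q₂ q₃ : ℕ → S}

lemma rowMap_comp (h : ∀ r, q₃ r = ∑ k ∈ Finset.range (r + 1), q₁ k * q₂ (r - k)) :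
    rowMap q₃ = rowMap q₂ ∘ₗ rowMap q₁ := by
  refine Finsupp.lhom_ext' fun r => LinearMap.ext_ring (Finsupp.ext fun m => ?_)
  simp only [LinearMap.comp_apply, Finsupp.lsingle_apply]
  rw [triMap_triMap_apply, triMap_single_apply]
  split_ifs with hm
  · obtain ⟨p, rfl⟩ := Nat.exists_eq_add_of_le hm
    rw [add_assoc, Finset.sum_range_add, Finset.sum_eq_zero, zero_add, h,
      ← Finset.sum_range_reflect]
    · rw [show m + p - m = p by omega]
      refine Finset.sum_congr rfl fun i hi => ?_
      rw [Finset.mem_range] at hi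
      rw [if_pos (by omega)]
      congr 2 <;> omega
    · intro l hl
      rw [if_neg (by simpa using hl), mul_zero]
  · refine (Finset.sum_eq_zero fun l hl => ?_).symm
    rw [Finset.mem_range] at hl
    rw [if_neg (by omega), mul_zero]

/-- Conjugation transfers multiplicativity from the Toeplitz maps; injectivity of the change of
basis replaces an inverse. -/
lemma skewMap_comp (h : ∀ r, q₃ r = ∑ k ∈ Finset.range (r + 1), q₁ k * q₂ (r - k)) (a : ℕ → S) :
    skewMap a q₃ = skewMap a q₂ ∘ₗ skewMap a q₁ := by
  have h1 : factMap a ∘ₗ skewMap a q₃ = factMap a ∘ₗ (skewMap a q₂ ∘ₗ skewMap a q₁) := by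
    rw [← rowMap_comp_factMap, rowMap_comp h, LinearMap.comp_assoc, rowMap_comp_factMap,
      ← LinearMap.comp_assoc, rowMap_comp_factMap, LinearMap.comp_assoc]
  exact LinearMap.ext fun x => factMap_injective a (LinearMap.congr_fun h1 x)

lemma pairForm_comp (h : ∀ r s, pairQ q₃ r s = pairQ q₁ r s + ∑ k ∈ Finset.range (r + 1),
      ∑ l ∈ Finset.range (s + 1), q₁ (r - k) * q₁ (s - l) * pairQ q₂ k l) :
    pairForm q₃ = pairForm q₁ + (pairForm q₂).comp (rowMap q₁) (rowMap q₁) := by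
  refine Finsupp.lhom_ext' fun r => LinearMap.ext_ring ?_
  refine Finsupp.lhom_ext' fun s => LinearMap.ext_ring ?_
  simp only [LinearMap.comp_apply, Finsupp.lsingle_apply, LinearMap.add_apply,
    LinearMap.BilinForm.comp_apply, pairForm_single]
  have h1 : ∀ (k : ℕ) (c : S), Finsupp.single k c = c • Finsupp.single k (1 : S) := by simp
  rw [triMap_single, triMap_single, map_sum (pairForm q₂), LinearMap.sum_apply, h]
  congr 1
  refine Finset.sum_congr rfl fun k _ => ?_
  rw [map_sum]
  refine Finset.sum_congr rfl fun l _ => ?_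
  rw [h1 k, h1 l, map_smul, map_smul, LinearMap.smul_apply, pairForm_single, smul_eq_mul,
    smul_eq_mul]
  ring

lemma factForm_comp (h : ∀ r s, pairQ q₃ r s = pairQ q₁ r s + ∑ k ∈ Finset.range (r + 1),
      ∑ l ∈ Finset.range (s + 1), q₁ (r - k) * q₁ (s - l) * pairQ q₂ k l) (a : ℕ → S) :
    factForm a q₃ = factForm a q₁ + (factForm a q₂).comp (skewMap a q₁) (skewMap a q₁) := by
  refine LinearMap.ext fun x => LinearMap.ext fun y => ?_
  have h1 : ∀ x, factMap a (skewMap a q₁ x) = rowMap q₁ (factMap a x) := fun x =>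
    (LinearMap.congr_fun (rowMap_comp_factMap a q₁) x).symm
  simp only [factForm, pairForm_comp h, LinearMap.BilinForm.comp_apply, LinearMap.add_apply, h1]

/-- The multiplicativity of q and the cocycle rule for two-row functions are exactly the hypotheses
of `skewCoef_fockMap_comp` after the change of basis. -/
theorem blockPfaffian_comp [Algebra ℚ S] (hq₁ : IsRowSequence q₁) (hq₂ : IsRowSequence q₂)
    (hq₃ : IsRowSequence q₃)
    (hsum : ∀ r, q₃ r = ∑ k ∈ Finset.range (r + 1), q₁ k * q₂ (r - k))
    (hpair : ∀ r s, pairQ q₃ r s = pairQ q₁ r s + ∑ k ∈ Finset.range (r + 1),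
      ∑ l ∈ Finset.range (s + 1), q₁ (r - k) * q₁ (s - l) * pairQ q₂ k l)
    (a : ℕ → S) (lam nu : StrictPartition) : blockPfaffian a q₃ lam nu =
      ∑ᶠ mu, blockPfaffian a q₁ lam mu * blockPfaffian a q₂ mu nu := by
  simp only [blockPfaffian_eq hq₁, blockPfaffian_eq hq₂, blockPfaffian_eq hq₃]
  exact skewCoef_fockMap_comp _ _ _ (skewMap_comp hsum a) (factForm_comp hpair a)
    (hq₂.skewMap_zero a) (hq₂.factForm_zero a) nu _

lemma IsRowSequence.map {S' : Type*} [CommRing S'] {q : ℕ → S} (hq : IsRowSequence q)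
    (f : S →+* S') : IsRowSequence fun i => f (q i) where
  zero := by rw [hq.zero, map_one]
  swap r s := by rw [← map_pairQ, hq.swap, map_neg, map_pairQ]

end Composition

/-! ### Universal functions and the union of two sets of variables -/

section Universal

open MvPowerSeries

variable {σ τ R : Type*} [CommRing R]

lemma isRowSequence_rowSeries (σ R : Type*) [Infinite σ] [CommRing R] [Algebra ℚ R] :
    IsRowSequence (rowSeries σ R) :=
  ⟨rowSeries_zero, pairQ_rowSeries_swap R⟩

variable (σ) in
/-- The parameters as constant power series. -/
def constSeq (a : ℕ → R) : ℕ → MvPowerSeries σ R := fun i => C (a i)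

lemma dCoeff_constSeq (a : ℕ → R) (lam mu : StrictPartition) :
    dCoeff (constSeq σ a) lam mu = C (dCoeff a lam mu) := by
  rw [dCoeff, dCoeff, RingHom.map_det]
  congr 1
  ext1 i j
  simp only [Matrix.of_apply, RingHom.mapMatrix_apply, Matrix.map_apply]
  split_ifs
  · exact (map_elemSymm C a _ _).symm
  · exact (map_zero C).symm

variable [Algebra ℚ R]

theorem factorialQ_eq [Infinite σ] (a : ℕ → R) (lam : StrictPartition) : factorialQ σ a lam =
    skewCoef StrictPartition.empty (fockMap
      ((isRowSequence_rowSeries σ R).factForm_isAlt (constSeq σ a))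
      (skewMap (constSeq σ a) (rowSeries σ R)) (partWedge _ lam)) := by
  rw [skewCoef_empty_eq_finsum (isRowSequence_rowSeries σ R), factorialQ]
  refine finsum_congr fun mu => finsum_congr fun _ => ?_
  rw [dCoeff_constSeq, universalQ_eq, smul_eq_C_mul]
  congr 1
  refine (map_pfaffianQ (MvPowerSeries.map (algebraMap ℚ R)).toRatAlgHom _ mu).trans ?_
  congr 1
  ext1 k
  exact map_rowSeries (algebraMap ℚ R) k

lemma factorialQ_row [Infinite σ] (a : ℕ → R) (r : ℕ) :
    factorialQ σ a (StrictPartition.row r) =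
      ∑ j ∈ Finset.range (r + 1), factEntry (constSeq σ a) r j * rowSeries σ R j := by
  rw [factorialQ_eq, skewCoef_empty_row _ _ _ ((isRowSequence_rowSeries σ R).skewMap_zero _),
    triMap_single_apply, if_pos (Nat.zero_le r), skewEntry, if_pos rfl]

lemma factorialQ_pair [Infinite σ] (a : ℕ → R) (lam : StrictPartition)
    (i j : Fin lam.parts.length) (h : i < j) : factorialQ σ a (lam.pair i j h) =
      factPair (constSeq σ a) (rowSeries σ R) (lam.parts.get i) (lam.parts.get j) := by
  rw [factorialQ_eq, skewCoef_empty_pair, factForm_single]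

lemma rowSkewR_eq [Infinite σ] (a : ℕ → R) (r k : ℕ) : rowSkewR σ a r k =
    triMap (skewEntry (constSeq σ a) (rowSeries σ R)) (Finsupp.single r 1) k := by
  rw [triMap_single_apply, rowSkewR, skewEntry]
  split_ifs with h0 h1 h2 h3 h4 h5 h6
  · exact factorialQ_row a r
  · omega
  · rw [factorialQ_row]
    have hs : constSeq σ (fun i => if i = 0 then 0 else a (k + i)) = shiftSeq (constSeq σ a) k := by
      ext1 i
      simp only [constSeq, shiftSeq]
      split_ifs <;> simp
    refine Finset.sum_congr rfl fun j hj => ?_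
    rw [Finset.mem_range] at hj
    rw [hs, factEntry]
    -- The constant term is absent from a one-row factorial function but formally present in
    -- `skewEntry`; there its coefficient vanishes because of the parameter 0.
    by_cases hj0 : j = 0
    · rw [if_pos hj0, if_neg (by omega), hj0, Nat.sub_zero, elemSymm_shiftSeq_self _ _ (by omega)]
    · rw [if_neg hj0, if_pos (by omega)]
  · omega
  · simp [h4, elemSymm_zero_right, rowSeries_zero]
  · omega
  · omega
  · rfl

theorem skewQ_eq [Infinite σ] (a : ℕ → R) (lam mu : StrictPartition) :
    skewQ σ a lam mu = blockPfaffian (constSeq σ a) (rowSeries σ R) lam mu := by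
  have hK : matK σ a lam = Matrix.of fun i j : Fin lam.parts.length =>
      factPair (constSeq σ a) (rowSeries σ R) (lam.parts.get i) (lam.parts.get j) := by
    have halt := (isRowSequence_rowSeries σ R).factForm_isAlt (constSeq σ a)
    ext1 i j
    rw [matK, Matrix.of_apply, Matrix.of_apply]
    split_ifs with h1 h2
    · exact factorialQ_pair a lam i j h1
    · rw [factorialQ_pair, ← factForm_single, ← factForm_single, halt.neg_eq]
    · obtain rfl : i = j := le_antisymm (not_lt.mp h2) (not_lt.mp h1)
      rw [← factForm_single, halt]
  have hM : matM σ a lam.parts (padded lam mu) =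
      Matrix.of fun (i : Fin lam.parts.length) (j : Fin (padded lam mu).length) =>
        triMap (skewEntry (constSeq σ a) (rowSeries σ R)) (Finsupp.single (lam.parts.get i) 1)
          ((padded lam mu).get j.rev) := by
    ext1 i j
    exact rowSkewR_eq a _ _
  rw [skewQ, hK, hM]
  rfl

theorem factorialQ_eq_skewQ [Infinite σ] (a : ℕ → R) (lam : StrictPartition) :
    factorialQ σ a lam = skewQ σ a lam StrictPartition.empty := by
  rw [factorialQ_eq, skewQ_eq, blockPfaffian_eq (isRowSequence_rowSeries σ R)]

theorem finite_skewQ_ne_zero [Infinite σ] (a : ℕ → R) (lam : StrictPartition) :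
    {mu : StrictPartition | skewQ σ a lam mu ≠ 0}.Finite := by
  simp only [skewQ_eq, blockPfaffian_eq (isRowSequence_rowSeries σ R)]
  exact (finite_and_expansion 0 (fun _ => rfl) _).1

variable (σ R) in
/-- `inX` as a ring homomorphism. -/
def inXHom (τ : Type*) : MvPowerSeries σ R →+* MvPowerSeries (σ ⊕ τ) R :=
  (MvPowerSeries.rename (Function.Embedding.inl : σ ↪ σ ⊕ τ)).toRingHom

variable (τ R) in
/-- `inY` as a ring homomorphism. -/
def inYHom (σ : Type*) : MvPowerSeries τ R →+* MvPowerSeries (σ ⊕ τ) R :=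
  (MvPowerSeries.rename (Function.Embedding.inr : τ ↪ σ ⊕ τ)).toRingHom

lemma inX_skewQ [Infinite σ] (a : ℕ → R) (lam mu : StrictPartition) :
    inX τ (skewQ σ a lam mu) =
      blockPfaffian (constSeq (σ ⊕ τ) a) (fun k => inXHom σ R τ (rowSeries σ R k)) lam mu := by
  rw [skewQ_eq]
  refine (map_blockPfaffian (inXHom σ R τ) _ _ lam mu).trans ?_
  congr 1
  ext1 i
  exact rename_C _ _

lemma inY_skewQ [Infinite τ] (a : ℕ → R) (lam mu : StrictPartition) :
    inY σ (skewQ τ a lam mu) =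
      blockPfaffian (constSeq (σ ⊕ τ) a) (fun k => inYHom τ R σ (rowSeries τ R k)) lam mu := by
  rw [skewQ_eq]
  refine (map_blockPfaffian (inYHom τ R σ) _ _ lam mu).trans ?_
  congr 1
  ext1 i
  exact rename_C _ _

/-- The addition formula needs a domain, which power series over R need not form. It is proved over
ℚ and mapped to R. -/
lemma pairQ_rowSeries_sum [Infinite σ] [Infinite τ] (r s : ℕ) :
    pairQ (rowSeries (σ ⊕ τ) R) r s = pairQ (fun k => inXHom σ R τ (rowSeries σ R k)) r s +
      ∑ k ∈ Finset.range (r + 1), ∑ l ∈ Finset.range (s + 1),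
        inXHom σ R τ (rowSeries σ R (r - k)) * inXHom σ R τ (rowSeries σ R (s - l)) *
          pairQ (fun k => inYHom τ R σ (rowSeries τ R k)) k l := by
  have := NoZeroDivisors.to_isDomain (MvPowerSeries (σ ⊕ τ) ℚ)
  have h1 := pairQ_comp (S := MvPowerSeries (σ ⊕ τ) ℚ)
    (fun k => inXHom σ ℚ τ (rowSeries σ ℚ k)) (fun k => inYHom τ ℚ σ (rowSeries τ ℚ k))
    (rowSeries (σ ⊕ τ) ℚ) ((isRowSequence_rowSeries σ ℚ).map _).zero
    ((isRowSequence_rowSeries τ ℚ).map _).zero ((isRowSequence_rowSeries σ ℚ).map _).swap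
    ((isRowSequence_rowSeries τ ℚ).map _).swap (isRowSequence_rowSeries (σ ⊕ τ) ℚ).swap
    rowSeries_sum r s
  have h2 := congrArg (MvPowerSeries.map (algebraMap ℚ R)) h1
  have hX : ∀ k, MvPowerSeries.map (algebraMap ℚ R) (inXHom σ ℚ τ (rowSeries σ ℚ k)) =
      inXHom σ R τ (rowSeries σ R k) := fun k => by
    rw [← map_rowSeries (algebraMap ℚ R) k]
    exact (rename_map _ _ _).symm
  have hY : ∀ k, MvPowerSeries.map (algebraMap ℚ R) (inYHom τ ℚ σ (rowSeries τ ℚ k)) =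
      inYHom τ R σ (rowSeries τ R k) := fun k => by
    rw [← map_rowSeries (algebraMap ℚ R) k]
    exact (rename_map _ _ _).symm
  simpa only [map_add, map_sum, map_mul, map_pairQ, map_rowSeries, hX, hY] using h2

theorem skewQ_sum [Infinite σ] [Infinite τ] (a : ℕ → R) (lam nu : StrictPartition) :
    skewQ (σ ⊕ τ) a lam nu = ∑ᶠ mu, inX τ (skewQ σ a lam mu) * inY σ (skewQ τ a mu nu) := by
  simp only [inX_skewQ, inY_skewQ]
  rw [skewQ_eq]
  exact blockPfaffian_comp ((isRowSequence_rowSeries σ R).map _)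
    ((isRowSequence_rowSeries τ R).map _) (isRowSequence_rowSeries (σ ⊕ τ) R) rowSeries_sum
    pairQ_rowSeries_sum _ lam nu

end Universal

end SymplecticQ

end

theorem mainTheorem6 {σ τ R : Type*} [Infinite σ] [Infinite τ] [CommRing R] [Algebra ℚ R]
    (a : ℕ → R) (lam nu : SymplecticQ.StrictPartition) :
    ({mu : SymplecticQ.StrictPartition | SymplecticQ.skewQ σ a lam mu ≠ 0}.Finite ∧
      SymplecticQ.factorialQ (σ ⊕ τ) a lam =
        ∑ᶠ mu : SymplecticQ.StrictPartition,
          SymplecticQ.inX τ (SymplecticQ.skewQ σ a lam mu) *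
            SymplecticQ.inY σ (SymplecticQ.factorialQ τ a mu)) ∧
    SymplecticQ.skewQ (σ ⊕ τ) a lam nu =
      ∑ᶠ mu : SymplecticQ.StrictPartition,
        SymplecticQ.inX τ (SymplecticQ.skewQ σ a lam mu) *
          SymplecticQ.inY σ (SymplecticQ.skewQ τ a mu nu) := by
  simp only [SymplecticQ.factorialQ_eq_skewQ]
  exact ⟨⟨SymplecticQ.finite_skewQ_ne_zero a lam, SymplecticQ.skewQ_sum a lam _⟩,
    SymplecticQ.skewQ_sum a lam nu⟩
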